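/- Let $k$ be a field of characteristic zero, $R$ a commutative $k$-algebra, and $L$ a Lie algebroid over $R$: a $k$-Lie algebra and $R$-module acting on $R$ with $(fl)(g)=f\,l(g)$, $l(fg)=l(f)g+f\,l(g)$, $[l,m](f)=l(m(f))-m(l(f))$ and $[l,fm]=l(f)m+f[l,m]$. Assume that $L$ is locally free of rank $d$ as an $R$-module. Let $U=\mathrm U_RL$ be its universal enveloping algebra, i.e. the unital $k$-algebra generated by $R$ and $L$ in which $R$ is multiplied as usual, $f\cdot l=fl$, $l\cdot f-f\cdot l=l(f)$ and $l\cdot m-m\cdot l=[l,m]$. It acts on $R$, and it is a cocommutative $R$-coalgebra for the left $R$-module structure, with $\epsilon_U(D)=D(1)$, $\Delta_U(1)=1\otimes 1$, $\Delta_U(l)=l\otimes 1+1\otimes l$ and $\Delta_U(DE)=\sum D_{(1)}E_{(1)}\otimes D_{(2)}E_{(2)}$. Let $J=\mathrm J_RL=\operatorname{Hom}_R(U,R)$ be the jet algebra, a commutative algebra under $(\alpha\beta)(D)=\sum\alpha(D_{(1)})\beta(D_{(2)})$ with unit $\epsilon_U$. Put $$1_1(r)(D)=r\,D(1),\qquad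 1_2(r)(D)=D(r),\qquad \epsilon(\alpha)=\alpha(1),$$ and let ${}^1\nabla,{}^2\nabla$ be the left $U$-module structures on $J$ given by ${}^1\nabla_r\alpha=r\alpha$ and $({}^1\nabla_l\alpha)(D)=l(\alpha(D))-\alpha(lD)$ for $r\in R$, $l\in L$, and $({}^2\nabla_E\alpha)(D)=\alpha(DE)$. Set $\langle\alpha,D\rangle_i=\epsilon({}^i\nabla_D\alpha)$. Regard $J$ as an $R$-$R$-bimodule, with $R$ acting on the left through $1_1$ and on the right through $1_2$, and as a topological ring with the $\ker\epsilon$-adic topology. Let $J\hat\otimes_RJ$ and $J\hat\otimes_RJ\hat\otimes_RJ$ be the corresponding completed bimodule tensor products. Then $1_1,1_2:R\to J$ and $\epsilon:J\to R$ are $k$-algebra morphisms, $J$ is complete and separated for the $\ker\epsilon$-adic topology, and there are a continuous $k$-algebra morphism $\Delta:J\to J\hat\otimes_RJ$, $\Delta(\alpha)=\sum\alpha_{(1)}\otimes\alpha_{(2)}$, and a $k$-algebra automorphism $S:J\to J$ which are uniquely determined by $$\sum\langle\alpha_{(1)},D\rangle_1\langle\alpha_{(2)},E\rangle_2=\epsilon({}^1\nabla_D{}^2\nabla_E\alpha),\qquad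 \langle S\alpha,D\rangle_1=\langle\alpha,D\rangle_2\qquad(D,E\in U,\ \alpha\in J).$$ More precisely, for every $\alpha$, $\Delta(\alpha)$ and $S(\alpha)$ are the only elements of $J\hat\otimes_RJ$ and of $J$ satisfying these identities for all $D,E$. These structures make $J$ the coordinate ring of a formal groupoid, i.e.: 1. $\epsilon$ and $\Delta$ are morphisms of $R$-$R$-bimodules, $S\circ 1_1=1_2$, $S\circ 1_2=1_1$ and $\epsilon\circ S=\epsilon$; 2. $\Delta$ is coassociative: $(\Delta\hat\otimes\mathrm{id})\circ\Delta=(\mathrm{id}\hat\otimes\Delta)\circ\Delta$; 3. $\epsilon\circ 1_1=\mathrm{id}_R=\epsilon\circ 1_2$; 4. $\sum 1_1(\epsilon(\alpha_{(1)}))\,\alpha_{(2)}=\alpha=\sum\alpha_{(1)}\,1_2(\epsilon(\alpha_{(2)}))$ for all $\alpha\in J$; 5. $\sum S(\alpha_{(1)})\,\alpha_{(2)}=1_2(\epsilon(\alpha))$ and $\sum\alpha_{(1)}\,S(\alpha_{(2)})=1_1(\epsilon(\alpha))$ for all $\alpha\in J$. Moreover $S^2=\mathrm{id}_J$. -/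

import Mathlib

open scoped TensorProduct

noncomputable section

/-! ### Complete commutative Hopf algebroids (coordinate rings of formal groupoids)

Throughout this part `A` is a commutative `k`-algebra with two "unit maps" `s t : R →ₐ[k] A` and a
"counit" `ε : A →ₐ[k] R`.  As an `R`-`R`-bimodule, `R` acts on the left of `A` through `s` and on
the right of `A` through `t`. -/

namespace FormalGroupoid

variable {k R A : Type*} [CommRing k] [CommRing R] [Algebra k R] [CommRing A] [Algebra k A]

/-- The relations `a t(r) ⊗ b = a ⊗ s(r) b`. -/
def rel₂ (s t : R →ₐ[k] A) : Ideal (A ⊗[k] A) :=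
  Ideal.span (Set.range fun r : R => t r ⊗ₜ[k] (1 : A) - (1 : A) ⊗ₜ[k] s r)

/-- The bimodule tensor product `A ⊗_R A`, as a commutative ring: the quotient of `A ⊗_k A` by the
relations `a t(r) ⊗ b = a ⊗ s(r) b`. -/
def Tensor₂ (s t : R →ₐ[k] A) : Type _ := (A ⊗[k] A) ⧸ rel₂ s t

instance (s t : R →ₐ[k] A) : CommRing (Tensor₂ s t) :=
  inferInstanceAs (CommRing ((A ⊗[k] A) ⧸ rel₂ s t))

instance (s t : R →ₐ[k] A) : Algebra k (Tensor₂ s t) :=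
  inferInstanceAs (Algebra k ((A ⊗[k] A) ⧸ rel₂ s t))

/-- The quotient map `A ⊗_k A → A ⊗_R A`. -/
def mk₂ (s t : R →ₐ[k] A) : A ⊗[k] A →ₐ[k] Tensor₂ s t := Ideal.Quotient.mkₐ k (rel₂ s t)

/-- The relations `a t(r) ⊗ b ⊗ c = a ⊗ s(r) b ⊗ c` and `a ⊗ b t(r) ⊗ c = a ⊗ b ⊗ s(r) c`. -/
def rel₃ (s t : R →ₐ[k] A) : Ideal (A ⊗[k] (A ⊗[k] A)) :=
  Ideal.span
    ((Set.range fun r : R =>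
        t r ⊗ₜ[k] ((1 : A) ⊗ₜ[k] (1 : A)) - (1 : A) ⊗ₜ[k] (s r ⊗ₜ[k] (1 : A))) ∪
      (Set.range fun r : R =>
        (1 : A) ⊗ₜ[k] (t r ⊗ₜ[k] (1 : A)) - (1 : A) ⊗ₜ[k] ((1 : A) ⊗ₜ[k] s r)))

/-- The bimodule tensor product `A ⊗_R A ⊗_R A`, as a commutative ring. -/
def Tensor₃ (s t : R →ₐ[k] A) : Type _ := (A ⊗[k] (A ⊗[k] A)) ⧸ rel₃ s t

instance (s t : R →ₐ[k] A) : CommRing (Tensor₃ s t) :=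
  inferInstanceAs (CommRing ((A ⊗[k] (A ⊗[k] A)) ⧸ rel₃ s t))

instance (s t : R →ₐ[k] A) : Algebra k (Tensor₃ s t) :=
  inferInstanceAs (Algebra k ((A ⊗[k] (A ⊗[k] A)) ⧸ rel₃ s t))

/-- The quotient map `A ⊗_k A ⊗_k A → A ⊗_R A ⊗_R A`. -/
def mk₃ (s t : R →ₐ[k] A) : A ⊗[k] (A ⊗[k] A) →ₐ[k] Tensor₃ s t :=
  Ideal.Quotient.mkₐ k (rel₃ s t)

/-- `a ↦ a ⊗ 1`. -/
def inl (s t : R →ₐ[k] A) : A →ₐ[k] Tensor₂ s t :=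
  (mk₂ s t).comp Algebra.TensorProduct.includeLeft

/-- `a ↦ 1 ⊗ a`. -/
def inr (s t : R →ₐ[k] A) : A →ₐ[k] Tensor₂ s t :=
  (mk₂ s t).comp Algebra.TensorProduct.includeRight

/-- `a ↦ a ⊗ 1 ⊗ 1`. -/
def in₁ (s t : R →ₐ[k] A) : A →ₐ[k] Tensor₃ s t :=
  (mk₃ s t).comp Algebra.TensorProduct.includeLeft

/-- `a ↦ 1 ⊗ a ⊗ 1`. -/
def in₂ (s t : R →ₐ[k] A) : A →ₐ[k] Tensor₃ s t :=
  (mk₃ s t).comp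
    (Algebra.TensorProduct.includeRight.comp Algebra.TensorProduct.includeLeft)

/-- `a ↦ 1 ⊗ 1 ⊗ a`. -/
def in₃ (s t : R →ₐ[k] A) : A →ₐ[k] Tensor₃ s t :=
  (mk₃ s t).comp
    (Algebra.TensorProduct.includeRight.comp Algebra.TensorProduct.includeRight)

/-- The ideal of `A ⊗_R A` generated by `ker ε ⊗ 1` and `1 ⊗ ker ε`. -/
def ideal₂ (s t : R →ₐ[k] A) (ε : A →ₐ[k] R) : Ideal (Tensor₂ s t) :=
  (RingHom.ker ε).map (inl s t) ⊔ (RingHom.ker ε).map (inr s t)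

/-- The ideal of `A ⊗_R A ⊗_R A` generated by `ker ε` in each of the three factors. -/
def ideal₃ (s t : R →ₐ[k] A) (ε : A →ₐ[k] R) : Ideal (Tensor₃ s t) :=
  (RingHom.ker ε).map (in₁ s t) ⊔ (RingHom.ker ε).map (in₂ s t) ⊔ (RingHom.ker ε).map (in₃ s t)

/-- The completed bimodule tensor product of two copies of `A`, where `A` carries the
`ker ε`-adic topology. -/
abbrev CTensor₂ (s t : R →ₐ[k] A) (ε : A →ₐ[k] R) : Type _ :=
  AdicCompletion (ideal₂ s t ε) (Tensor₂ s t)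

/-- The completed bimodule tensor product of three copies of `A`. -/
abbrev CTensor₃ (s t : R →ₐ[k] A) (ε : A →ₐ[k] R) : Type _ :=
  AdicCompletion (ideal₃ s t ε) (Tensor₃ s t)

/-- The canonical algebra map from a ring to its adic completion. -/
def ofₐ (k : Type*) {B : Type*} [CommRing k] [CommRing B] [Algebra k B] (I : Ideal B) :
    B →ₐ[k] AdicCompletion I B :=
  { algebraMap B (AdicCompletion I B) with
    commutes' := fun _ => rfl }

theorem ofₐ_apply {B : Type*} [CommRing B] [Algebra k B] (I : Ideal B) (b : B) :
    ofₐ k I b = AdicCompletion.of I B b := rfl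

/-- An algebra map to an adic completion is continuous if it maps the ideal of definition into the
ideal of topologically nilpotent elements, i.e. to zero modulo the ideal of definition. -/
def IsCts {B C : Type*} [CommRing B] [CommRing C] [Algebra k B] [Algebra k C]
    (I : Ideal B) (K : Ideal C) (f : B →ₐ[k] AdicCompletion K C) : Prop :=
  ∀ b ∈ I, AdicCompletion.evalₐ K 1 (f b) = 0

section extend

variable {B C : Type*} [CommRing B] [CommRing C] [Algebra k B] [Algebra k C]
  {I : Ideal B} {K : Ideal C}

theorem factor_evalₐ {m n : ℕ} (h : m ≤ n) (x : AdicCompletion K C) :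
    Ideal.Quotient.factor (Ideal.pow_le_pow_right h) (AdicCompletion.evalₐ K n x) =
      AdicCompletion.evalₐ K m x := by
  obtain ⟨c, rfl⟩ := AdicCompletion.mk_surjective K C x
  rw [AdicCompletion.evalₐ_mk, AdicCompletion.evalₐ_mk, Ideal.Quotient.factor_mk]
  exact (AdicCompletion.Ideal.mk_eq_mk K h c)

theorem IsCts.eval_pow {f : B →ₐ[k] AdicCompletion K C} (hf : IsCts I K f) (n : ℕ) :
    ∀ b ∈ I ^ n, AdicCompletion.evalₐ K n (f b) = 0 := by
  rcases n with _ | n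
  · intro b _
    obtain ⟨c, hc⟩ := Ideal.Quotient.mk_surjective (AdicCompletion.evalₐ K 0 (f b))
    rw [← hc]
    exact Ideal.Quotient.eq_zero_iff_mem.2 (by simp)
  have h1 : I ≤ (K.map (Ideal.Quotient.mk (K ^ (n + 1)))).comap
      ((AdicCompletion.evalₐ K (n + 1)).toRingHom.comp f.toRingHom) := by
    intro b hb
    obtain ⟨c, hc⟩ := Ideal.Quotient.mk_surjective (AdicCompletion.evalₐ K (n + 1) (f b))
    have h2 := hf b hb
    rw [← factor_evalₐ (Nat.le_add_left 1 n), ← hc, Ideal.Quotient.factor_mk,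
      Ideal.Quotient.eq_zero_iff_mem, pow_one] at h2
    rw [Ideal.mem_comap]
    change AdicCompletion.evalₐ K (n + 1) (f b) ∈ _
    rw [← hc]
    exact Ideal.mem_map_of_mem _ h2
  intro b hb
  have h3 := Ideal.le_comap_pow _ _ (Ideal.pow_right_mono h1 (n + 1) hb)
  rw [← Ideal.map_pow, Ideal.map_quotient_self] at h3
  exact h3

/-- The map `B̂ → C / K ^ n` induced by a continuous `f : B → Ĉ`. -/
def extendAux (f : B →ₐ[k] AdicCompletion K C) (hf : IsCts I K f) (n : ℕ) :
    AdicCompletion I B →ₐ[k] C ⧸ K ^ n :=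
  (Ideal.Quotient.liftₐ (I ^ n)
    (((AdicCompletion.evalₐ K n).restrictScalars k).comp f) (hf.eval_pow n)).comp
      ((AdicCompletion.evalₐ I n).restrictScalars k)

theorem extendAux_apply (f : B →ₐ[k] AdicCompletion K C) (hf : IsCts I K f) (n : ℕ)
    (x : AdicCompletion I B) (b : B)
    (hb : Ideal.Quotient.mk (I ^ n) b = AdicCompletion.evalₐ I n x) :
    extendAux f hf n x = AdicCompletion.evalₐ K n (f b) := by
  simp only [extendAux, AlgHom.comp_apply, AlgHom.restrictScalars_apply, ← hb]
  rfl

theorem extendAux_compat (f : B →ₐ[k] AdicCompletion K C) (hf : IsCts I K f) {m n : ℕ}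
    (h : m ≤ n) : (Ideal.Quotient.factorₐ k (Ideal.pow_le_pow_right h)).comp (extendAux f hf n) =
      extendAux f hf m := by
  refine AlgHom.ext fun x => ?_
  obtain ⟨b, hb⟩ := Ideal.Quotient.mk_surjective (AdicCompletion.evalₐ I n x)
  have hb' : Ideal.Quotient.mk (I ^ m) b = AdicCompletion.evalₐ I m x := by
    rw [← factor_evalₐ h, ← hb, Ideal.Quotient.factor_mk]
  rw [AlgHom.comp_apply, extendAux_apply f hf n x b hb, extendAux_apply f hf m x b hb']
  exact factor_evalₐ h (f b)

/-- The extension by continuity of `f : B → Ĉ` to the completion of `B`. -/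
def extend (f : B →ₐ[k] AdicCompletion K C) (hf : IsCts I K f) :
    AdicCompletion I B →ₐ[k] AdicCompletion K C :=
  AdicCompletion.liftAlgHom K (extendAux f hf) (extendAux_compat f hf)

theorem evalₐ_extend (f : B →ₐ[k] AdicCompletion K C) (hf : IsCts I K f) (n : ℕ)
    (x : AdicCompletion I B) : AdicCompletion.evalₐ K n (extend f hf x) = extendAux f hf n x :=
  AdicCompletion.evalₐ_liftAlgHom K (extendAux f hf) (extendAux_compat f hf) n x

/-- `extend f` does extend `f`. -/
theorem extend_of (f : B →ₐ[k] AdicCompletion K C) (hf : IsCts I K f) (b : B) :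
    extend f hf (AdicCompletion.of I B b) = f b :=
  AdicCompletion.ext_evalₐ fun n => by
    rw [evalₐ_extend, extendAux_apply f hf n _ b (AdicCompletion.evalₐ_of I n b).symm]

end extend

section lift

variable {s t : R →ₐ[k] A} {ε : A →ₐ[k] R}

theorem inl_t (r : R) : inl s t (t r) = inr s t (s r) :=
  (Ideal.Quotient.eq).2 (Ideal.subset_span ⟨r, rfl⟩)

theorem in₁_t (r : R) : in₁ s t (t r) = in₂ s t (s r) :=
  (Ideal.Quotient.eq).2 (Ideal.subset_span (Or.inl ⟨r, rfl⟩))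

theorem in₂_t (r : R) : in₂ s t (t r) = in₃ s t (s r) :=
  (Ideal.Quotient.eq).2 (Ideal.subset_span (Or.inr ⟨r, rfl⟩))

/-- The algebra map `a ⊗ b ↦ f a * g b` on `A ⊗_R A`. -/
def lift₂ {B : Type*} [CommRing B] [Algebra k B] (f g : A →ₐ[k] B)
    (h : ∀ r, f (t r) = g (s r)) : Tensor₂ s t →ₐ[k] B :=
  Ideal.Quotient.liftₐ (rel₂ s t) (Algebra.TensorProduct.productMap f g) (by
    have : rel₂ s t ≤ RingHom.ker (Algebra.TensorProduct.productMap f g) := by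
      refine Ideal.span_le.2 ?_
      rintro _ ⟨r, rfl⟩
      simp [RingHom.mem_ker, h]
    exact fun a ha => this ha)

theorem lift₂_inl {B : Type*} [CommRing B] [Algebra k B] (f g : A →ₐ[k] B)
    (h : ∀ r, f (t r) = g (s r)) (a : A) : lift₂ f g h (inl s t a) = f a := by
  change Algebra.TensorProduct.productMap f g (a ⊗ₜ 1) = f a
  simp

theorem lift₂_inr {B : Type*} [CommRing B] [Algebra k B] (f g : A →ₐ[k] B)
    (h : ∀ r, f (t r) = g (s r)) (a : A) : lift₂ f g h (inr s t a) = g a := by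
  change Algebra.TensorProduct.productMap f g (1 ⊗ₜ a) = g a
  simp

variable {C : Type*} [CommRing C] [Algebra k C] {K : Ideal C}

theorem isCts_lift₂ (f g : A →ₐ[k] AdicCompletion K C)
    (h : ∀ r, f (t r) = g (s r)) (hf : IsCts (RingHom.ker ε) K f)
    (hg : IsCts (RingHom.ker ε) K g) : IsCts (ideal₂ s t ε) K (lift₂ f g h) := by
  have : ideal₂ s t ε ≤ RingHom.ker
      (((AdicCompletion.evalₐ K 1).restrictScalars k).comp (lift₂ f g h)) := by
    refine sup_le ?_ ?_
    · refine Ideal.map_le_iff_le_comap.2 fun a ha => ?_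
      rw [Ideal.mem_comap, RingHom.mem_ker, AlgHom.comp_apply, lift₂_inl]
      exact hf a ha
    · refine Ideal.map_le_iff_le_comap.2 fun a ha => ?_
      rw [Ideal.mem_comap, RingHom.mem_ker, AlgHom.comp_apply, lift₂_inr]
      exact hg a ha
  exact fun b hb => this hb

/-- The continuous algebra map `a ⊗ b ↦ f a * g b` from the completion of `A ⊗_R A` to that of `C`,
for continuous algebra maps `f` and `g`. -/
def clift₂ (ε : A →ₐ[k] R) (f g : A →ₐ[k] AdicCompletion K C)
    (h : ∀ r, f (t r) = g (s r)) (hf : IsCts (RingHom.ker ε) K f)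
    (hg : IsCts (RingHom.ker ε) K g) : CTensor₂ s t ε →ₐ[k] AdicCompletion K C :=
  extend (lift₂ f g h) (isCts_lift₂ f g h hf hg)

theorem isCts_ofₐ {f : A →ₐ[k] C} (hf : ∀ a ∈ RingHom.ker ε, f a ∈ K) :
    IsCts (RingHom.ker ε) K ((ofₐ k K).comp f) := by
  intro a ha
  rw [AlgHom.comp_apply, ofₐ_apply, AdicCompletion.evalₐ_of, Ideal.Quotient.eq_zero_iff_mem,
    pow_one]
  exact hf a ha

theorem IsCts.comp_clift₂ {Δ : A →ₐ[k] CTensor₂ s t ε}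
    (hΔ : IsCts (RingHom.ker ε) (ideal₂ s t ε) Δ) (f g : A →ₐ[k] AdicCompletion K C)
    (h : ∀ r, f (t r) = g (s r)) (hf : IsCts (RingHom.ker ε) K f)
    (hg : IsCts (RingHom.ker ε) K g) :
    IsCts (RingHom.ker ε) K ((clift₂ ε f g h hf hg).comp Δ) := by
  intro a ha
  rw [AlgHom.comp_apply, clift₂, evalₐ_extend, extendAux, AlgHom.comp_apply,
    AlgHom.restrictScalars_apply, hΔ a ha, map_zero]

theorem clift₂_inl (f g : A →ₐ[k] AdicCompletion K C)
    (h : ∀ r, f (t r) = g (s r)) (hf : IsCts (RingHom.ker ε) K f)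
    (hg : IsCts (RingHom.ker ε) K g) (a : A) :
    clift₂ ε f g h hf hg (AdicCompletion.of _ _ (inl s t a)) = f a := by
  rw [clift₂, extend_of, lift₂_inl]

theorem clift₂_inr (f g : A →ₐ[k] AdicCompletion K C)
    (h : ∀ r, f (t r) = g (s r)) (hf : IsCts (RingHom.ker ε) K f)
    (hg : IsCts (RingHom.ker ε) K g) (a : A) :
    clift₂ ε f g h hf hg (AdicCompletion.of _ _ (inr s t a)) = g a := by
  rw [clift₂, extend_of, lift₂_inr]

end lift

section maps

variable (s t : R →ₐ[k] A) (ε : A →ₐ[k] R)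

theorem isCts_in₁ : IsCts (RingHom.ker ε) (ideal₃ s t ε) ((ofₐ k _).comp (in₁ s t)) :=
  isCts_ofₐ fun _ ha => Ideal.mem_sup_left (Ideal.mem_sup_left (Ideal.mem_map_of_mem _ ha))

theorem isCts_in₂ : IsCts (RingHom.ker ε) (ideal₃ s t ε) ((ofₐ k _).comp (in₂ s t)) :=
  isCts_ofₐ fun _ ha => Ideal.mem_sup_left (Ideal.mem_sup_right (Ideal.mem_map_of_mem _ ha))

theorem isCts_in₃ : IsCts (RingHom.ker ε) (ideal₃ s t ε) ((ofₐ k _).comp (in₃ s t)) :=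
  isCts_ofₐ fun _ ha => Ideal.mem_sup_right (Ideal.mem_map_of_mem _ ha)

theorem of_in₁_t (r : R) : ((ofₐ k (ideal₃ s t ε)).comp (in₁ s t)) (t r) =
    ((ofₐ k (ideal₃ s t ε)).comp (in₂ s t)) (s r) :=
  congrArg (ofₐ k _) (in₁_t r)

theorem of_in₂_t (r : R) : ((ofₐ k (ideal₃ s t ε)).comp (in₂ s t)) (t r) =
    ((ofₐ k (ideal₃ s t ε)).comp (in₃ s t)) (s r) :=
  congrArg (ofₐ k _) (in₂_t r)

/-- `a ⊗ b ↦ a ⊗ b ⊗ 1` on completed tensor products. -/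
def in₁₂ : CTensor₂ s t ε →ₐ[k] CTensor₃ s t ε :=
  clift₂ ε ((ofₐ k _).comp (in₁ s t)) ((ofₐ k _).comp (in₂ s t))
    (of_in₁_t s t ε) (isCts_in₁ s t ε) (isCts_in₂ s t ε)

/-- `a ⊗ b ↦ 1 ⊗ a ⊗ b` on completed tensor products. -/
def in₂₃ : CTensor₂ s t ε →ₐ[k] CTensor₃ s t ε :=
  clift₂ ε ((ofₐ k _).comp (in₂ s t)) ((ofₐ k _).comp (in₃ s t))
    (of_in₂_t s t ε) (isCts_in₂ s t ε) (isCts_in₃ s t ε)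

end maps

section structureMaps

variable {s t : R →ₐ[k] A} {ε : A →ₐ[k] R}

/-- `Δ` is a morphism of `R`-`R`-bimodules.  (For an algebra map this amounts to
`Δ(s r) = s r ⊗ 1` and `Δ(t r) = 1 ⊗ t r`.) -/
structure IsBimoduleMap (Δ : A →ₐ[k] CTensor₂ s t ε) : Prop where
  left : ∀ r a, Δ (s r * a) = AdicCompletion.of _ _ (inl s t (s r)) * Δ a
  right : ∀ a r, Δ (a * t r) = Δ a * AdicCompletion.of _ _ (inr s t (t r))

theorem IsBimoduleMap.map_s {Δ : A →ₐ[k] CTensor₂ s t ε} (h : IsBimoduleMap Δ) (r : R) :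
    Δ (s r) = AdicCompletion.of _ _ (inl s t (s r)) := by
  simpa using h.left r 1

theorem IsBimoduleMap.map_t {Δ : A →ₐ[k] CTensor₂ s t ε} (h : IsBimoduleMap Δ) (r : R) :
    Δ (t r) = AdicCompletion.of _ _ (inr s t (t r)) := by
  simpa using h.right 1 r

/-- `Δ ⊗ id` on completed tensor products. -/
def comulLeft (Δ : A →ₐ[k] CTensor₂ s t ε) (hb : IsBimoduleMap Δ)
    (hc : IsCts (RingHom.ker ε) (ideal₂ s t ε) Δ) : CTensor₂ s t ε →ₐ[k] CTensor₃ s t ε :=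
  clift₂ ε ((in₁₂ s t ε).comp Δ) ((ofₐ k _).comp (in₃ s t))
    (fun r => by
      rw [AlgHom.comp_apply, hb.map_t, in₁₂, clift₂_inr, of_in₂_t])
    (hc.comp_clift₂ _ _ _ _ _) (isCts_in₃ s t ε)

/-- `id ⊗ Δ` on completed tensor products. -/
def comulRight (Δ : A →ₐ[k] CTensor₂ s t ε) (hb : IsBimoduleMap Δ)
    (hc : IsCts (RingHom.ker ε) (ideal₂ s t ε) Δ) : CTensor₂ s t ε →ₐ[k] CTensor₃ s t ε :=
  clift₂ ε ((ofₐ k _).comp (in₁ s t)) ((in₂₃ s t ε).comp Δ)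
    (fun r => by
      rw [AlgHom.comp_apply (in₂₃ s t ε), hb.map_s, in₂₃, clift₂_inl, of_in₁_t])
    (isCts_in₁ s t ε) (hc.comp_clift₂ _ _ _ _ _)

theorem isCts_id : IsCts (RingHom.ker ε) (RingHom.ker ε) (ofₐ k (RingHom.ker ε)) :=
  isCts_ofₐ (f := AlgHom.id k A) fun _ ha => ha

/-- `a ⊗ b ↦ s(ε a) b`, with values in the `ker ε`-adic completion of `A`. -/
def counitLeft (hs : ∀ r, ε (s r) = r) (ht : ∀ r, ε (t r) = r) :
    CTensor₂ s t ε →ₐ[k] AdicCompletion (RingHom.ker ε) A :=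
  clift₂ ε ((ofₐ k _).comp (s.comp ε)) (ofₐ k _)
    (fun r => by simp [ht])
    (isCts_ofₐ fun a ha => by
      rw [RingHom.mem_ker] at ha ⊢
      rw [AlgHom.comp_apply, hs, ha])
    isCts_id

/-- `a ⊗ b ↦ a t(ε b)`, with values in the `ker ε`-adic completion of `A`. -/
def counitRight (hs : ∀ r, ε (s r) = r) (ht : ∀ r, ε (t r) = r) :
    CTensor₂ s t ε →ₐ[k] AdicCompletion (RingHom.ker ε) A :=
  clift₂ ε (ofₐ k _) ((ofₐ k _).comp (t.comp ε))
    (fun r => by simp [hs])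
    isCts_id
    (isCts_ofₐ fun a ha => by
      rw [RingHom.mem_ker] at ha ⊢
      rw [AlgHom.comp_apply, ht, ha])

/-- `a ⊗ b ↦ S(a) b`, with values in the `ker ε`-adic completion of `A`. -/
def antipodeLeft (S : A ≃ₐ[k] A) (hS : ∀ r, S (t r) = s r) (hε : ∀ a, ε (S a) = ε a) :
    CTensor₂ s t ε →ₐ[k] AdicCompletion (RingHom.ker ε) A :=
  clift₂ ε ((ofₐ k _).comp (S : A →ₐ[k] A)) (ofₐ k _)
    (fun r => by simp [hS])
    (isCts_ofₐ fun a ha => by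
      rw [RingHom.mem_ker] at ha ⊢
      exact (hε a).trans ha)
    isCts_id

/-- `a ⊗ b ↦ a S(b)`, with values in the `ker ε`-adic completion of `A`. -/
def antipodeRight (S : A ≃ₐ[k] A) (hS : ∀ r, S (s r) = t r) (hε : ∀ a, ε (S a) = ε a) :
    CTensor₂ s t ε →ₐ[k] AdicCompletion (RingHom.ker ε) A :=
  clift₂ ε (ofₐ k _) ((ofₐ k _).comp (S : A →ₐ[k] A))
    (fun r => by simp [hS])
    isCts_id
    (isCts_ofₐ fun a ha => by
      rw [RingHom.mem_ker] at ha ⊢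
      exact (hε a).trans ha)

end structureMaps

/-- The commutative `k`-algebra `A`, with unit maps `s, t : R → A`, counit `ε : A → R`,
comultiplication `Δ` to the completion of `A ⊗_R A`, and invertible antipode `S`, is the (complete)
coordinate ring of a formal groupoid.  The maps `s, t, ε, Δ, S` are bundled algebra morphisms. -/
structure IsFormalGroupoid (s t : R →ₐ[k] A) (ε : A →ₐ[k] R) (Δ : A →ₐ[k] CTensor₂ s t ε)
    (S : A ≃ₐ[k] A) : Prop where
  /-- `A` is complete and separated for the `ker ε`-adic topology. -/
  complete : IsAdicComplete (RingHom.ker ε) A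
  counit_s : ∀ r, ε (s r) = r
  counit_t : ∀ r, ε (t r) = r
  /-- `ε` is a morphism of `R`-`R`-bimodules. -/
  counit_bimodule : ∀ r a r', ε (s r * a * t r') = r * ε a * r'
  comul_bimodule : IsBimoduleMap Δ
  comul_cts : IsCts (RingHom.ker ε) (ideal₂ s t ε) Δ
  /-- `(Δ ⊗ id) ∘ Δ = (id ⊗ Δ) ∘ Δ`. -/
  coassoc : ∀ a, comulLeft Δ comul_bimodule comul_cts (Δ a) =
    comulRight Δ comul_bimodule comul_cts (Δ a)
  /-- `∑ s(ε(a₁)) a₂ = a`. -/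
  counit_comul : ∀ a, counitLeft counit_s counit_t (Δ a) = AdicCompletion.of _ _ a
  /-- `∑ a₁ t(ε(a₂)) = a`. -/
  comul_counit : ∀ a, counitRight counit_s counit_t (Δ a) = AdicCompletion.of _ _ a
  antipode_s : ∀ r, S (s r) = t r
  antipode_t : ∀ r, S (t r) = s r
  /-- The antipode is compatible with the counit (in particular it is continuous). -/
  counit_antipode : ∀ a, ε (S a) = ε a
  /-- `∑ S(a₁) a₂ = t(ε(a))`. -/
  antipode_comul : ∀ a, antipodeLeft S antipode_t counit_antipode (Δ a) =
    AdicCompletion.of _ _ (t (ε a))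
  /-- `∑ a₁ S(a₂) = s(ε(a))`. -/
  comul_antipode : ∀ a, antipodeRight S antipode_s counit_antipode (Δ a) =
    AdicCompletion.of _ _ (s (ε a))

end FormalGroupoid

set_option linter.unusedSectionVars false

/-! ### Enveloping algebras and jets of Lie algebroids -/

namespace LieAlgebroid

section Env

variable (k R L : Type*) [CommRing k] [CommRing R] [Algebra k R] [LieRing L] [LieAlgebra k L]
  [Module R L] [LieRingModule L R]

/-- The defining relations of the universal enveloping algebra of a Lie algebroid `L` over `R`, on
the generators `R ⊕ L`: the elements of `R` multiply as in `R` (with `1 ∈ R` being the unit), the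
commutator of elements of `R ⊕ L` is the Lie bracket `[(f, l), (g, m)] = (l(g) - m(f), [l, m])`, and
the product `f · l` of `f ∈ R` and `l ∈ L` is the element `f l` of `L`. -/
inductive EnvRel : FreeAlgebra k (R ⊕ L) → FreeAlgebra k (R ⊕ L) → Prop
  | scalar (c : k) :
      EnvRel (FreeAlgebra.ι k (Sum.inl (algebraMap k R c))) (algebraMap k _ c)
  | add_fn (f g : R) :
      EnvRel (FreeAlgebra.ι k (Sum.inl (f + g)))
        (FreeAlgebra.ι k (Sum.inl f) + FreeAlgebra.ι k (Sum.inl g))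
  | mul_fn (f g : R) :
      EnvRel (FreeAlgebra.ι k (Sum.inl (f * g)))
        (FreeAlgebra.ι k (Sum.inl f) * FreeAlgebra.ι k (Sum.inl g))
  | add_vec (l m : L) :
      EnvRel (FreeAlgebra.ι k (Sum.inr (l + m)))
        (FreeAlgebra.ι k (Sum.inr l) + FreeAlgebra.ι k (Sum.inr m))
  | smul_vec (f : R) (l : L) :
      EnvRel (FreeAlgebra.ι k (Sum.inr (f • l)))
        (FreeAlgebra.ι k (Sum.inl f) * FreeAlgebra.ι k (Sum.inr l))
  | lie_vec (l m : L) :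
      EnvRel (FreeAlgebra.ι k (Sum.inr ⁅l, m⁆))
        (FreeAlgebra.ι k (Sum.inr l) * FreeAlgebra.ι k (Sum.inr m) -
          FreeAlgebra.ι k (Sum.inr m) * FreeAlgebra.ι k (Sum.inr l))
  | lie_fn (l : L) (f : R) :
      EnvRel (FreeAlgebra.ι k (Sum.inl ⁅l, f⁆))
        (FreeAlgebra.ι k (Sum.inr l) * FreeAlgebra.ι k (Sum.inl f) -
          FreeAlgebra.ι k (Sum.inl f) * FreeAlgebra.ι k (Sum.inr l))

/-- The universal enveloping algebra `U_R L` of a Lie algebroid `L` over the `k`-algebra `R`. -/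
def Env : Type _ := RingQuot (EnvRel k R L)

instance : Ring (Env k R L) := inferInstanceAs (Ring (RingQuot (EnvRel k R L)))

instance : Algebra k (Env k R L) := inferInstanceAs (Algebra k (RingQuot (EnvRel k R L)))

namespace Env

/-- The quotient map from the free algebra. -/
def mk : FreeAlgebra k (R ⊕ L) →ₐ[k] Env k R L := RingQuot.mkAlgHom k (EnvRel k R L)

variable {k R L} in
theorem mk_rel {x y : FreeAlgebra k (R ⊕ L)} (h : EnvRel k R L x y) :
    mk k R L x = mk k R L y :=
  RingQuot.mkAlgHom_rel k h

/-- The canonical algebra map `R → U_R L`. -/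
def fn : R →ₐ[k] Env k R L :=
  AlgHom.mk' (RingHom.mk' (MonoidHom.mk ⟨fun f => mk k R L (FreeAlgebra.ι k (Sum.inl f)), by
      have := mk_rel (EnvRel.scalar (R := R) (L := L) (1 : k))
      simpa using this⟩ (fun f g => by
      have := mk_rel (EnvRel.mul_fn (k := k) (L := L) f g)
      simpa using this)) (fun f g => by
      have := mk_rel (EnvRel.add_fn (k := k) (L := L) f g)
      simpa using this)) (fun c f => by
      have h1 := mk_rel (EnvRel.scalar (R := R) (L := L) c)
      have h2 := mk_rel (EnvRel.mul_fn (k := k) (L := L) (algebraMap k R c) f)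
      rw [map_mul, h1, ← Algebra.smul_def, AlgHom.commutes, ← Algebra.smul_def] at h2
      exact h2)

/-- `U_R L` as an `R`-module, through left multiplication. -/
instance : Module R (Env k R L) := Module.compHom _ (fn k R L).toRingHom

variable {k R L}

theorem smul_def (r : R) (D : Env k R L) : r • D = fn k R L r * D := rfl

instance : IsScalarTower R (Env k R L) (Env k R L) :=
  ⟨fun r D E => by simp only [smul_def, smul_eq_mul, mul_assoc]⟩

instance : IsScalarTower k R (Env k R L) :=
  ⟨fun c r D => by simp only [smul_def, map_smul, smul_mul_assoc]⟩

variable (k R L) in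
/-- The canonical `R`-linear map `L → U_R L`. -/
def vec : L →ₗ[R] Env k R L where
  toFun l := mk k R L (FreeAlgebra.ι k (Sum.inr l))
  map_add' l m := by
    have := mk_rel (EnvRel.add_vec (k := k) (R := R) l m)
    simpa using this
  map_smul' f l := by
    have := mk_rel (EnvRel.smul_vec (k := k) f l)
    rw [map_mul] at this
    exact this

theorem vec_lie (l m : L) :
    vec k R L ⁅l, m⁆ = vec k R L l * vec k R L m - vec k R L m * vec k R L l := by
  have := mk_rel (EnvRel.lie_vec (k := k) (R := R) l m)
  rw [map_sub, map_mul, map_mul] at this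
  exact this

theorem fn_lie (l : L) (f : R) :
    fn k R L ⁅l, f⁆ = vec k R L l * fn k R L f - fn k R L f * vec k R L l := by
  have := mk_rel (EnvRel.lie_fn (k := k) l f)
  rw [map_sub, map_mul, map_mul] at this
  exact this

theorem vec_mul_fn (l : L) (f : R) :
    vec k R L l * fn k R L f = fn k R L ⁅l, f⁆ + fn k R L f * vec k R L l := by
  rw [fn_lie, sub_add_cancel]

theorem vec_mul_smul (l : L) (f : R) (D : Env k R L) :
    vec k R L l * (f • D) = ⁅l, f⁆ • D + f • (vec k R L l * D) := by
  rw [smul_def, smul_def, smul_def, ← mul_assoc, vec_mul_fn, add_mul, mul_assoc]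

theorem induction {p : Env k R L → Prop} (hfn : ∀ r, p (fn k R L r)) (hvec : ∀ l, p (vec k R L l))
    (hmul : ∀ D E, p D → p E → p (D * E)) (hadd : ∀ D E, p D → p E → p (D + E))
    (D : Env k R L) : p D := by
  obtain ⟨x, rfl⟩ := RingQuot.mkAlgHom_surjective k (EnvRel k R L) D
  change p (mk k R L x)
  induction x using FreeAlgebra.induction with
  | grade0 c =>
    rw [AlgHom.commutes, ← (fn k R L).commutes]
    exact hfn _
  | grade1 x =>
    rcases x with r | l
    · exact hfn r
    · exact hvec l
  | mul x y hx hy => rw [map_mul]; exact hmul _ _ hx hy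
  | add x y hx hy => rw [map_add]; exact hadd _ _ hx hy

section lift

variable {A : Type*} [Ring A] [Algebra k A] (φ : R →ₐ[k] A) (ψ : L →+ A)
  (h₁ : ∀ r l, ψ (r • l) = φ r * ψ l) (h₂ : ∀ l m, ψ ⁅l, m⁆ = ψ l * ψ m - ψ m * ψ l)
  (h₃ : ∀ l r, φ ⁅l, r⁆ = ψ l * φ r - φ r * ψ l)

/-- The universal property of `U_R L`. -/
def lift : Env k R L →ₐ[k] A :=
  RingQuot.liftAlgHom k ⟨FreeAlgebra.lift k (Sum.elim φ ψ), by
    intro x y h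
    induction h <;> simp [h₁, h₂, h₃]⟩

theorem lift_fn (r : R) : lift φ ψ h₁ h₂ h₃ (fn k R L r) = φ r := by
  refine (RingQuot.liftAlgHom_mkAlgHom_apply ..).trans ?_
  simp

theorem lift_vec (l : L) : lift φ ψ h₁ h₂ h₃ (vec k R L l) = ψ l := by
  refine (RingQuot.liftAlgHom_mkAlgHom_apply ..).trans ?_
  simp

end lift

end Env

end Env

section Connections

variable {k R L : Type*} [CommRing k] [CommRing R] [Algebra k R] [LieRing L] [LieAlgebra k L]
  [Module R L] [LieRingModule L R]

section

variable {M : Type*} [AddCommGroup M] [Module k M] [Module R M] [IsScalarTower k R M]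

variable (k R M) in
/-- Multiplication by elements of `R` on an `R`-module, as a map to `k`-linear endomorphisms. -/
def smulEnd : R →ₐ[k] Module.End k M := Algebra.lsmul k k M

theorem smulEnd_apply (r : R) (m : M) : smulEnd k R M r m = r • m := rfl

variable (k R L M) in
/-- Left `U_R L`-module structures on the `R`-module `M` that extend its `R`-module structure. -/
structure Rep where
  toEnd : Env k R L →ₐ[k] Module.End k M
  toEnd_fn : ∀ r m, toEnd (Env.fn k R L r) m = r • m

theorem Rep.vec_smul (ρ : Rep k R L M) (l : L) (r : R) (m : M) :
    ρ.toEnd (Env.vec k R L l) (r • m) = ⁅l, r⁆ • m + r • ρ.toEnd (Env.vec k R L l) m := by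
  rw [← ρ.toEnd_fn r m, ← Module.End.mul_apply, ← map_mul, Env.vec_mul_fn, map_add, map_mul,
    LinearMap.add_apply, Module.End.mul_apply, ρ.toEnd_fn, ρ.toEnd_fn]

/-- The left `U_R L`-module structure on an `R`-module `M` corresponding to a flat connection. -/
def Rep.mk' (conn : L →+ Module.End k M)
    (h₁ : ∀ (r : R) l m, conn (r • l) m = r • conn l m)
    (h₂ : ∀ l (r : R) m, conn l (r • m) = ⁅l, r⁆ • m + r • conn l m)
    (h₃ : ∀ l l' m, conn ⁅l, l'⁆ m = conn l (conn l' m) - conn l' (conn l m)) :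
    Rep k R L M where
  toEnd := Env.lift (smulEnd k R M) conn (fun r l => LinearMap.ext fun m => h₁ r l m)
    (fun l l' => LinearMap.ext fun m => h₃ l l' m)
    (fun l r => LinearMap.ext fun m => by
      rw [LinearMap.sub_apply, Module.End.mul_apply, Module.End.mul_apply, smulEnd_apply,
        smulEnd_apply, smulEnd_apply, h₂, add_sub_cancel_right])
  toEnd_fn r m := by rw [Env.lift_fn, smulEnd_apply]

theorem Rep.mk'_vec (conn : L →+ Module.End k M) (h₁ : ∀ (r : R) l m, conn (r • l) m = r • conn l m)
    (h₂ : ∀ l (r : R) m, conn l (r • m) = ⁅l, r⁆ • m + r • conn l m)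
    (h₃ : ∀ l l' m, conn ⁅l, l'⁆ m = conn l (conn l' m) - conn l' (conn l m)) (l : L) :
    (Rep.mk' conn h₁ h₂ h₃).toEnd (Env.vec k R L l) = conn l :=
  Env.lift_vec (smulEnd k R M) conn (fun r l => LinearMap.ext fun m => h₁ r l m)
    (fun l l' => LinearMap.ext fun m => h₃ l l' m)
    (fun l r => LinearMap.ext fun m => by
      rw [LinearMap.sub_apply, Module.End.mul_apply, Module.End.mul_apply, smulEnd_apply,
        smulEnd_apply, smulEnd_apply, h₂, add_sub_cancel_right]) l

variable {N P : Type*} [AddCommGroup N] [Module k N] [Module R N] [IsScalarTower k R N]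
  [AddCommGroup P] [Module k P] [Module R P] [IsScalarTower k R P]

/-- An `R`-linear map that commutes with the connections is `U_R L`-linear. -/
theorem Rep.map_of_vec (ρ : Rep k R L M) (σ : Rep k R L N) (φ : M →ₗ[R] N)
    (h : ∀ l m, φ (ρ.toEnd (Env.vec k R L l) m) = σ.toEnd (Env.vec k R L l) (φ m))
    (D : Env k R L) : ∀ m, φ (ρ.toEnd D m) = σ.toEnd D (φ m) := by
  induction D using Env.induction with
  | hfn r => intro m; rw [ρ.toEnd_fn, σ.toEnd_fn, map_smul]
  | hvec l => exact h l
  | hmul D E hD hE => intro m; rw [map_mul, map_mul, Module.End.mul_apply, hD, hE]; rfl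
  | hadd D E hD hE => intro m; simp only [map_add, LinearMap.add_apply, hD, hE]

/-- `l ↦ (m ⊗ n ↦ l m ⊗ n + m ⊗ l n)`, for a fixed `l`. -/
def tensorConnAux (ρ : Rep k R L M) (σ : Rep k R L N) (l : L) : M ⊗[R] N →+ M ⊗[R] N :=
  TensorProduct.liftAddHom
    (AddMonoidHom.mk' (fun m => AddMonoidHom.mk'
      (fun n => ρ.toEnd (Env.vec k R L l) m ⊗ₜ[R] n + m ⊗ₜ[R] σ.toEnd (Env.vec k R L l) n)
      (fun n n' => by simp only [TensorProduct.tmul_add, map_add]; abel))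
      (fun m m' => by
        ext n
        simp only [AddMonoidHom.mk'_apply, AddMonoidHom.add_apply, TensorProduct.add_tmul, map_add]
        abel))
    (fun r m n => by
      simp only [AddMonoidHom.mk'_apply, ρ.vec_smul, σ.vec_smul, TensorProduct.add_tmul,
        TensorProduct.tmul_add, TensorProduct.smul_tmul]
      abel)

/-- The tensor product connection `l (m ⊗ n) = l m ⊗ n + m ⊗ l n`. -/
def tensorConn (ρ : Rep k R L M) (σ : Rep k R L N) : L →+ Module.End k (M ⊗[R] N) :=
  AddMonoidHom.mk' (fun l =>
    { toFun := tensorConnAux ρ σ l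
      map_add' := map_add _
      map_smul' := fun c x => by
        induction x using TensorProduct.induction_on with
        | zero => simp
        | add x y hx hy => simp only [smul_add, map_add, hx, hy]
        | tmul m n =>
          rw [TensorProduct.smul_tmul']
          simp only [tensorConnAux, TensorProduct.liftAddHom_tmul, AddMonoidHom.mk'_apply, map_smul,
            RingHom.id_apply, smul_add, TensorProduct.smul_tmul'] })
    (fun l l' => by
      refine LinearMap.ext fun x => ?_
      change tensorConnAux ρ σ (l + l') x = tensorConnAux ρ σ l x + tensorConnAux ρ σ l' x
      induction x using TensorProduct.induction_on with
      | zero => simp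
      | add x y hx hy => rw [map_add, hx, hy, map_add, map_add]; abel
      | tmul m n =>
        simp only [tensorConnAux, TensorProduct.liftAddHom_tmul, AddMonoidHom.mk'_apply, map_add,
          LinearMap.add_apply, TensorProduct.add_tmul, TensorProduct.tmul_add]
        abel)

theorem tensorConn_tmul (ρ : Rep k R L M) (σ : Rep k R L N) (l : L) (m : M) (n : N) :
    tensorConn ρ σ l (m ⊗ₜ n) =
      ρ.toEnd (Env.vec k R L l) m ⊗ₜ n + m ⊗ₜ σ.toEnd (Env.vec k R L l) n := rfl

/-- The tensor product of left `U_R L`-modules. -/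
def Rep.tensor (ρ : Rep k R L M) (σ : Rep k R L N) : Rep k R L (M ⊗[R] N) :=
  Rep.mk' (tensorConn ρ σ)
    (fun r l x => by
      induction x using TensorProduct.induction_on with
      | zero => simp
      | add x y hx hy => simp only [smul_add, map_add, hx, hy]
      | tmul m n =>
        simp only [tensorConn_tmul, map_smul, Env.smul_def, map_mul, Module.End.mul_apply,
          Rep.toEnd_fn, smul_add, TensorProduct.smul_tmul', TensorProduct.tmul_smul])
    (fun l r x => by
      induction x using TensorProduct.induction_on with
      | zero => simp
      | add x y hx hy => simp only [smul_add, map_add, hx, hy]; abel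
      | tmul m n =>
        rw [TensorProduct.smul_tmul', tensorConn_tmul, tensorConn_tmul, ρ.vec_smul,
          TensorProduct.add_tmul, smul_add]
        simp only [TensorProduct.smul_tmul']
        abel)
    (fun l l' x => by
      induction x using TensorProduct.induction_on with
      | zero => simp
      | add x y hx hy => simp only [map_add, hx, hy]; abel
      | tmul m n =>
        simp only [tensorConn_tmul, map_add, Env.vec_lie, map_sub, map_mul, LinearMap.sub_apply,
          Module.End.mul_apply, TensorProduct.sub_tmul, TensorProduct.tmul_sub]
        abel)

theorem Rep.tensor_vec (ρ : Rep k R L M) (σ : Rep k R L N) (l : L) (m : M) (n : N) :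
    (ρ.tensor σ).toEnd (Env.vec k R L l) (m ⊗ₜ n) =
      ρ.toEnd (Env.vec k R L l) m ⊗ₜ n + m ⊗ₜ σ.toEnd (Env.vec k R L l) n := by
  rw [Rep.tensor, Rep.mk'_vec, tensorConn_tmul]

end

variable (k R L)

/-- Left multiplication on `U_R L`. -/
def envRep : Rep k R L (Env k R L) where
  toEnd := Algebra.lmul k (Env k R L)
  toEnd_fn _ _ := rfl

/-- `Δ : U_R L → U_R L ⊗_R U_R L`, given by letting `U_R L` act on `1 ⊗ 1`.  It satisfies
`Δ(1) = 1 ⊗ 1`, `Δ(r D) = r Δ(D)` and `Δ(l D) = ∑ l D₁ ⊗ D₂ + D₁ ⊗ l D₂`, see below. -/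
def envComul : Env k R L →ₗ[R] Env k R L ⊗[R] Env k R L where
  toFun D := ((envRep k R L).tensor (envRep k R L)).toEnd D (1 ⊗ₜ 1)
  map_add' D E := by simp
  map_smul' r D := by
    rw [Env.smul_def, map_mul, Module.End.mul_apply, Rep.toEnd_fn, RingHom.id_apply]

variable {k R L} in
theorem envComul_mul (D E : Env k R L) :
    envComul k R L (D * E) =
      ((envRep k R L).tensor (envRep k R L)).toEnd D (envComul k R L E) := by
  change ((envRep k R L).tensor (envRep k R L)).toEnd (D * E) (1 ⊗ₜ 1) = _
  rw [map_mul]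
  rfl

theorem envComul_one : envComul k R L 1 = 1 ⊗ₜ 1 := by
  change ((envRep k R L).tensor (envRep k R L)).toEnd 1 (1 ⊗ₜ 1) = _
  rw [map_one]
  rfl

theorem envComul_fn (r : R) : envComul k R L (Env.fn k R L r) = Env.fn k R L r ⊗ₜ 1 := by
  have := (envComul k R L).map_smul r 1
  rw [envComul_one, Env.smul_def, mul_one, TensorProduct.smul_tmul', Env.smul_def, mul_one] at this
  exact this

theorem envComul_vec (l : L) :
    envComul k R L (Env.vec k R L l) = Env.vec k R L l ⊗ₜ 1 + 1 ⊗ₜ Env.vec k R L l := by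
  change ((envRep k R L).tensor (envRep k R L)).toEnd (Env.vec k R L l) (1 ⊗ₜ 1) = _
  rw [Rep.tensor_vec]
  change (Env.vec k R L l * 1) ⊗ₜ[R] 1 + 1 ⊗ₜ[R] (Env.vec k R L l * 1) = _
  rw [mul_one]

variable {k R L}

/-- Two `U_R L`-linear maps from `U_R L` that agree at `1` are equal. -/
theorem envRep_ext {M : Type*} [AddCommGroup M] [Module k M] [Module R M] [IsScalarTower k R M]
    (ρ : Rep k R L M) (φ ψ : Env k R L →ₗ[R] M)
    (hφ : ∀ D E, φ (D * E) = ρ.toEnd D (φ E)) (hψ : ∀ D E, ψ (D * E) = ρ.toEnd D (ψ E))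
    (h : φ 1 = ψ 1) : φ = ψ :=
  LinearMap.ext fun D => by rw [← mul_one D, hφ, hψ, h]

variable (k R L)
variable [LieRinehartRing R L] [LieRinehartAlgebra k R L]

/-- The action `D ↦ (f ↦ D(f))` of `U_R L` on `R` extending the action of `L` on `R`. -/
def baseRep : Rep k R L R :=
  Rep.mk'
    (AddMonoidHom.mk' (fun l => (LieModule.toEnd k L R l : Module.End k R)) (fun l l' => by simp))
    (fun r l m => by simp)
    (fun l r m => by
      change ⁅l, r * m⁆ = ⁅l, r⁆ * m + r * ⁅l, m⁆
      rw [LieRinehartRing.leibniz_mul_right, smul_eq_mul, add_comm])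
    (fun l l' m => by
      change ⁅⁅l, l'⁆, m⁆ = ⁅l, ⁅l', m⁆⁆ - ⁅l', ⁅l, m⁆⁆
      rw [leibniz_lie l l' m, add_sub_cancel_right])

variable {k R L}

theorem lie_one_eq {R L : Type*} [CommRing R] [LieRing L] [Module R L] [LieRingModule L R]
    [LieRinehartRing R L] (l : L) : ⁅l, (1 : R)⁆ = 0 := by
  have := LieRinehartRing.leibniz_mul_right l (1 : R) 1
  simpa using this

theorem baseRep_vec (l : L) (f : R) : (baseRep k R L).toEnd (Env.vec k R L l) f = ⁅l, f⁆ := by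
  rw [baseRep, Rep.mk'_vec]
  rfl

variable (k R L)

/-- The map `U_R L → R`, `D ↦ D(f)`, for `f : R`. -/
def evalAt (f : R) : Env k R L →ₗ[R] R where
  toFun D := (baseRep k R L).toEnd D f
  map_add' D E := by simp
  map_smul' r D := by
    rw [Env.smul_def, map_mul, Module.End.mul_apply, Rep.toEnd_fn, RingHom.id_apply]

variable {k R L}

theorem evalAt_mul (f : R) (D E : Env k R L) :
    evalAt k R L f (D * E) = (baseRep k R L).toEnd D (evalAt k R L f E) := by
  change (baseRep k R L).toEnd (D * E) f = _
  rw [map_mul]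
  rfl

theorem evalAt_one (f : R) : evalAt k R L f 1 = f := by
  change (baseRep k R L).toEnd 1 f = _
  rw [map_one]
  rfl

variable (k R L)

/-- The comultiplication `Δ` and counit `ε(D) = D(1)` of `U_R L`. -/
instance : CoalgebraStruct R (Env k R L) where
  comul := envComul k R L
  counit := evalAt k R L 1

variable {k R L} in
theorem comul_mul (D E : Env k R L) :
    CoalgebraStruct.comul (R := R) (D * E) =
      ((envRep k R L).tensor (envRep k R L)).toEnd D (CoalgebraStruct.comul (R := R) E) :=
  envComul_mul D E

theorem comul_one : CoalgebraStruct.comul (R := R) (1 : Env k R L) = 1 ⊗ₜ 1 := envComul_one k R L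

variable {k R L} in
/-- A map `φ ⊗ ψ` is `U_R L`-linear if `φ` and `ψ` are. -/
theorem Rep.map_tensor {M N M' N' : Type*} [AddCommGroup M] [Module k M] [Module R M]
    [IsScalarTower k R M] [AddCommGroup N] [Module k N] [Module R N] [IsScalarTower k R N]
    [AddCommGroup M'] [Module k M'] [Module R M'] [IsScalarTower k R M'] [AddCommGroup N']
    [Module k N'] [Module R N'] [IsScalarTower k R N']
    (ρ : Rep k R L M) (σ : Rep k R L N) (ρ' : Rep k R L M') (σ' : Rep k R L N')
    (φ : M →ₗ[R] M') (ψ : N →ₗ[R] N') (hφ : ∀ D m, φ (ρ.toEnd D m) = ρ'.toEnd D (φ m))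
    (hψ : ∀ D n, ψ (σ.toEnd D n) = σ'.toEnd D (ψ n)) (D : Env k R L) (x : M ⊗[R] N) :
    TensorProduct.map φ ψ ((ρ.tensor σ).toEnd D x) =
      (ρ'.tensor σ').toEnd D (TensorProduct.map φ ψ x) := by
  refine Rep.map_of_vec _ _ _ (fun l x => ?_) D x
  induction x using TensorProduct.induction_on with
  | zero => simp
  | add x y hx hy => simp only [map_add, hx, hy]
  | tmul m n => simp only [Rep.tensor_vec, map_add, TensorProduct.map_tmul, hφ, hψ]

instance : Coalgebra R (Env k R L) where
  coassoc := by
    refine envRep_ext ((envRep k R L).tensor ((envRep k R L).tensor (envRep k R L))) _ _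
      (fun D E => ?_) (fun D E => ?_) ?_
    · simp only [LinearMap.comp_apply, comul_mul]
      rw [LinearMap.rTensor, Rep.map_tensor _ _ ((envRep k R L).tensor (envRep k R L))
        (envRep k R L) _ _ comul_mul (fun _ _ => rfl)]
      refine Rep.map_of_vec (((envRep k R L).tensor (envRep k R L)).tensor (envRep k R L))
        ((envRep k R L).tensor ((envRep k R L).tensor (envRep k R L)))
        (TensorProduct.assoc R _ _ _).toLinearMap (fun l x => ?_) D _
      induction x using TensorProduct.induction_on with
      | zero => simp
      | add x y hx hy => simp only [map_add, hx, hy]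
      | tmul x n =>
        induction x using TensorProduct.induction_on with
        | zero => simp
        | add x y hx hy => simp only [TensorProduct.add_tmul, map_add, hx, hy]
        | tmul x m =>
          simp only [Rep.tensor_vec, map_add, TensorProduct.add_tmul, LinearEquiv.coe_coe,
            TensorProduct.assoc_tmul, TensorProduct.tmul_add, add_assoc]
    · simp only [LinearMap.comp_apply, comul_mul]
      rw [LinearMap.lTensor, Rep.map_tensor _ _ (envRep k R L)
        ((envRep k R L).tensor (envRep k R L)) _ _ (fun _ _ => rfl) comul_mul]
    · simp [comul_one]
  rTensor_counit_comp_comul := by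
    refine envRep_ext ((baseRep k R L).tensor (envRep k R L)) _ _
      (fun D E => ?_) (fun D E => ?_) ?_
    · simp only [LinearMap.comp_apply, comul_mul]
      rw [LinearMap.rTensor, Rep.map_tensor _ _ (baseRep k R L)
        (envRep k R L) _ _ (evalAt_mul 1) (fun _ _ => rfl)]
    · refine Rep.map_of_vec (envRep k R L) _ (TensorProduct.mk R R (Env k R L) 1) (fun l x => ?_) D E
      simp [Rep.tensor_vec, baseRep_vec, lie_one_eq]
    · simp only [LinearMap.comp_apply, comul_one, LinearMap.rTensor_tmul, TensorProduct.mk_apply]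
      congr 1
      exact evalAt_one 1
  lTensor_counit_comp_comul := by
    refine envRep_ext ((envRep k R L).tensor (baseRep k R L)) _ _
      (fun D E => ?_) (fun D E => ?_) ?_
    · simp only [LinearMap.comp_apply, comul_mul]
      rw [LinearMap.lTensor, Rep.map_tensor _ _ (envRep k R L)
        (baseRep k R L) _ _ (fun _ _ => rfl) (evalAt_mul 1)]
    · refine Rep.map_of_vec (envRep k R L) _ ((TensorProduct.mk R (Env k R L) R).flip 1)
        (fun l x => ?_) D E
      simp [Rep.tensor_vec, baseRep_vec, lie_one_eq]
    · simp only [LinearMap.comp_apply, comul_one, LinearMap.lTensor_tmul, TensorProduct.mk_apply,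
        LinearMap.flip_apply]
      congr 1
      exact evalAt_one 1

instance : Coalgebra.IsCocomm R (Env k R L) where
  comm_comp_comul := by
    refine envRep_ext ((envRep k R L).tensor (envRep k R L)) _ _ (fun D E => ?_) comul_mul ?_
    · simp only [LinearMap.comp_apply, comul_mul]
      refine Rep.map_of_vec ((envRep k R L).tensor (envRep k R L))
        ((envRep k R L).tensor (envRep k R L)) (TensorProduct.comm R _ _).toLinearMap (fun l x => ?_) D _
      induction x using TensorProduct.induction_on with
      | zero => simp
      | add x y hx hy => simp only [map_add, hx, hy]
      | tmul m n =>
        simp only [Rep.tensor_vec, map_add, LinearEquiv.coe_coe, TensorProduct.comm_tmul]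
        rw [add_comm]
    · simp [comul_one]

end Connections

section Jets

variable (k R L : Type*) [CommRing k] [CommRing R] [Algebra k R] [LieRing L] [LieAlgebra k L]
  [Module R L] [LieRingModule L R] [LieRinehartRing R L] [LieRinehartAlgebra k R L]

/-- The jet algebra `J_R L = Hom_R(U_R L, R)`, a commutative `R`-algebra for the convolution product
`(α β)(D) = ∑ α(D₁) β(D₂)`, with unit `ε : D ↦ D(1)`. -/
abbrev Jet : Type _ := WithConv (Env k R L →ₗ[R] R)

variable {k R L}

theorem Jet.mul_apply (α β : Jet k R L) (D : Env k R L) :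
    (α * β) D = LinearMap.mul' R R
      (TensorProduct.map α.ofConv β.ofConv (CoalgebraStruct.comul (R := R) D)) := rfl

theorem Jet.one_apply (D : Env k R L) : (1 : Jet k R L) D = evalAt k R L 1 D := rfl

instance : IsScalarTower k R (Jet k R L) :=
  ⟨fun c r α => WithConv.ext (LinearMap.ext fun D => smul_assoc c r (α D))⟩

/-- `D ↦ α(D E)`. -/
def mulRightDual (E : Env k R L) (α : Env k R L →ₗ[R] R) : Env k R L →ₗ[R] R where
  toFun D := α (D * E)
  map_add' D D' := by rw [add_mul, map_add]
  map_smul' r D := by rw [smul_mul_assoc, map_smul, RingHom.id_apply]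

/-- `D ↦ l(α(D)) - α(l D)`. -/
def grothDual (l : L) (α : Env k R L →ₗ[R] R) : Env k R L →ₗ[R] R where
  toFun D := ⁅l, α D⁆ - α (Env.vec k R L l * D)
  map_add' D D' := by rw [mul_add, map_add, map_add, lie_add]; abel
  map_smul' r D := by
    rw [Env.vec_mul_smul, map_add, map_smul, map_smul, map_smul, smul_eq_mul, smul_eq_mul,
      smul_eq_mul, LieRinehartRing.leibniz_mul_right, RingHom.id_apply, smul_eq_mul, smul_eq_mul]
    ring

variable (k R L)

variable {L} in
/-- `α ↦ ¹∇_l α`, where `(¹∇_l α)(D) = l(α(D)) - α(l D)`. -/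
def grothEnd (l : L) : Module.End k (Jet k R L) where
  toFun α := WithConv.toConv (grothDual l α.ofConv)
  map_add' α β := WithConv.ext (LinearMap.ext fun D => by
    change ⁅l, α D + β D⁆ - (α (Env.vec k R L l * D) + β (Env.vec k R L l * D)) =
      (⁅l, α D⁆ - α (Env.vec k R L l * D)) + (⁅l, β D⁆ - β (Env.vec k R L l * D))
    rw [lie_add]; abel)
  map_smul' c α := WithConv.ext (LinearMap.ext fun D => by
    change ⁅l, c • α D⁆ - c • α (Env.vec k R L l * D) = c • (⁅l, α D⁆ - α (Env.vec k R L l * D))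
    rw [smul_sub]
    exact congrArg (· - _) ((LieModule.toEnd k L R l).map_smul c (α D)))

variable {k R L} in
theorem grothEnd_apply (l : L) (α : Jet k R L) (D : Env k R L) :
    grothEnd k R l α D = ⁅l, α D⁆ - α (Env.vec k R L l * D) := rfl

/-- The Grothendieck connection `¹∇` on `J_R L`, as a left `U_R L`-module structure: it extends the
`R`-module structure, and `(¹∇_l α)(D) = l(α(D)) - α(l D)` for `l` in `L`. -/
def nabla₁ : Rep k R L (Jet k R L) :=
  Rep.mk'
    (AddMonoidHom.mk' (fun l => grothEnd k R l)
      (fun l l' => LinearMap.ext fun α => WithConv.ext (LinearMap.ext fun D => by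
        change ⁅l + l', α D⁆ - α (Env.vec k R L (l + l') * D) =
          (⁅l, α D⁆ - α (Env.vec k R L l * D)) + (⁅l', α D⁆ - α (Env.vec k R L l' * D))
        rw [add_lie, map_add, add_mul, map_add]; abel)))
    (fun r l α => WithConv.ext (LinearMap.ext fun D => by
      change ⁅r • l, α D⁆ - α (Env.vec k R L (r • l) * D) =
        r • (⁅l, α D⁆ - α (Env.vec k R L l * D))
      rw [LieRinehartRing.lie_smul_eq_mul, map_smul, smul_mul_assoc, map_smul, smul_sub,
        smul_eq_mul, smul_eq_mul]))
    (fun l r α => WithConv.ext (LinearMap.ext fun D => by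
      change ⁅l, r * α D⁆ - r * α (Env.vec k R L l * D) =
        ⁅l, r⁆ * α D + r * (⁅l, α D⁆ - α (Env.vec k R L l * D))
      rw [LieRinehartRing.leibniz_mul_right, smul_eq_mul]; ring))
    (fun l l' α => WithConv.ext (LinearMap.ext fun D => by
      change ⁅⁅l, l'⁆, α D⁆ - α (Env.vec k R L ⁅l, l'⁆ * D) =
        (⁅l, ⁅l', α D⁆ - α (Env.vec k R L l' * D)⁆ -
          (⁅l', α (Env.vec k R L l * D)⁆ - α (Env.vec k R L l' * (Env.vec k R L l * D)))) -
        (⁅l', ⁅l, α D⁆ - α (Env.vec k R L l * D)⁆ -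
          (⁅l, α (Env.vec k R L l' * D)⁆ - α (Env.vec k R L l * (Env.vec k R L l' * D))))
      rw [Env.vec_lie, sub_mul, map_sub, lie_sub, lie_sub, leibniz_lie l l' (α D), mul_assoc,
        mul_assoc]
      abel))

/-- The left `U_R L`-module structure `²∇` on `J_R L`, given by `(²∇_E α)(D) = α(D E)`. -/
def nabla₂ : Env k R L →ₐ[k] Module.End k (Jet k R L) :=
  AlgHom.ofLinearMap
    { toFun := fun E =>
        { toFun := fun α => WithConv.toConv (mulRightDual E α.ofConv)
          map_add' := fun _ _ => rfl
          map_smul' := fun _ _ => rfl }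
      map_add' := fun E E' => LinearMap.ext fun α => WithConv.ext (LinearMap.ext fun D => by
        change α (D * (E + E')) = α (D * E) + α (D * E')
        rw [mul_add, map_add])
      map_smul' := fun c E => LinearMap.ext fun α => WithConv.ext (LinearMap.ext fun D => by
        change α (D * (c • E)) = c • α (D * E)
        rw [mul_smul_comm, ← algebraMap_smul R c (D * E), map_smul, algebraMap_smul]) }
    (LinearMap.ext fun α => WithConv.ext (LinearMap.ext fun D => congrArg α (mul_one D)))
    (fun E E' => LinearMap.ext fun α => WithConv.ext (LinearMap.ext fun D =>
      congrArg α (mul_assoc D E E').symm))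

variable {k R L}

theorem nabla₁_fn (r : R) (α : Jet k R L) : (nabla₁ k R L).toEnd (Env.fn k R L r) α = r • α :=
  (nabla₁ k R L).toEnd_fn r α

theorem nabla₁_vec_apply (l : L) (α : Jet k R L) (D : Env k R L) :
    (nabla₁ k R L).toEnd (Env.vec k R L l) α D = ⁅l, α D⁆ - α (Env.vec k R L l * D) := by
  rw [nabla₁, Rep.mk'_vec]
  rfl

theorem nabla₂_apply (E : Env k R L) (α : Jet k R L) (D : Env k R L) :
    nabla₂ k R L E α D = α (D * E) := rfl

theorem evalAt_mul_fn (f g : R) (D : Env k R L) :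
    LinearMap.mul' R R (TensorProduct.map (evalAt k R L f) (evalAt k R L g)
      (CoalgebraStruct.comul (R := R) D)) = evalAt k R L (f * g) D := by
  have h := envRep_ext (baseRep k R L)
    (LinearMap.mul' R R ∘ₗ TensorProduct.map (evalAt k R L f) (evalAt k R L g) ∘ₗ
      CoalgebraStruct.comul) (evalAt k R L (f * g)) (fun D E => by
        simp only [LinearMap.comp_apply, comul_mul]
        rw [Rep.map_tensor _ _ (baseRep k R L) (baseRep k R L) _ _ (evalAt_mul f) (evalAt_mul g)]
        refine Rep.map_of_vec _ _ (LinearMap.mul' R R) (fun l x => ?_) D _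
        induction x using TensorProduct.induction_on with
        | zero => simp
        | add x y hx hy => simp only [map_add, hx, hy]
        | tmul m n =>
          simp only [Rep.tensor_vec, map_add, LinearMap.mul'_apply, baseRep_vec,
            LieRinehartRing.leibniz_mul_right, smul_eq_mul]
          ring)
      (evalAt_mul (f * g)) (by simp [comul_one, evalAt_one])
  exact LinearMap.congr_fun h D

variable (k R L)

/-- The first unit map, `𝟙₁(r)(D) = r D(1)`, i.e. the `R`-algebra structure of `J_R L`. -/
def unit₁ : R →ₐ[k] Jet k R L := IsScalarTower.toAlgHom k R (Jet k R L)

/-- The second unit map, `𝟙₂(r)(D) = D(r)`. -/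
def unit₂ : R →ₐ[k] Jet k R L :=
  AlgHom.ofLinearMap
    { toFun := fun r => WithConv.toConv (evalAt k R L r)
      map_add' := fun r r' => WithConv.ext (LinearMap.ext fun D =>
        map_add ((baseRep k R L).toEnd D) r r')
      map_smul' := fun c r => WithConv.ext (LinearMap.ext fun D =>
        map_smul ((baseRep k R L).toEnd D) c r) }
    rfl
    (fun r r' => WithConv.ext (LinearMap.ext fun D => (evalAt_mul_fn r r' D).symm))

/-- The counit `ε(α) = α(1)`. -/
def jetCounit : Jet k R L →ₐ[k] R :=
  AlgHom.ofLinearMap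
    { toFun := fun α => α 1
      map_add' := fun _ _ => rfl
      map_smul' := fun _ _ => rfl }
    (evalAt_one 1)
    (fun α β => by
      change (α * β) 1 = α 1 * β 1
      rw [Jet.mul_apply, comul_one, TensorProduct.map_tmul, LinearMap.mul'_apply])

variable {k R L}

theorem unit₁_apply (r : R) (D : Env k R L) :
    unit₁ k R L r D = r * (baseRep k R L).toEnd D 1 := rfl

theorem unit₂_apply (r : R) (D : Env k R L) :
    unit₂ k R L r D = (baseRep k R L).toEnd D r := rfl

theorem jetCounit_apply (α : Jet k R L) : jetCounit k R L α = α 1 := rfl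

/-- The pairing `⟨α, D⟩₁ = ε(¹∇_D α)`. -/
def pair₁ (D : Env k R L) : Jet k R L →ₗ[k] R :=
  (jetCounit k R L).toLinearMap ∘ₗ (nabla₁ k R L).toEnd D

/-- The pairing `⟨α, D⟩₂ = ε(²∇_D α)`. -/
def pair₂ (D : Env k R L) : Jet k R L →ₗ[k] R :=
  (jetCounit k R L).toLinearMap ∘ₗ nabla₂ k R L D

theorem pair₂_apply (D : Env k R L) (α : Jet k R L) : pair₂ D α = α D :=
  congrArg α (one_mul D)

/-- `α ⊗ β ↦ ⟨α, D⟩₁ ⟨β, E⟩₂` on `J_R L ⊗_k J_R L`. -/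
def pairTensor (D E : Env k R L) : Jet k R L ⊗[k] Jet k R L →ₗ[k] R :=
  LinearMap.mul' k R ∘ₗ TensorProduct.map (pair₁ D) (pair₂ E)

theorem pairTensor_tmul (D E : Env k R L) (α β : Jet k R L) :
    pairTensor D E (α ⊗ₜ β) = pair₁ D α * pair₂ E β := rfl

variable (k R L) in
/-- The completed tensor product of two copies of `J_R L`, with `R` acting through `𝟙₂` on the left
factor and through `𝟙₁` on the right factor. -/
abbrev JetTensor : Type _ :=
  FormalGroupoid.CTensor₂ (unit₁ k R L) (unit₂ k R L) (jetCounit k R L)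

/-- `∑ ⟨x₁, D⟩₁ ⟨x₂, E⟩₂ = c` for an element `x = ∑ x₁ ⊗ x₂` of the completed tensor product.  The
pairing is extended by continuity: `c` is its value at every representative in `J_R L ⊗_k J_R L`
of every sufficiently fine truncation of `x`. -/
def HasPairing (x : JetTensor k R L) (D E : Env k R L) (c : R) : Prop :=
  ∃ N : ℕ, ∀ n ≥ N, ∀ y : Jet k R L ⊗[k] Jet k R L,
    AdicCompletion.evalₐ _ n x = Ideal.Quotient.mk _ (FormalGroupoid.mk₂ _ _ y) →
      pairTensor D E y = c

end Jets

end LieAlgebroid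

end

open scoped TensorProduct

set_option linter.unusedSectionVars false

noncomputable section

/-! ### Filtrations defined by derivations -/

/-! Multiplication in $U$ on the left and on the right gives two commuting actions of $L$ on $J$ by
derivations, ${}^1\nabla$ and ${}^2\nabla$. Everything rests on one rigidity principle,
`eq_of_derives`: a continuous algebra map into a completion is determined by its values on $R$ and
by the way it intertwines sufficiently many derivations. Sufficiently many means that the filtration
by order of vanishing (order at least $n$ if all iterated derivatives of length less than $n$ lie in
the ideal) is contained in the adic filtration. The groupoid axioms then become infinitesimal
identities, checked with the Leibniz rule.

The two filtrations are compared through an Euler derivation $\sum z_i\delta_i$, which acts on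
elements of order $n$ as multiplication by $n$ modulo order $n+1$; in characteristic zero it can be
inverted. There are two forms of the argument: `IsFrame.ordIdeal_eq_pow` for algebras complete and
separated for the order, such as $J$, and `ordIdeal_le_pow` for uncompleted tensor products, where
generators of the ideal are already known.

Coordinates on $J$ are needed: jets $t_i$ with $t_i(1)=0$ restricting on $L$ to the forms
$\lambda_i$ of a dual basis $(\lambda_i,e_i)$ of the projective module $L$. They could be read off
from a Poincaré-Birkhoff-Witt theorem, but are constructed directly. On noncommutative power series
with the shuffle product the dual basis defines a connection, curved in general, whose covariant
derivatives can be prescribed freely. The Bianchi identity and contraction with the Euler field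
remove the failure of flatness one order at a time, at the cost of dividing by $n+2$
(`FreeConnection.exists_flat_lift`). Elements flat to all orders, modulo those of infinite order,
form a $U$-module, and its matrix coefficients are jets (`exists_jet_vec_eq`).

The antipode is $S(\alpha)(D)=(D\cdot\epsilon)(\alpha)$ for a suitable action of $U$ on $R$-valued
maps on $J$. It exchanges ${}^1\nabla$ and ${}^2\nabla$. Since maps into $J$ with prescribed
behaviour under ${}^1\nabla$ are determined by their counits (`eq_of_jetDer₁`), $S$ is
multiplicative and involutive, and $\langle\alpha,D\rangle_1=(S\alpha)(D)$.

The pairing turns $\alpha\otimes\beta$ into the family $E\mapsto\beta(E)S(\alpha)$ in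
$\operatorname{Hom}_R(U,J)$ (`toJetJet`), and the required $\Delta(\alpha)$ into $E\mapsto
S({}^2\nabla_E\alpha)$ (`translates`), which is multiplicative in $\alpha$. Modulo the $n$-th powers
of the ideal and modulo order $n$, `toJetJet` is bijective, so the second map lifts to the completed
tensor product. The lift intertwines ${}^1\nabla\otimes1$ and $1\otimes{}^2\nabla$ with ${}^1\nabla$
and ${}^2\nabla$, and its values are killed by ${}^2\nabla\otimes1+1\otimes{}^1\nabla$; these three
facts feed the rigidity principle. -/

section OrdIdeal

variable {k A ι : Type*} [CommRing k] [CommRing A] [Algebra k A]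

/-- The elements of order at least `n` with respect to the derivations `δ i`: those `a` for which
all iterated derivatives `δ i₁ (⋯ (δ iₘ a))` with `m < n` lie in `K`. -/
def ordIdeal (δ : ι → Derivation k A A) (K : Ideal A) : ℕ → Ideal A
  | 0 => ⊤
  | n + 1 =>
    { carrier := {a | a ∈ ordIdeal δ K n ∧ a ∈ K ∧ ∀ i, δ i a ∈ ordIdeal δ K n}
      add_mem' := fun ha hb => ⟨add_mem ha.1 hb.1, add_mem ha.2.1 hb.2.1, fun i => by
        rw [map_add]; exact add_mem (ha.2.2 i) (hb.2.2 i)⟩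
      zero_mem' := ⟨zero_mem _, zero_mem _, fun i => by rw [map_zero]; exact zero_mem _⟩
      smul_mem' := fun c a ha => ⟨Ideal.mul_mem_left _ _ ha.1, Ideal.mul_mem_left _ _ ha.2.1,
        fun i => by
          rw [smul_eq_mul, Derivation.leibniz]
          exact add_mem (Ideal.mul_mem_left _ _ (ha.2.2 i)) (Ideal.mul_mem_right _ _ ha.1)⟩ }

variable {δ : ι → Derivation k A A} {K : Ideal A}

theorem ordIdeal_succ_le (n : ℕ) : ordIdeal δ K (n + 1) ≤ ordIdeal δ K n := fun _ ha => ha.1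

theorem ordIdeal_antitone : Antitone (ordIdeal δ K) :=
  antitone_nat_of_succ_le ordIdeal_succ_le

theorem mem_ordIdeal_zero (a : A) : a ∈ ordIdeal δ K 0 := Submodule.mem_top

/-- The first clause in the definition of `ordIdeal` is redundant. It is carried along because, by
the Leibniz rule, closure under multiplication by scalars needs `a` itself to have order `n`. -/
theorem mem_ordIdeal_succ {n : ℕ} {a : A} :
    a ∈ ordIdeal δ K (n + 1) ↔ a ∈ K ∧ ∀ i, δ i a ∈ ordIdeal δ K n := by
  refine ⟨fun h => h.2, fun h => ⟨?_, h⟩⟩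
  induction n with
  | zero => exact mem_ordIdeal_zero a
  | succ n ih =>
    have h' : a ∈ K ∧ ∀ i, δ i a ∈ ordIdeal δ K n := ⟨h.1, fun i => ordIdeal_succ_le n (h.2 i)⟩
    exact ⟨ih h', h'⟩

theorem mem_ordIdeal_one {a : A} : a ∈ ordIdeal δ K 1 ↔ a ∈ K := by
  rw [mem_ordIdeal_succ]
  exact ⟨fun h => h.1, fun h => ⟨h, fun i => mem_ordIdeal_zero _⟩⟩

/-- By the Leibniz rule a derivative lowers the order of only one factor, by at most one. Nothing is
known about the derivative of a factor of order zero, but then the other factor alone has the full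
order. -/
theorem mul_mem_ordIdeal {m n : ℕ} {a b : A} (ha : a ∈ ordIdeal δ K m) (hb : b ∈ ordIdeal δ K n) :
    a * b ∈ ordIdeal δ K (m + n) := by
  induction h : m + n generalizing m n a b with
  | zero => exact mem_ordIdeal_zero _
  | succ p ih =>
    refine mem_ordIdeal_succ.2 ⟨?_, fun i => ?_⟩
    · rcases m with _ | m
      · rcases n with _ | n
        · omega
        · exact Ideal.mul_mem_left _ _ (mem_ordIdeal_succ.1 hb).1
      · exact Ideal.mul_mem_right _ _ (mem_ordIdeal_succ.1 ha).1
    · rw [Derivation.leibniz, smul_eq_mul, smul_eq_mul]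
      refine add_mem ?_ ?_
      · rcases n with _ | n
        · exact Ideal.mul_mem_right _ _ (ordIdeal_succ_le p (by rwa [← h]))
        · exact ih ha ((mem_ordIdeal_succ.1 hb).2 i) (by omega)
      · rcases m with _ | m
        · exact Ideal.mul_mem_right _ _ (ordIdeal_succ_le p (by rwa [← h, zero_add]))
        · exact ih hb ((mem_ordIdeal_succ.1 ha).2 i) (by omega)

theorem pow_le_ordIdeal (n : ℕ) : K ^ n ≤ ordIdeal δ K n := by
  induction n with
  | zero => exact le_top
  | succ n ih =>
    rw [pow_succ, Ideal.mul_le]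
    exact fun a ha b hb => mul_mem_ordIdeal (ih ha) (mem_ordIdeal_one.2 hb)

/-- A derivation maps `K ^ (n + 1)` to `K ^ n`. -/
theorem Derivation.map_pow_succ_mem (δ : Derivation k A A) (n : ℕ) {a : A} (ha : a ∈ K ^ (n + 1)) :
    δ a ∈ K ^ n := by
  induction n generalizing a with
  | zero => simp
  | succ n ih =>
    rw [pow_succ] at ha
    refine Submodule.mul_induction_on ha (fun x hx y hy => ?_) fun x y hx hy => ?_
    · rw [Derivation.leibniz, smul_eq_mul, smul_eq_mul]
      refine add_mem (Ideal.mul_mem_right _ _ hx) ?_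
      rw [mul_comm, pow_succ]
      exact Ideal.mul_mem_mul (ih hx) hy
    · rw [map_add]; exact add_mem hx hy

variable [Fintype ι]

/-- The Euler derivation of the coordinates `z` with respect to the derivations `δ`. -/
def euler (δ : ι → Derivation k A A) (z : ι → A) : Derivation k A A := ∑ i, z i • δ i

theorem euler_apply (z : ι → A) (a : A) : euler δ z a = ∑ i, z i * δ i a := by
  rw [euler, ← Derivation.coeFnAddMonoidHom_apply, map_sum, Finset.sum_apply]
  rfl

theorem euler_mem {z : ι → A} (hz : ∀ i, z i ∈ K) {n : ℕ} {a : A}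
    (ha : ∀ i, δ i a ∈ ordIdeal δ K n) : euler δ z a ∈ ordIdeal δ K (n + 1) := by
  rw [euler_apply, add_comm]
  exact sum_mem fun i _ => mul_mem_ordIdeal (mem_ordIdeal_one.2 (hz i)) (ha i)

/-- The derivations `δ` and coordinates `z` are adapted to each other modulo `K`, and the module
spanned by the derivations is involutive. -/
structure IsFrame (δ : ι → Derivation k A A) (K : Ideal A) (z : ι → A) : Prop where
  coord_mem : ∀ i, z i ∈ K
  der : ∀ i, ∃ c : ι → A, (∀ j, δ i (z j) - c j ∈ K) ∧ ∀ a, δ i a = ∑ j, c j * δ j a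
  bracket : ∀ i j, ∃ c : ι → A, ∀ a, δ i (δ j a) - δ j (δ i a) = ∑ m, c m * δ m a

/-- Euler's identity for homogeneous elements, modulo terms of higher order. -/
theorem IsFrame.euler_sub_mem {z : ι → A} (h : IsFrame δ K z) {n : ℕ} {a : A}
    (ha : a ∈ ordIdeal δ K n) : euler δ z a - n * a ∈ ordIdeal δ K (n + 1) := by
  induction n generalizing a with
  | zero =>
    rw [Nat.cast_zero, zero_mul, sub_zero]
    exact euler_mem h.coord_mem fun i => mem_ordIdeal_zero _
  | succ n ih =>
    have ha' := mem_ordIdeal_succ.1 ha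
    refine mem_ordIdeal_succ.2 ⟨?_, fun i => ?_⟩
    · exact sub_mem (mem_ordIdeal_one.1 (ordIdeal_antitone (by omega)
        (euler_mem h.coord_mem ha'.2))) (Ideal.mul_mem_left _ _ ha'.1)
    · obtain ⟨c, hc, hc'⟩ := h.der i
      -- Moving `δ i` past the Euler derivation leaves three terms: the defect of `δ i (z j)` from
      -- `c j`, Euler's identity for `δ i a`, and brackets. Writing `δ i a` as `∑ j, c j * δ j a`
      -- accounts for the extra one in `n + 1`.
      have key : δ i (euler δ z a - (n + 1 : ℕ) * a) =
          ∑ j, (δ i (z j) - c j) * δ j a + (euler δ z (δ i a) - n * δ i a) +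
            ∑ j, z j * (δ i (δ j a) - δ j (δ i a)) := by
        have h1 := hc' a
        rw [map_sub, Derivation.leibniz, Derivation.map_natCast, euler_apply, euler_apply, map_sum]
        simp only [Derivation.leibniz, smul_eq_mul, sub_mul, mul_sub, Finset.sum_sub_distrib,
          Finset.sum_add_distrib, mul_comm _ (δ i (z _))]
        rw [← h1]
        push_cast
        ring
      rw [key]
      refine add_mem (add_mem (sum_mem fun j _ => ?_) (ih (ha'.2 i))) (sum_mem fun j _ => ?_)
      · rw [add_comm n 1]
        exact mul_mem_ordIdeal (mem_ordIdeal_one.2 (hc j)) (ha'.2 j)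
      · obtain ⟨d, hd⟩ := h.bracket i j
        rw [hd, add_comm n 1]
        exact mul_mem_ordIdeal (mem_ordIdeal_one.2 (h.coord_mem j))
          (sum_mem fun m _ => Ideal.mul_mem_left _ _ (ha'.2 m))

/-- The Leibniz rule propagates the identity on $K/K^2$ to multiplication by $n$ on $K^n/K^{n+1}$;
`hGK` covers $n=0$. -/
theorem Derivation.sub_mul_mem_pow_succ {G : Derivation k A A}
    (hG : ∀ a ∈ K, G a - a ∈ K ^ 2) (n : ℕ) {a : A} (ha : a ∈ K ^ n) (hGK : ∀ a, G a ∈ K) :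
    G a - n * a ∈ K ^ (n + 1) := by
  induction n generalizing a with
  | zero => simpa using hGK a
  | succ n ih =>
    rw [pow_succ] at ha
    refine Submodule.mul_induction_on ha (fun x hx y hy => ?_) fun x y hx hy => ?_
    · have : G (x * y) - (n + 1 : ℕ) * (x * y) = x * (G y - y) + (G x - n * x) * y := by
        rw [Derivation.leibniz, smul_eq_mul, smul_eq_mul]
        push_cast
        ring
      rw [this]
      refine add_mem ?_ ?_
      · rw [show n + 1 + 1 = n + 2 by omega, pow_add]
        exact Ideal.mul_mem_mul hx (hG y hy)
      · rw [pow_succ]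
        exact Ideal.mul_mem_mul (ih hx) hy
    · rw [map_add, mul_add, add_sub_add_comm]
      exact add_mem hx hy

/-- Generators suffice: since `G` takes values in `K`, the Leibniz term `x * G c` of a multiple `c •
x` lies in `K ^ 2`. -/
theorem span_euler_sub_mem {G : Derivation k A A} {X : Set A} (hX : K = Ideal.span X)
    (hGK : ∀ a, G a ∈ K) (hG : ∀ x ∈ X, G x - x ∈ K ^ 2) : ∀ a ∈ K, G a - a ∈ K ^ 2 := by
  intro a ha
  rw [hX] at ha
  refine Submodule.span_induction (fun x hx => hG x hx) (by simp) (fun x y _ _ hx hy => ?_)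
    (fun c x hx h => ?_) ha
  · rw [map_add, add_sub_add_comm]; exact add_mem hx hy
  · have : G (c • x) - c • x = c * (G x - x) + x * G c := by
      rw [smul_eq_mul, Derivation.leibniz, smul_eq_mul, smul_eq_mul]; ring
    rw [this]
    refine add_mem (Ideal.mul_mem_left _ _ h) ?_
    rw [pow_two]
    exact Ideal.mul_mem_mul (hX ▸ hx) (hGK c)

end OrdIdeal

/-! ### Inverting the Euler derivation in characteristic zero -/

section CharZero

theorem Ideal.mem_of_natCast_mul_mem (k : Type*) {A : Type*} [Field k] [CharZero k] [CommRing A]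
    [Algebra k A] {J : Ideal A} {n : ℕ} (hn : n ≠ 0) {a : A} (h : (n : A) * a ∈ J) : a ∈ J := by
  have : a = algebraMap k A (n : k)⁻¹ * ((n : A) * a) := by
    rw [← mul_assoc, ← map_natCast (algebraMap k A), ← map_mul,
      inv_mul_cancel₀ (Nat.cast_ne_zero.2 hn), map_one, one_mul]
  rw [this]
  exact Ideal.mul_mem_left _ _ h

variable {k A ι : Type*} [Field k] [CharZero k] [CommRing A] [Algebra k A] [Fintype ι]
  {δ : ι → Derivation k A A} {K : Ideal A}

/-- If the Euler derivation acts as the identity on `K / K ^ 2`, the filtration by the order is the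
`K`-adic one. -/
theorem ordIdeal_le_pow {z : ι → A} (hz : ∀ i, z i ∈ K) {X : Set A} (hX : K = Ideal.span X)
    (hG : ∀ x ∈ X, euler δ z x - x ∈ K ^ 2) (n : ℕ) : ordIdeal δ K n ≤ K ^ n := by
  have hGK : ∀ a, euler δ z a ∈ K := fun a => by
    rw [euler_apply]
    exact sum_mem fun i _ => Ideal.mul_mem_right _ _ (hz i)
  have hG' := span_euler_sub_mem hX hGK hG
  induction n with
  | zero => simp
  | succ n ih =>
    intro a ha
    rcases n with _ | n
    · rw [zero_add, pow_one]; exact mem_ordIdeal_one.1 ha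
    -- The Euler derivative of `a` is congruent to $(n+1)a$ modulo $K^{n+2}$. It also lies in
    -- $K^{n+2}$, because the derivatives of `a` lie in $K^{n+1}$ by induction. It remains to divide
    -- by $n+1$.
    · have h1 := Derivation.sub_mul_mem_pow_succ hG' (n + 1) (ih ha.1) hGK
      have h2 : euler δ z a ∈ K ^ (n + 1 + 1) := by
        rw [euler_apply, pow_succ']
        exact sum_mem fun i _ => Ideal.mul_mem_mul (hz i) (ih (ha.2.2 i))
      refine Ideal.mem_of_natCast_mul_mem k (Nat.succ_ne_zero n) ?_
      have := sub_mem h2 h1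
      rwa [sub_sub_cancel] at this

/-- One step of the inversion of the Euler derivation. -/
theorem IsFrame.sub_euler_mem {z : ι → A} (h : IsFrame δ K z) {n : ℕ} (hn : n ≠ 0) {a : A}
    (ha : a ∈ ordIdeal δ K n) :
    a - (n : k)⁻¹ • euler δ z a ∈ ordIdeal δ K (n + 1) := by
  have h1 := h.euler_sub_mem ha
  have : a - (n : k)⁻¹ • euler δ z a = -((n : k)⁻¹ • (euler δ z a - n * a)) := by
    have h2 : (n : A) * a = (n : k) • a := by rw [Algebra.smul_def, map_natCast]
    rw [smul_sub, h2, smul_smul, inv_mul_cancel₀ (Nat.cast_ne_zero.2 hn), one_smul, neg_sub]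
  rw [this, Algebra.smul_def]
  exact neg_mem (Ideal.mul_mem_left _ _ h1)

/-- Approximation of the elements of an algebra with a frame whose coordinates lie in the image of
`P`. -/
theorem IsFrame.exists_sub_mem {W : Type*} [CommRing W] [Algebra k W] {z : ι → W}
    (P : W →ₐ[k] A) (h : IsFrame δ K (fun i => P (z i))) (h0 : ∀ a, ∃ w, a - P w ∈ K) (n : ℕ)
    (a : A) : ∃ w, a - P w ∈ ordIdeal δ K n := by
  induction n generalizing a with
  | zero => exact ⟨0, mem_ordIdeal_zero _⟩
  | succ n ih =>
    obtain ⟨w, hw⟩ := ih a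
    rcases n with _ | n
    · obtain ⟨w, hw⟩ := h0 a
      exact ⟨w, mem_ordIdeal_one.2 hw⟩
    · have h1 := h.sub_euler_mem (Nat.succ_ne_zero n) hw
      choose v hv using fun i => ih (δ i (a - P w))
      -- Modulo higher order the remainder `a - P w` is $(n+1)^{-1}$ times its Euler derivative; in
      -- that expression the derivatives are replaced by their approximations `P (v i)`.
      refine ⟨w + ((n + 1 : ℕ) : k)⁻¹ • ∑ i, z i * v i, ?_⟩
      have : a - P (w + ((n + 1 : ℕ) : k)⁻¹ • ∑ i, z i * v i) =
          a - P w - ((n + 1 : ℕ) : k)⁻¹ • euler δ (fun i => P (z i)) (a - P w) +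
            ((n + 1 : ℕ) : k)⁻¹ • ∑ i, P (z i) * (δ i (a - P w) - P (v i)) := by
        rw [euler_apply]
        simp only [map_add, map_smul, map_sum, map_mul, mul_sub, Finset.sum_sub_distrib, smul_sub]
        ring
      rw [this, Algebra.smul_def (((n + 1 : ℕ) : k)⁻¹) (∑ i, P (z i) * _)]
      refine add_mem h1 (Ideal.mul_mem_left _ _ (sum_mem fun i _ => ?_))
      rw [add_comm (n + 1) 1]
      exact mul_mem_ordIdeal (mem_ordIdeal_one.2 (h.coord_mem i)) (hv i)

/-- In an algebra with a frame that is complete and separated for the filtration by the order, the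
elements of positive order are combinations of the coordinates. -/
theorem IsFrame.exists_eq_sum {z : ι → A} (h : IsFrame δ K z)
    (hsep : ∀ a, (∀ n, a ∈ ordIdeal δ K n) → a = 0)
    (hlim : ∀ f : ℕ → A, (∀ n, f (n + 1) - f n ∈ ordIdeal δ K n) →
      ∃ a, ∀ n, a - f n ∈ ordIdeal δ K n) (n : ℕ) {a : A} (ha : a ∈ ordIdeal δ K (n + 1)) :
    ∃ b : ι → A, (∀ i, b i ∈ ordIdeal δ K n) ∧ a = ∑ i, z i * b i := by
  -- Successive remainders: `α m` has order `n + 1 + m`, and each step subtracts its leading part,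
  -- written as an Euler derivative.
  let α : ℕ → A := fun m => Nat.rec a
    (fun m x => x - ((n + 1 + m : ℕ) : k)⁻¹ • euler δ z x) m
  have hα : ∀ m, α m ∈ ordIdeal δ K (n + 1 + m) := by
    intro m
    induction m with
    | zero => exact ha
    | succ m ih => exact h.sub_euler_mem (n := n + 1 + m) (by omega) ih
  let b : ι → ℕ → A := fun i M =>
    ∑ m ∈ Finset.range M, ((n + 1 + m : ℕ) : k)⁻¹ • δ i (α m)
  have hterm : ∀ i m, ((n + 1 + m : ℕ) : k)⁻¹ • δ i (α m) ∈ ordIdeal δ K (n + m) := by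
    intro i m
    rw [Algebra.smul_def]
    have := hα m
    rw [show n + 1 + m = n + m + 1 by omega] at this
    exact Ideal.mul_mem_left _ _ ((mem_ordIdeal_succ.1 this).2 i)
  choose β hβ using fun i => hlim (b i) (fun M => by
    simp only [b, Finset.sum_range_succ, add_sub_cancel_left]
    exact ordIdeal_antitone (by omega) (hterm i M))
  have hb : ∀ i M, b i M ∈ ordIdeal δ K n := fun i M =>
    sum_mem fun m _ => ordIdeal_antitone (by omega) (hterm i m)
  refine ⟨β, fun i => ?_, ?_⟩
  · have := add_mem (hβ i n) (hb i n)
    rwa [sub_add_cancel] at this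
  -- The subtracted parts telescope, so the coefficients of the coordinates are the limits `β` of
  -- the partial sums `b`.
  · have hα' : ∀ M, a - ∑ i, z i * b i M = α M := by
      intro M
      induction M with
      | zero => simp [b, α]
      | succ M ih =>
        have : α (M + 1) = α M - ((n + 1 + M : ℕ) : k)⁻¹ • euler δ z (α M) := rfl
        rw [this, ← ih, ih, euler_apply]
        simp only [b, Finset.sum_range_succ, mul_add, Finset.sum_add_distrib, Finset.smul_sum,
          mul_smul_comm] at ih ⊢
        rw [← ih]
        ring
    rw [← sub_eq_zero]
    refine hsep _ fun M => ?_
    have : a - ∑ i, z i * β i = α M - ∑ i, z i * (β i - b i M) := by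
      rw [← hα' M]
      simp only [mul_sub, Finset.sum_sub_distrib]
      ring
    rw [this]
    exact sub_mem (ordIdeal_antitone (by omega) (hα M))
      (sum_mem fun i _ => Ideal.mul_mem_left _ _ (hβ i M))

/-- In an algebra with a frame that is complete and separated for the filtration by the order,
this filtration is the `K`-adic one. -/
theorem IsFrame.ordIdeal_eq_pow {z : ι → A} (h : IsFrame δ K z)
    (hsep : ∀ a, (∀ n, a ∈ ordIdeal δ K n) → a = 0)
    (hlim : ∀ f : ℕ → A, (∀ n, f (n + 1) - f n ∈ ordIdeal δ K n) →
      ∃ a, ∀ n, a - f n ∈ ordIdeal δ K n) (n : ℕ) : ordIdeal δ K n = K ^ n := by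
  refine le_antisymm ?_ (pow_le_ordIdeal n)
  induction n with
  | zero => simp
  | succ n ih =>
    intro a ha
    obtain ⟨b, hb, rfl⟩ := h.exists_eq_sum hsep hlim n ha
    rw [pow_succ']
    exact sum_mem fun i _ => Ideal.mul_mem_mul (h.coord_mem i) (ih (hb i))

/-- In an algebra with a frame that is complete and separated for the filtration by the order,
the coordinates generate `K`. -/
theorem IsFrame.span_eq {z : ι → A} (h : IsFrame δ K z)
    (hsep : ∀ a, (∀ n, a ∈ ordIdeal δ K n) → a = 0)
    (hlim : ∀ f : ℕ → A, (∀ n, f (n + 1) - f n ∈ ordIdeal δ K n) →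
      ∃ a, ∀ n, a - f n ∈ ordIdeal δ K n) : K = Ideal.span (Set.range z) := by
  refine le_antisymm (fun a ha => ?_) (Ideal.span_le.2 (Set.range_subset_iff.2 h.coord_mem))
  obtain ⟨b, -, rfl⟩ := h.exists_eq_sum hsep hlim 0 (mem_ordIdeal_one.2 ha)
  exact sum_mem fun i _ => Ideal.mul_mem_right _ _ (Ideal.subset_span ⟨i, rfl⟩)

end CharZero

/-! ### Flattening a connection -/

/-- An `R`-module `A` with a bilinear multiplication, an augmentation and an action of the Lie
algebroid `L` by derivations, not assumed to be flat, such that the covariant derivatives of an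
element can be prescribed arbitrarily. -/
structure FreeConnection (R L A : Type*) [CommRing R] [LieRing L] [Module R L] [LieRingModule L R]
    [AddCommGroup A] [Module R A] where
  nabla : L →ₗ[R] A →+ A
  aug : A →ₗ[R] R
  mul : A →ₗ[R] A →ₗ[R] A
  nabla_smul : ∀ x (r : R) a, nabla x (r • a) = ⁅x, r⁆ • a + r • nabla x a
  nabla_mul : ∀ x a b, nabla x (mul a b) = mul (nabla x a) b + mul a (nabla x b)
  aug_mul : ∀ a b, aug (mul a b) = aug a * aug b
  exists_nabla_eq : ∀ (c : R) (γ : L →ₗ[R] A), ∃ a, aug a = c ∧ ∀ x, nabla x a = γ x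

namespace FreeConnection

variable {R L A : Type*} [CommRing R] [LieRing L] [Module R L] [LieRingModule L R]
  [AddCommGroup A] [Module R A] (C : FreeConnection R L A)

/-- The elements all of whose iterated covariant derivatives of order less than `n` have
augmentation zero. -/
def ord : ℕ → Submodule R A
  | 0 => ⊤
  | n + 1 =>
    { carrier := {a | a ∈ ord n ∧ C.aug a = 0 ∧ ∀ x, C.nabla x a ∈ ord n}
      add_mem' := fun ha hb => ⟨add_mem ha.1 hb.1, by rw [map_add, ha.2.1, hb.2.1, add_zero],
        fun x => by rw [map_add]; exact add_mem (ha.2.2 x) (hb.2.2 x)⟩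
      zero_mem' := ⟨zero_mem _, map_zero _, fun x => by rw [map_zero]; exact zero_mem _⟩
      smul_mem' := fun r a ha => ⟨Submodule.smul_mem _ _ ha.1, by rw [map_smul, ha.2.1, smul_zero],
        fun x => by
          rw [C.nabla_smul]
          exact add_mem (Submodule.smul_mem _ _ ha.1) (Submodule.smul_mem _ _ (ha.2.2 x))⟩ }

variable {C}

theorem mem_ord_zero (a : A) : a ∈ C.ord 0 := Submodule.mem_top

theorem ord_succ_le (n : ℕ) : C.ord (n + 1) ≤ C.ord n := fun _ h => h.1

theorem ord_antitone : Antitone C.ord := antitone_nat_of_succ_le ord_succ_le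

theorem nabla_mem_ord {n : ℕ} {a : A} (ha : a ∈ C.ord (n + 1)) (x : L) :
    C.nabla x a ∈ C.ord n := ha.2.2 x

theorem mem_ord_succ {n : ℕ} {a : A} :
    a ∈ C.ord (n + 1) ↔ C.aug a = 0 ∧ ∀ x, C.nabla x a ∈ C.ord n := by
  refine ⟨fun h => h.2, fun h => ⟨?_, h⟩⟩
  induction n with
  | zero => exact mem_ord_zero a
  | succ n ih =>
    have h' : C.aug a = 0 ∧ ∀ x, C.nabla x a ∈ C.ord n := ⟨h.1, fun x => ord_succ_le n (h.2 x)⟩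
    exact ⟨ih h', h'⟩

theorem mul_mem_ord {m n : ℕ} {a b : A} (ha : a ∈ C.ord m) (hb : b ∈ C.ord n) :
    C.mul a b ∈ C.ord (m + n) := by
  induction h : m + n generalizing m n a b with
  | zero => exact mem_ord_zero _
  | succ p ih =>
    refine mem_ord_succ.2 ⟨?_, fun x => ?_⟩
    · rw [C.aug_mul]
      rcases m with _ | m
      · rcases n with _ | n
        · omega
        · rw [(mem_ord_succ.1 hb).1, mul_zero]
      · rw [(mem_ord_succ.1 ha).1, zero_mul]
    · rw [C.nabla_mul]
      refine add_mem ?_ ?_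
      · rcases m with _ | m
        · exact ih (mem_ord_zero _) (show b ∈ C.ord p from ord_antitone (by omega) hb) (by omega)
        · exact ih (nabla_mem_ord ha x) hb (by omega)
      · rcases n with _ | n
        · exact ih (show a ∈ C.ord p from ord_antitone (by omega) ha) (mem_ord_zero _) (by omega)
        · exact ih ha (nabla_mem_ord hb x) (by omega)

theorem mul_mem_ord_succ {n : ℕ} {a b : A} (ha : C.aug a = 0) (hb : b ∈ C.ord n) :
    C.mul a b ∈ C.ord (n + 1) := by
  rw [add_comm]
  exact mul_mem_ord (mem_ord_succ.2 ⟨ha, fun _ => mem_ord_zero _⟩) hb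

/-- On leading terms a factor acts through its augmentation. Differentiating the difference gives
the same expression for `∇ b`, of lower order, plus terms in which `b` is undifferentiated. -/
theorem mul_sub_smul_mem_ord {n : ℕ} (a : A) {b : A} (hb : b ∈ C.ord n) :
    C.mul a b - C.aug a • b ∈ C.ord (n + 1) := by
  induction n generalizing a b with
  | zero =>
    refine mem_ord_succ.2 ⟨?_, fun _ => mem_ord_zero _⟩
    rw [map_sub, C.aug_mul, map_smul, smul_eq_mul, sub_self]
  | succ n ih =>
    refine mem_ord_succ.2 ⟨?_, fun x => ?_⟩
    · rw [map_sub, C.aug_mul, map_smul, smul_eq_mul, sub_self]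
    · have : C.nabla x (C.mul a b - C.aug a • b) = C.mul (C.nabla x a) b +
          (C.mul a (C.nabla x b) - C.aug a • C.nabla x b) - ⁅x, C.aug a⁆ • b := by
        rw [map_sub, C.nabla_mul, C.nabla_smul]
        abel
      rw [this]
      refine sub_mem (add_mem ?_ (ih a (nabla_mem_ord hb x))) (Submodule.smul_mem _ _ hb)
      simpa using mul_mem_ord (mem_ord_zero (C.nabla x a)) hb

variable (C) in
/-- The torsion `d_∇ γ` of a connection-valued one-form `γ`. -/
def extDer (γ : L →ₗ[R] A) (x y : L) : A := C.nabla x (γ y) - C.nabla y (γ x) - γ ⁅x, y⁆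

theorem extDer_swap (γ : L →ₗ[R] A) (x y : L) : C.extDer γ y x = -C.extDer γ x y := by
  rw [extDer, extDer, ← lie_skew, map_neg]
  abel

variable [LieRinehartRing R L]

variable (C) in
/-- The curvature. -/
def curv (x y : L) : A →ₗ[R] A where
  toFun a := C.nabla x (C.nabla y a) - C.nabla y (C.nabla x a) - C.nabla ⁅x, y⁆ a
  map_add' a b := by simp only [map_add]; abel
  map_smul' r a := by
    have h := lie_lie x y r
    simp only [C.nabla_smul, map_add, RingHom.id_apply, smul_sub, h, sub_smul]
    abel

theorem curv_apply (x y : L) (a : A) :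
    C.curv x y a = C.nabla x (C.nabla y a) - C.nabla y (C.nabla x a) - C.nabla ⁅x, y⁆ a := rfl

theorem curv_mul (x y : L) (a b : A) :
    C.curv x y (C.mul a b) = C.mul (C.curv x y a) b + C.mul a (C.curv x y b) := by
  simp only [curv_apply, C.nabla_mul, map_add, map_sub, LinearMap.sub_apply]
  abel

theorem curv_mem_ord {n : ℕ} {a : A} (ha : a ∈ C.ord (n + 2)) (x y : L) :
    C.curv x y a ∈ C.ord n :=
  sub_mem (sub_mem (nabla_mem_ord (nabla_mem_ord ha y) x) (nabla_mem_ord (nabla_mem_ord ha x) y))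
    (ord_succ_le _ (nabla_mem_ord ha _))

theorem extDer_smul (γ : L →ₗ[R] A) (x y : L) (r : R) :
    C.extDer γ x (r • y) = r • C.extDer γ x y := by
  simp only [extDer, map_smul, C.nabla_smul, LieRinehartRing.leibniz_smul_right, map_add,
    AddMonoidHom.smul_apply, smul_sub]
  abel

variable (C) in
/-- `extDer` as a linear map in the second variable. -/
def extDerₗ (γ : L →ₗ[R] A) (x : L) : L →ₗ[R] A where
  toFun y := C.extDer γ x y
  map_add' y z := by simp only [extDer, map_add, lie_add, AddMonoidHom.add_apply]; abel
  map_smul' r y := extDer_smul γ x y r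

/-- The Bianchi identity. -/
theorem bianchi (γ : L →ₗ[R] A) (x y z : L) :
    C.nabla x (C.extDer γ y z) + C.nabla y (C.extDer γ z x) + C.nabla z (C.extDer γ x y) =
      (C.curv x y (γ z) + C.curv y z (γ x) + C.curv z x (γ y)) +
        (C.extDer γ ⁅x, y⁆ z + C.extDer γ ⁅y, z⁆ x + C.extDer γ ⁅z, x⁆ y) := by
  -- After expansion everything cancels except the cyclic sum of `γ ⁅⁅x, y⁆, z⁆`, which vanishes by
  -- the Jacobi identity.
  have h : γ ⁅⁅x, y⁆, z⁆ + γ ⁅⁅y, z⁆, x⁆ + γ ⁅⁅z, x⁆, y⁆ = 0 := by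
    rw [← map_add, ← map_add, ← lie_skew ⁅x, y⁆, ← lie_skew ⁅y, z⁆, ← lie_skew ⁅z, x⁆, ← neg_add,
      ← neg_add, add_assoc, add_comm, lie_jacobi, neg_zero, map_zero]
  simp only [extDer, curv_apply, map_sub]
  rw [← sub_eq_zero, ← h]
  abel

variable (C) in
/-- The elements that are flat to order `n`. -/
def flat : ℕ → Submodule R A
  | 0 => ⊤
  | n + 1 =>
    { carrier := {a | a ∈ flat n ∧ (∀ x, C.nabla x a ∈ flat n) ∧
        ∀ x y, C.curv x y a ∈ C.ord (n + 1)}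
      add_mem' := fun ha hb => ⟨add_mem ha.1 hb.1,
        fun x => by rw [map_add]; exact add_mem (ha.2.1 x) (hb.2.1 x),
        fun x y => by rw [map_add]; exact add_mem (ha.2.2 x y) (hb.2.2 x y)⟩
      zero_mem' := ⟨zero_mem _, fun x => by rw [map_zero]; exact zero_mem _,
        fun x y => by rw [map_zero]; exact zero_mem _⟩
      smul_mem' := fun r a ha => ⟨Submodule.smul_mem _ _ ha.1,
        fun x => by
          rw [C.nabla_smul]
          exact add_mem (Submodule.smul_mem _ _ ha.1) (Submodule.smul_mem _ _ (ha.2.1 x)),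
        fun x y => by rw [map_smul]; exact Submodule.smul_mem _ _ (ha.2.2 x y)⟩ }

theorem mem_flat_zero (a : A) : a ∈ C.flat 0 := Submodule.mem_top

theorem flat_succ_le (n : ℕ) : C.flat (n + 1) ≤ C.flat n := fun _ h => h.1

theorem mem_flat_succ {n : ℕ} {a : A} : a ∈ C.flat (n + 1) ↔
    (∀ x, C.nabla x a ∈ C.flat n) ∧ ∀ x y, C.curv x y a ∈ C.ord (n + 1) := by
  refine ⟨fun h => h.2, fun h => ⟨?_, h⟩⟩
  induction n with
  | zero => exact mem_flat_zero a
  | succ n ih =>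
    have h' : (∀ x, C.nabla x a ∈ C.flat n) ∧ ∀ x y, C.curv x y a ∈ C.ord (n + 1) :=
      ⟨fun x => flat_succ_le n (h.1 x), fun x y => ord_succ_le _ (h.2 x y)⟩
    exact ⟨ih h', h'⟩

theorem nabla_mem_flat {n : ℕ} {a : A} (ha : a ∈ C.flat n) (x : L) :
    C.nabla x a ∈ C.flat (n - 1) := by
  rcases n with _ | n
  · exact mem_flat_zero _
  · exact (mem_flat_succ.1 ha).1 x

theorem curv_mem_ord_of_flat {n : ℕ} {a : A} (ha : a ∈ C.flat n) (x y : L) :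
    C.curv x y a ∈ C.ord n := by
  rcases n with _ | n
  · exact mem_ord_zero _
  · exact (mem_flat_succ.1 ha).2 x y

/-- Curvature is of second order, so it lowers the order of vanishing by at most two. -/
theorem ord_le_flat (n : ℕ) : C.ord (n + 2) ≤ C.flat n := by
  induction n with
  | zero => exact fun _ _ => mem_flat_zero _
  | succ n ih =>
    exact fun a ha => mem_flat_succ.2 ⟨fun x => ih (nabla_mem_ord ha x), curv_mem_ord ha⟩

/-- The connection and its curvature both obey the Leibniz rule. -/
theorem mul_mem_flat {n : ℕ} {a b : A} (ha : a ∈ C.flat n) (hb : b ∈ C.flat n) :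
    C.mul a b ∈ C.flat n := by
  induction n generalizing a b with
  | zero => exact mem_flat_zero _
  | succ n ih =>
    refine mem_flat_succ.2 ⟨fun x => ?_, fun x y => ?_⟩
    · rw [C.nabla_mul]
      exact add_mem (ih (ha.2.1 x) hb.1) (ih ha.1 (hb.2.1 x))
    · rw [curv_mul]
      refine add_mem ?_ ?_
      · exact mul_mem_ord (m := n + 1) (ha.2.2 x y) (mem_ord_zero b)
      · simpa using mul_mem_ord (mem_ord_zero a) (hb.2.2 x y)

/-! ### Correcting elements to flat ones, order by order -/

section Lift

variable {ι : Type*} [Fintype ι] {l : ι → L} {lam : ι → L →ₗ[R] R}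

theorem sum_dual_smul_map (hl : ∀ x, ∑ i, lam i x • l i = x) (φ : L →ₗ[R] A) (x : L) :
    ∑ i, lam i x • φ (l i) = φ x := by
  conv_rhs => rw [← hl x]
  simp only [map_sum, map_smul]

theorem sum_dual_smul_nabla (hl : ∀ x, ∑ i, lam i x • l i = x) (x : L) (a : A) :
    ∑ i, lam i x • C.nabla (l i) a = C.nabla x a := by
  conv_rhs => rw [← hl x]
  simp only [map_sum, map_smul, AddMonoidHom.finsetSum_apply, AddMonoidHom.smul_apply]

/-- Euler's identity for a curved connection. Commuting `∇ x` past `∇ (l i)` produces curvature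
terms, which `ha'` makes small enough once multiplied by `t i`. The truncated `n - 1` imposes no
condition for `n ≤ 1`. -/
theorem euler_mem_ord (hl : ∀ x, ∑ i, lam i x • l i = x) {t : ι → A}
    (ht : ∀ i, C.aug (t i) = 0) (ht' : ∀ i x, C.aug (C.nabla x (t i)) = lam i x) {n : ℕ} {a : A}
    (ha : a ∈ C.ord n) (ha' : a ∈ C.flat (n - 1)) :
    ∑ i, C.mul (t i) (C.nabla (l i) a) - n • a ∈ C.ord (n + 1) := by
  induction n generalizing a with
  | zero =>
    rw [zero_smul, sub_zero]
    exact sum_mem fun i _ => mul_mem_ord_succ (ht i) (mem_ord_zero _)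
  | succ n ih =>
    refine mem_ord_succ.2 ⟨?_, fun x => ?_⟩
    · simp [C.aug_mul, ht, (mem_ord_succ.1 ha).1]
    · have : C.nabla x (∑ i, C.mul (t i) (C.nabla (l i) a) - (n + 1) • a) =
          ∑ i, (C.mul (C.nabla x (t i)) (C.nabla (l i) a) -
            C.aug (C.nabla x (t i)) • C.nabla (l i) a) +
          (∑ i, C.mul (t i) (C.nabla (l i) (C.nabla x a)) - n • C.nabla x a) +
          ∑ i, (C.mul (t i) (C.nabla ⁅x, l i⁆ a) + C.mul (t i) (C.curv x (l i) a)) := by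
        simp only [curv_apply, map_add, map_sub, map_sum, C.nabla_mul, Finset.sum_add_distrib,
          Finset.sum_sub_distrib, ht', sum_dual_smul_nabla hl, map_nsmul, add_smul, one_smul]
        abel
      rw [this]
      refine add_mem (add_mem (sum_mem fun i _ => mul_sub_smul_mem_ord _ (nabla_mem_ord ha _))
        (ih (nabla_mem_ord ha x) (nabla_mem_flat ha' x))) (sum_mem fun i _ => add_mem ?_ ?_)
      · exact mul_mem_ord_succ (ht i) (nabla_mem_ord ha _)
      · exact mul_mem_ord_succ (ht i) (curv_mem_ord_of_flat ha' x _)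

/-- The one-form can be corrected so that its exterior derivative vanishes to one more order. -/
theorem exists_flat_form (hl : ∀ x, ∑ i, lam i x • l i = x) {t : ι → A}
    (ht : ∀ i, C.aug (t i) = 0) (ht' : ∀ i x, C.aug (C.nabla x (t i)) = lam i x) {n : ℕ}
    (ht'' : ∀ i, t i ∈ C.flat n) {s : R} (hs : s * (n + 2) = 1)
    (h : ∀ a ∈ C.flat (n - 1), ∃ a' ∈ C.flat n, a' - a ∈ C.ord (n + 1))
    (γ : L →ₗ[R] A) (hγ : ∀ x, γ x ∈ C.flat n) (hγ' : ∀ x y, C.extDer γ x y ∈ C.ord n) :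
    ∃ e : L →ₗ[R] A, (∀ x, e x ∈ C.flat n) ∧ (∀ x, e x ∈ C.ord (n + 1)) ∧
      ∀ x y, C.extDer (γ + e) x y ∈ C.ord (n + 1) := by
  have hc : ∀ x y, C.extDer γ x y ∈ C.flat (n - 1) := fun x y =>
    sub_mem (sub_mem (nabla_mem_flat (hγ y) x) (nabla_mem_flat (hγ x) y)) (by
      rcases n with _ | n
      · exact mem_flat_zero _
      · exact flat_succ_le _ (hγ _))
  choose c' hc' hc'' using fun i j => h (C.extDer γ (l i) (l j)) (hc _ _)
  -- `d j` replaces the form `x ↦ C.extDer γ x (l j)`, whose values are known to be flat only to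
  -- order `n - 1`, by one with values flat to order `n`. This keeps the correction within `C.flat
  -- n`.
  let d : ι → L →ₗ[R] A := fun j => ∑ i, (lam i).smulRight (c' i j)
  have hd_apply : ∀ j x, d j x = ∑ i, lam i x • c' i j := fun j x => by
    simp [d, LinearMap.sum_apply]
  have hd_flat : ∀ j x, d j x ∈ C.flat n := fun j x => by
    rw [hd_apply]
    exact sum_mem fun i _ => Submodule.smul_mem _ _ (hc' i j)
  have hd : ∀ j x, d j x - C.extDer γ x (l j) ∈ C.ord (n + 1) := fun j x => by
    have h1 : C.extDer γ x (l j) = ∑ i, lam i x • C.extDer γ (l i) (l j) := by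
      simp only [extDer_swap γ (l j), smul_neg, Finset.sum_neg_distrib]
      exact congrArg Neg.neg (sum_dual_smul_map hl (C.extDerₗ γ (l j)) x).symm
    rw [hd_apply, h1, ← Finset.sum_sub_distrib]
    simp only [← smul_sub]
    exact sum_mem fun i _ => Submodule.smul_mem _ _ (hc'' i j)
  have hd_ord : ∀ j x, d j x ∈ C.ord n := fun j x => by
    have := add_mem (ord_succ_le _ (hd j x)) (hγ' x (l j))
    rwa [sub_add_cancel] at this
  -- Up to sign and approximation, this is the contraction of the two-form `C.extDer γ` with the
  -- Euler field $\sum t_je_j$: the homotopy operator of a formal Poincaré lemma.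
  let E : L →ₗ[R] A := ∑ j, (C.mul (t j)).comp (d j)
  have hE_apply : ∀ x, E x = ∑ j, C.mul (t j) (d j x) := fun x => by
    simp [E, LinearMap.sum_apply]
  have hE : ∀ x, E x ∈ C.ord (n + 1) := fun x => by
    rw [hE_apply]
    exact sum_mem fun j _ => mul_mem_ord_succ (ht j) (hd_ord j x)
  have claim₁ : ∀ x y, C.nabla x (E y) - C.extDer γ y x -
      ∑ j, C.mul (t j) (C.nabla x (C.extDer γ y (l j))) ∈ C.ord (n + 1) := by
    intro x y
    have h1 : C.extDer γ y x = ∑ j, lam j x • C.extDer γ y (l j) :=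
      (sum_dual_smul_map hl (C.extDerₗ γ y) x).symm
    have : C.nabla x (E y) - C.extDer γ y x -
        ∑ j, C.mul (t j) (C.nabla x (C.extDer γ y (l j))) =
        ∑ j, ((C.mul (C.nabla x (t j)) (d j y) - C.aug (C.nabla x (t j)) • d j y) +
          lam j x • (d j y - C.extDer γ y (l j)) +
          C.mul (t j) (C.nabla x (d j y - C.extDer γ y (l j)))) := by
      rw [hE_apply, h1]
      simp only [map_sum, C.nabla_mul, Finset.sum_add_distrib, Finset.sum_sub_distrib, ht',
        map_sub, smul_sub]
      abel
    rw [this]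
    refine sum_mem fun j _ => add_mem (add_mem (mul_sub_smul_mem_ord _ (hd_ord j y))
      (Submodule.smul_mem _ _ (hd j y))) (mul_mem_ord_succ (ht j) (nabla_mem_ord (hd j y) x))
  -- The cyclic sum in the Bianchi identity is of order `n`, because the values of `γ` are flat to
  -- order `n` and its torsion has order `n`; the factor `t j` raises the order by one.
  have claim₂ : ∀ x y, ∑ j, C.mul (t j) (C.nabla x (C.extDer γ y (l j)) -
      C.nabla y (C.extDer γ x (l j)) + C.nabla (l j) (C.extDer γ x y)) ∈ C.ord (n + 1) := by
    intro x y
    refine sum_mem fun j _ => mul_mem_ord_succ (ht j) ?_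
    have h1 := bianchi (C := C) γ x y (l j)
    rw [extDer_swap γ x (l j), map_neg, ← sub_eq_add_neg] at h1
    rw [h1]
    refine add_mem (add_mem (add_mem ?_ ?_) ?_) (add_mem (add_mem (hγ' _ _) (hγ' _ _)) (hγ' _ _))
    all_goals exact curv_mem_ord_of_flat (hγ _) _ _
  -- Cartan's formula on leading terms: the Euler field acts on a two-form with coefficients of
  -- degree `n` by `n + 2`, where `n` comes from Euler's identity and `2` from the two uses of
  -- `claim₁`. Hence `s • E` with `s = 1 / (n + 2)` cancels the torsion.
  have claim₃ : ∀ x y, C.nabla x (E y) - C.nabla y (E x) + (n + 2) • C.extDer γ x y ∈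
      C.ord (n + 1) := by
    intro x y
    have h1 := euler_mem_ord hl ht ht' (hγ' x y) (hc x y)
    have h2 := sub_mem (add_mem (sub_mem (claim₁ x y) (claim₁ y x)) (claim₂ x y)) h1
    convert h2 using 1
    rw [extDer_swap γ x y]
    simp only [map_add, map_sub, Finset.sum_add_distrib, Finset.sum_sub_distrib, add_smul, two_smul]
    abel
  refine ⟨s • E, fun x => Submodule.smul_mem _ _ ?_, fun x => Submodule.smul_mem _ _ (hE x),
    fun x y => ?_⟩
  · rw [hE_apply]
    exact sum_mem fun j _ => mul_mem_flat (ht'' j) (hd_flat j x)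
  · have : C.extDer (γ + s • E) x y =
        s • (C.nabla x (E y) - C.nabla y (E x) + (n + 2) • C.extDer γ x y) +
          ⁅x, s⁆ • E y - ⁅y, s⁆ • E x - s • E ⁅x, y⁆ := by
      have h1 : s • (n + 2) • C.extDer γ x y = C.extDer γ x y := by
        rw [← Nat.cast_smul_eq_nsmul R, smul_smul]
        push_cast
        rw [hs, one_smul]
      rw [smul_add, h1, smul_sub]
      simp only [extDer, LinearMap.add_apply, LinearMap.smul_apply, map_add, C.nabla_smul]
      abel
    rw [this]
    exact sub_mem (sub_mem (add_mem (Submodule.smul_mem _ _ (claim₃ x y))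
      (Submodule.smul_mem _ _ (hE y))) (Submodule.smul_mem _ _ (hE x)))
      (Submodule.smul_mem _ _ (hE _))

/-- The form `x ↦ ∇ x a` is approximated by one with values flat to order `n`. The curvature bound
on `a` makes its torsion of order `n`, so `exists_flat_form` applies. The corrected form is
integrated by `exists_nabla_eq`; the curvature of the primitive is exactly the torsion of the form.
-/
theorem exists_flat_lift_of_coord (hl : ∀ x, ∑ i, lam i x • l i = x) {t : ι → A}
    (ht : ∀ i, C.aug (t i) = 0) (ht' : ∀ i x, C.aug (C.nabla x (t i)) = lam i x) {n : ℕ}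
    (ht'' : ∀ i, t i ∈ C.flat n) {s : R} (hs : s * (n + 2) = 1)
    (h : ∀ a ∈ C.flat (n - 1), ∃ a' ∈ C.flat n, a' - a ∈ C.ord (n + 1))
    {a : A} (ha : a ∈ C.flat n) : ∃ a' ∈ C.flat (n + 1), a' - a ∈ C.ord (n + 2) := by
  choose g hg hg' using fun i => h (C.nabla (l i) a) (nabla_mem_flat ha _)
  let γ : L →ₗ[R] A := ∑ i, (lam i).smulRight (g i)
  have hγ_apply : ∀ x, γ x = ∑ i, lam i x • g i := fun x => by simp [γ, LinearMap.sum_apply]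
  have hγ : ∀ x, γ x ∈ C.flat n := fun x => by
    rw [hγ_apply]
    exact sum_mem fun i _ => Submodule.smul_mem _ _ (hg i)
  have hγ' : ∀ x, γ x - C.nabla x a ∈ C.ord (n + 1) := fun x => by
    rw [hγ_apply, ← sum_dual_smul_nabla hl x a, ← Finset.sum_sub_distrib]
    simp only [← smul_sub]
    exact sum_mem fun i _ => Submodule.smul_mem _ _ (hg' i)
  have hext : ∀ x y, C.extDer γ x y ∈ C.ord n := fun x y => by
    have : C.extDer γ x y = C.curv x y a + (C.nabla x (γ y - C.nabla y a) -
        C.nabla y (γ x - C.nabla x a) - (γ ⁅x, y⁆ - C.nabla ⁅x, y⁆ a)) := by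
      simp only [extDer, curv_apply, map_sub]
      abel
    rw [this]
    exact add_mem (curv_mem_ord_of_flat ha x y) (sub_mem (sub_mem (nabla_mem_ord (hγ' y) x)
      (nabla_mem_ord (hγ' x) y)) (ord_succ_le _ (hγ' _)))
  obtain ⟨e, he, he', hγe⟩ := exists_flat_form hl ht ht' ht'' hs h γ hγ hext
  obtain ⟨a', ha', ha''⟩ := C.exists_nabla_eq (C.aug a) (γ + e)
  refine ⟨a', mem_flat_succ.2 ⟨fun x => ?_, fun x y => ?_⟩, mem_ord_succ.2 ⟨?_, fun x => ?_⟩⟩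
  · rw [ha'']
    exact add_mem (hγ x) (he x)
  · rw [curv_apply, ha'', ha'', ha'']
    exact hγe x y
  · rw [map_sub, ha', sub_self]
  · rw [map_sub, ha'', LinearMap.add_apply, add_sub_right_comm]
    exact add_mem (hγ' x) (he' x)

/-- Every element that is flat to order `n` can be improved to one that is flat to order
`n + 1`. -/
theorem exists_flat_lift (hl : ∀ x, ∑ i, lam i x • l i = x)
    (hs : ∀ n : ℕ, ∃ s : R, s * (n + 2) = 1) (n : ℕ) :
    (∀ φ : L →ₗ[R] R, ∃ a ∈ C.flat n, C.aug a = 0 ∧ ∀ x, C.aug (C.nabla x a) = φ x) ∧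
      ∀ a ∈ C.flat n, ∃ a' ∈ C.flat (n + 1), a' - a ∈ C.ord (n + 2) := by
  -- The two claims need each other: lifting an element flat to order `n` uses coordinates flat to
  -- the same order, which are obtained by lifting those of the previous order.
  induction n with
  | zero =>
    have h0 : ∀ φ : L →ₗ[R] R, ∃ a ∈ C.flat 0, C.aug a = 0 ∧ ∀ x, C.aug (C.nabla x a) = φ x := by
      intro φ
      obtain ⟨u, hu, -⟩ := C.exists_nabla_eq 1 0
      obtain ⟨a, ha, ha'⟩ := C.exists_nabla_eq 0 (φ.smulRight u)
      refine ⟨a, mem_flat_zero a, ha, fun x => ?_⟩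
      rw [ha', LinearMap.smulRight_apply, map_smul, hu, smul_eq_mul, mul_one]
    refine ⟨h0, fun a ha => ?_⟩
    choose t ht ht' ht'' using fun i => h0 (lam i)
    obtain ⟨s, hs⟩ := hs 0
    -- For `n = 0` the truncated `n - 1` is again zero, so an element serves as its own lift.
    exact exists_flat_lift_of_coord hl ht' ht'' ht hs
      (fun a ha => ⟨a, ha, by rw [sub_self]; exact zero_mem _⟩) ha
  | succ n ih =>
    have h1 : ∀ φ : L →ₗ[R] R, ∃ a ∈ C.flat (n + 1), C.aug a = 0 ∧
        ∀ x, C.aug (C.nabla x a) = φ x := by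
      intro φ
      obtain ⟨a, ha, ha', ha''⟩ := ih.1 φ
      obtain ⟨b, hb, hb'⟩ := ih.2 a ha
      have h2 := mem_ord_succ.1 hb'
      refine ⟨b, hb, ?_, fun x => ?_⟩
      · rw [← sub_eq_zero, ← ha', ← map_sub, h2.1, ha']
      · have h3 := (mem_ord_succ.1 (h2.2 x)).1
        rwa [map_sub, map_sub, sub_eq_zero, ha''] at h3
    refine ⟨h1, fun a ha => ?_⟩
    choose t ht ht' ht'' using fun i => h1 (lam i)
    obtain ⟨s, hs⟩ := hs (n + 1)
    exact exists_flat_lift_of_coord hl ht' ht'' ht hs ih.2 ha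

/-- If `A` is complete, then every linear form on `L` is the first derivative of a flat element. -/
theorem exists_flat (hl : ∀ x, ∑ i, lam i x • l i = x)
    (hs : ∀ n : ℕ, ∃ s : R, s * (n + 2) = 1)
    (hlim : ∀ f : ℕ → A, (∀ n, f (n + 1) - f n ∈ C.ord (n + 2)) →
      ∃ a, ∀ n, a - f n ∈ C.ord (n + 2)) (φ : L →ₗ[R] R) :
    ∃ a, (∀ n, a ∈ C.flat n) ∧ C.aug a = 0 ∧ ∀ x, C.aug (C.nabla x a) = φ x := by
  choose next hnext hnext' using fun n => (exists_flat_lift (C := C) hl hs n).2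
  obtain ⟨a₀, -, ha₀, ha₀'⟩ := (exists_flat_lift (C := C) hl hs 0).1 φ
  -- The `n`-th iterate is flat to order `n` and differs from the limit by order `n + 2`, which by
  -- `ord_le_flat` does not affect flatness to order `n`.
  let f : ∀ n, C.flat n := fun n => Nat.rec ⟨a₀, mem_flat_zero _⟩
    (fun n a => ⟨next n a.1 a.2, hnext n a.1 a.2⟩) n
  obtain ⟨a, ha⟩ := hlim (fun n => (f n).1) (fun n => hnext' n (f n).1 (f n).2)
  have h1 := mem_ord_succ.1 (ha 0)
  refine ⟨a, fun n => ?_, ?_, fun x => ?_⟩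
  · have := add_mem (ord_le_flat n (ha n)) (f n).2
    rwa [sub_add_cancel] at this
  · have h2 := h1.1
    rw [map_sub, sub_eq_zero] at h2
    exact h2.trans ha₀
  · have h2 := (mem_ord_succ.1 (h1.2 x)).1
    rw [map_sub, map_sub, sub_eq_zero] at h2
    exact h2.trans (ha₀' x)

end Lift

end FreeConnection

/-! ### Noncommutative formal power series -/

namespace Shuffle

variable {R ι : Type*} [CommRing R]

/-- The coefficient of `w` in the shuffle product of `a` and `b`. -/
def coeffMul : List ι → (List ι → R) → (List ι → R) → R
  | [], a, b => a [] * b []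
  | i :: w, a, b => coeffMul w (fun v => a (i :: v)) b + coeffMul w a (fun v => b (i :: v))

theorem coeffMul_add_left (w : List ι) (a a' b : List ι → R) :
    coeffMul w (a + a') b = coeffMul w a b + coeffMul w a' b := by
  induction w generalizing a a' b with
  | nil => simp [coeffMul, add_mul]
  | cons i w ih =>
    have := ih (fun v => a (i :: v)) (fun v => a' (i :: v)) b
    simp only [coeffMul, ih]
    rw [add_add_add_comm, ← this]
    rfl

theorem coeffMul_add_right (w : List ι) (a b b' : List ι → R) :
    coeffMul w a (b + b') = coeffMul w a b + coeffMul w a b' := by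
  induction w generalizing a b b' with
  | nil => simp [coeffMul, mul_add]
  | cons i w ih =>
    have := ih a (fun v => b (i :: v)) (fun v => b' (i :: v))
    simp only [coeffMul, ih]
    rw [add_add_add_comm, ← this]
    rfl

theorem coeffMul_smul_left (w : List ι) (r : R) (a b : List ι → R) :
    coeffMul w (r • a) b = r * coeffMul w a b := by
  induction w generalizing a b with
  | nil => simp [coeffMul, mul_assoc]
  | cons i w ih =>
    have := ih (fun v => a (i :: v)) b
    simp only [coeffMul, ih, mul_add]
    rw [← this]
    rfl

theorem coeffMul_smul_right (w : List ι) (r : R) (a b : List ι → R) :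
    coeffMul w a (r • b) = r * coeffMul w a b := by
  induction w generalizing a b with
  | nil => simp [coeffMul, mul_left_comm]
  | cons i w ih =>
    have := ih a (fun v => b (i :: v))
    simp only [coeffMul, ih, mul_add]
    rw [← this]
    rfl

/-- The shuffle product. -/
def mul : (List ι → R) →ₗ[R] (List ι → R) →ₗ[R] (List ι → R) :=
  LinearMap.mk₂ R (fun a b w => coeffMul w a b)
    (fun _ _ _ => funext fun w => coeffMul_add_left w _ _ _)
    (fun _ _ _ => funext fun w => coeffMul_smul_left w _ _ _)
    (fun _ _ _ => funext fun w => coeffMul_add_right w _ _ _)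
    (fun _ _ _ => funext fun w => coeffMul_smul_right w _ _ _)

theorem mul_apply (a b : List ι → R) (w : List ι) : mul a b w = coeffMul w a b := rfl

variable {L : Type*} [LieRing L] [Module R L] [LieRingModule L R]

theorem lie_coeffMul [LieRinehartRing R L] (x : L) (w : List ι) (a b : List ι → R) :
    ⁅x, coeffMul w a b⁆ =
      coeffMul w (fun v => ⁅x, a v⁆) b + coeffMul w a (fun v => ⁅x, b v⁆) := by
  induction w generalizing a b with
  | nil =>
    simp only [coeffMul, LieRinehartRing.leibniz_mul_right, smul_eq_mul]
    ring
  | cons i w ih =>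
    simp only [coeffMul, lie_add, ih]
    abel

variable [Fintype ι]

/-- The covariant derivative `a ↦ x(a) + ∑ i, lam i x ∂ᵢ a`. -/
def nabla (lam : ι → L →ₗ[R] R) [LieRinehartRing R L] :
    L →ₗ[R] (List ι → R) →+ (List ι → R) where
  toFun x := AddMonoidHom.mk' (fun a w => ⁅x, a w⁆ + ∑ i, lam i x * a (i :: w))
    (fun a b => funext fun w => by
      simp only [Pi.add_apply, lie_add, mul_add, Finset.sum_add_distrib]
      abel)
  map_add' x y := AddMonoidHom.ext fun a => funext fun w => by
    simp only [AddMonoidHom.mk'_apply, AddMonoidHom.add_apply, Pi.add_apply, add_lie, map_add,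
      add_mul, Finset.sum_add_distrib]
    abel
  map_smul' r x := AddMonoidHom.ext fun a => funext fun w => by
    simp only [AddMonoidHom.mk'_apply, AddMonoidHom.smul_apply, Pi.smul_apply, map_smul,
      LieRinehartRing.lie_smul_eq_mul, smul_eq_mul, mul_add, Finset.mul_sum, mul_assoc,
      RingHom.id_apply]

theorem nabla_apply (lam : ι → L →ₗ[R] R) [LieRinehartRing R L] (x : L) (a : List ι → R)
    (w : List ι) : nabla lam x a w = ⁅x, a w⁆ + ∑ i, lam i x * a (i :: w) := rfl

/-- The series with constant term `c` and prescribed covariant derivatives `γ i`. -/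
def primitive (l : ι → L) (c : R) (γ : ι → List ι → R) : List ι → R
  | [] => c
  | i :: w => γ i w - ⁅l i, primitive l c γ w⁆

/-- The recursion defining `primitive` solves the equation for each vector `l i`; the identity
$\sum\lambda_i(x)l_i=x$ extends it to all `x`. The `l i` need not be linearly independent. -/
theorem nabla_primitive [LieRinehartRing R L] {lam : ι → L →ₗ[R] R} {l : ι → L}
    (hl : ∀ x, ∑ i, lam i x • l i = x) (c : R) (γ : ι → List ι → R) (x : L) :
    nabla lam x (primitive l c γ) = ∑ i, lam i x • γ i := by
  refine funext fun w => ?_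
  rw [nabla_apply, Finset.sum_apply]
  simp only [primitive, mul_sub, Finset.sum_sub_distrib, Pi.smul_apply, smul_eq_mul,
    ← LieRinehartRing.lie_smul_eq_mul]
  have h : ⁅x, primitive l c γ w⁆ = ∑ i, ⁅lam i x • l i, primitive l c γ w⁆ := by
    conv_lhs => rw [← hl x]
    exact map_sum (AddMonoidHom.mk' (fun y : L => ⁅y, primitive l c γ w⁆)
      fun y z => add_lie y z _) _ _
  rw [h]
  abel

/-- The connection on noncommutative formal power series associated with a dual basis of `L`. -/
def connection [LieRinehartRing R L] {lam : ι → L →ₗ[R] R} {l : ι → L}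
    (hl : ∀ x, ∑ i, lam i x • l i = x) : FreeConnection R L (List ι → R) where
  nabla := nabla lam
  aug := LinearMap.proj []
  mul := mul
  nabla_smul x r a := funext fun w => by
    simp only [nabla_apply, Pi.add_apply, Pi.smul_apply, smul_eq_mul,
      LieRinehartRing.leibniz_mul_right, mul_add, Finset.mul_sum]
    simp only [mul_left_comm r]
    abel
  nabla_mul x a b := funext fun w => by
    have h1 : ∀ (c d : List ι → R), nabla lam x c =
        (fun v => ⁅x, c v⁆) + ∑ i, lam i x • fun v => c (i :: v) := fun c d => by
      funext v
      simp [nabla_apply]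
    have h2 : nabla lam x (mul a b) w = ⁅x, mul a b w⁆ + ∑ i, lam i x * mul a b (i :: w) := rfl
    rw [h2, h1 a a, h1 b b]
    simp only [map_add, map_sum, map_smul, LinearMap.add_apply, LinearMap.sum_apply,
      LinearMap.smul_apply, Pi.add_apply, Finset.sum_apply, Pi.smul_apply, smul_eq_mul]
    simp only [mul_apply, lie_coeffMul, coeffMul, mul_add, Finset.sum_add_distrib]
    abel
  aug_mul _ _ := rfl
  exists_nabla_eq c γ := ⟨primitive l c fun i => γ (l i), rfl, fun x => by
    rw [nabla_primitive hl, FreeConnection.sum_dual_smul_map hl γ]⟩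

variable [LieRinehartRing R L] {lam : ι → L →ₗ[R] R} {l : ι → L}

theorem mem_ord_of_forall (hl : ∀ x, ∑ i, lam i x • l i = x) {n : ℕ} {a : List ι → R}
    (h : ∀ w : List ι, w.length < n → a w = 0) : a ∈ (connection hl).ord n := by
  induction n generalizing a with
  | zero => exact FreeConnection.mem_ord_zero _
  | succ n ih =>
    refine FreeConnection.mem_ord_succ.2 ⟨h [] (Nat.succ_pos n), fun x => ih fun w hw => ?_⟩
    have h2 : (connection hl).nabla x a w = ⁅x, a w⁆ + ∑ i, lam i x * a (i :: w) := rfl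
    rw [h2, h w (by omega), lie_zero, zero_add]
    refine Finset.sum_eq_zero fun i _ => ?_
    rw [h (i :: w) (by simpa using hw), mul_zero]

/-- As the `l i` may satisfy relations, a series of order `n` can have nonzero coefficients on words
shorter than `n`. A change of infinite order removes them, by integrating coefficientwise the
corrected derivatives. -/
theorem exists_forall_eq_zero (hl : ∀ x, ∑ i, lam i x • l i = x) (n : ℕ) :
    ∀ a ∈ (connection hl).ord n, ∃ b : List ι → R, (∀ w : List ι, w.length < n → b w = 0) ∧
      ∀ m, b - a ∈ (connection hl).ord m := by
  induction n with
  | zero =>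
    exact fun a _ => ⟨a, fun w hw => absurd hw (Nat.not_lt_zero _), fun m => by
      rw [sub_self]; exact zero_mem _⟩
  | succ n ih =>
    intro a ha
    choose b hb hb' using fun i => ih _ (FreeConnection.nabla_mem_ord ha (l i))
    refine ⟨primitive l 0 b, fun w => ?_, fun m => ?_⟩
    · induction w with
      | nil => exact fun _ => rfl
      | cons i w ihw =>
        intro hw
        rw [List.length_cons] at hw
        rw [primitive, ihw (by omega), hb i w (by omega), lie_zero, sub_zero]
    · rcases m with _ | m
      · exact FreeConnection.mem_ord_zero _
      · refine FreeConnection.mem_ord_succ.2 ⟨?_, fun x => ?_⟩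
        · rw [map_sub, (FreeConnection.mem_ord_succ.1 ha).1, sub_zero]
          rfl
        · have h1 : (connection hl).nabla x (primitive l 0 b) = ∑ i, lam i x • b i :=
            nabla_primitive hl 0 b x
          rw [map_sub, h1, ← FreeConnection.sum_dual_smul_nabla hl x a, ← Finset.sum_sub_distrib]
          simp only [← smul_sub]
          exact sum_mem fun i _ => Submodule.smul_mem _ _ (hb' i m)

theorem exists_lim (hl : ∀ x, ∑ i, lam i x • l i = x) (f : ℕ → List ι → R)
    (hf : ∀ n, f (n + 1) - f n ∈ (connection hl).ord (n + 2)) :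
    ∃ a, ∀ n, a - f n ∈ (connection hl).ord (n + 2) := by
  choose η hη hη' using fun n => exists_forall_eq_zero hl _ _ (hf n)
  let g : ℕ → List ι → R := fun n => f 0 + ∑ m ∈ Finset.range n, η m
  have hg : ∀ n p, g n - f n ∈ (connection hl).ord p := by
    intro n p
    induction n with
    | zero => simp [g]
    | succ n ih =>
      have : g (n + 1) - f (n + 1) = (g n - f n) + (η n - (f (n + 1) - f n)) := by
        simp only [g, Finset.sum_range_succ]
        abel
      rw [this]
      exact add_mem ih (hη' n p)
  -- The increment `η m` vanishes on words of length less than `m + 2`, so the coefficient at `w` is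
  -- stationary from the partial sum with index `w.length - 1` on.
  refine ⟨fun w => g (w.length - 1) w, fun n => ?_⟩
  have : (fun w : List ι => g (w.length - 1) w) - f n =
      ((fun w : List ι => g (w.length - 1) w) - g n) + (g n - f n) := by abel
  rw [this]
  refine add_mem (mem_ord_of_forall hl fun w hw => ?_) (hg n _)
  simp only [Pi.sub_apply, g, Pi.add_apply, Finset.sum_apply]
  rw [add_sub_add_left_eq_sub, sub_eq_zero]
  refine Finset.sum_subset (Finset.range_mono (by omega)) fun m _ hm => hη m w ?_
  rw [Finset.mem_range] at hm
  omega

end Shuffle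

/-! ### Existence of jets with prescribed first derivative -/

namespace FreeConnection

variable {k R L A : Type*} [CommRing k] [CommRing R] [Algebra k R] [LieRing L] [LieAlgebra k L]
  [Module R L] [LieRingModule L R] [LieRinehartRing R L] [LieRinehartAlgebra k R L]
  [AddCommGroup A] [Module R A] [Module k A] [IsScalarTower k R A] (C : FreeConnection R L A)

open LieAlgebroid

/-- The elements of infinite order. -/
def ordTop : Submodule R A := ⨅ n, C.ord n

/-- The elements that are flat to all orders. -/
def flatTop : Submodule R A := ⨅ n, C.flat n

variable {C}

theorem mem_ordTop {a : A} : a ∈ C.ordTop ↔ ∀ n, a ∈ C.ord n := Submodule.mem_iInf _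

theorem mem_flatTop {a : A} : a ∈ C.flatTop ↔ ∀ n, a ∈ C.flat n := Submodule.mem_iInf _

theorem nabla_mem_ordTop {a : A} (ha : a ∈ C.ordTop) (x : L) : C.nabla x a ∈ C.ordTop :=
  mem_ordTop.2 fun n => nabla_mem_ord (mem_ordTop.1 ha (n + 1)) x

theorem nabla_mem_flatTop {a : A} (ha : a ∈ C.flatTop) (x : L) : C.nabla x a ∈ C.flatTop :=
  mem_flatTop.2 fun n => nabla_mem_flat (mem_flatTop.1 ha (n + 1)) x

theorem curv_mem_ordTop {a : A} (ha : a ∈ C.flatTop) (x y : L) : C.curv x y a ∈ C.ordTop :=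
  mem_ordTop.2 fun n => curv_mem_ord_of_flat (mem_flatTop.1 ha n) x y

variable (C) in
/-- Flat elements modulo elements of infinite order. -/
abbrev FlatQuot : Type _ := C.flatTop ⧸ C.ordTop.submoduleOf C.flatTop

variable (C) in
/-- The connection on `FlatQuot`. -/
def nablaQuot (x : L) : C.FlatQuot →+ C.FlatQuot :=
  QuotientAddGroup.map _ _
    (AddMonoidHom.mk' (fun a : C.flatTop => (⟨C.nabla x a, nabla_mem_flatTop a.2 x⟩ : C.flatTop))
      (fun a b => Subtype.ext (map_add (C.nabla x) a.1 b.1)))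
    (fun a (ha : a.1 ∈ C.ordTop) => nabla_mem_ordTop ha x)

theorem nablaQuot_mk (x : L) (a : C.flatTop) :
    C.nablaQuot x (Submodule.Quotient.mk a) =
      Submodule.Quotient.mk ⟨C.nabla x a, nabla_mem_flatTop a.2 x⟩ := rfl

theorem nablaQuot_smul (x : L) (r : R) (m : C.FlatQuot) :
    C.nablaQuot x (r • m) = ⁅x, r⁆ • m + r • C.nablaQuot x m := by
  obtain ⟨a, rfl⟩ := Submodule.Quotient.mk_surjective _ m
  rw [← Submodule.Quotient.mk_smul, nablaQuot_mk, nablaQuot_mk, ← Submodule.Quotient.mk_smul,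
    ← Submodule.Quotient.mk_smul, ← Submodule.Quotient.mk_add]
  exact congrArg _ (Subtype.ext (C.nabla_smul x r a))

variable (k L) in
theorem _root_.LieAlgebroid.lie_algebraMap (x : L) (c : k) : ⁅x, algebraMap k R c⁆ = 0 := by
  rw [Algebra.algebraMap_eq_smul_one]
  refine ((LieModule.toEnd k L R x).map_smul c 1).trans ?_
  rw [LieModule.toEnd_apply_apply, lie_one_eq, smul_zero]

variable (k C) in
/-- The connection on `FlatQuot`, as a map to `k`-linear endomorphisms. -/
def connQuot : L →+ Module.End k C.FlatQuot :=
  AddMonoidHom.mk'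
    (fun x =>
      { toFun := C.nablaQuot x
        map_add' := map_add _
        map_smul' := fun c m => by
          rw [← algebraMap_smul R c m, nablaQuot_smul, lie_algebraMap, zero_smul, zero_add,
            algebraMap_smul]
          rfl })
    (fun x y => LinearMap.ext fun m => by
      obtain ⟨a, rfl⟩ := Submodule.Quotient.mk_surjective _ m
      rw [LinearMap.add_apply]
      change C.nablaQuot (x + y) (Submodule.Quotient.mk a) =
        C.nablaQuot x (Submodule.Quotient.mk a) + C.nablaQuot y (Submodule.Quotient.mk a)
      rw [nablaQuot_mk, nablaQuot_mk, nablaQuot_mk, ← Submodule.Quotient.mk_add]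
      exact congrArg _ (Subtype.ext (by simp)))

theorem connQuot_apply (x : L) (m : C.FlatQuot) : connQuot k C x m = C.nablaQuot x m := rfl

variable (k C) in
/-- `FlatQuot` is a module over the enveloping algebra. -/
def flatRep : Rep k R L C.FlatQuot :=
  Rep.mk' (connQuot k C)
    (fun r x m => by
      obtain ⟨a, rfl⟩ := Submodule.Quotient.mk_surjective _ m
      rw [connQuot_apply, connQuot_apply, nablaQuot_mk, nablaQuot_mk, ← Submodule.Quotient.mk_smul]
      exact congrArg _ (Subtype.ext (by simp)))
    (fun x r m => by simp only [connQuot_apply, nablaQuot_smul])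
    (fun x y m => by
      obtain ⟨a, rfl⟩ := Submodule.Quotient.mk_surjective _ m
      simp only [connQuot_apply, nablaQuot_mk]
      -- This is the reason for the quotient: on elements flat to all orders the curvature takes
      -- values of infinite order.
      rw [← Submodule.Quotient.mk_sub, eq_comm, Submodule.Quotient.eq]
      exact curv_mem_ordTop a.2 x y)

theorem flatRep_vec (x : L) (m : C.FlatQuot) :
    (flatRep k C).toEnd (Env.vec k R L x) m = C.nablaQuot x m :=
  LinearMap.congr_fun (Rep.mk'_vec (connQuot k C) _ _ _ x) m

variable (C) in
/-- The augmentation of `FlatQuot`. -/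
def augQuot : C.FlatQuot →ₗ[R] R :=
  Submodule.liftQ _ (C.aug.comp C.flatTop.subtype)
    fun _ ha => (mem_ord_succ.1 (mem_ordTop.1 ha 1)).1

/-- The jet defined by a flat element. -/
theorem exists_jet (a : C.flatTop) : ∃ α : Jet k R L, α 1 = C.aug a ∧
    ∀ x, α (Env.vec k R L x) = C.aug (C.nabla x a) := by
  -- A matrix coefficient of the $U$-module `FlatQuot`: act on the class of `a`, then augment.
  let φ : Env k R L →ₗ[R] R :=
    { toFun := fun D => C.augQuot ((flatRep k C).toEnd D (Submodule.Quotient.mk a))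
      map_add' := fun D E => by rw [map_add, LinearMap.add_apply, map_add]
      map_smul' := fun r D => by
        rw [Env.smul_def, map_mul, Module.End.mul_apply, Rep.toEnd_fn, map_smul,
          RingHom.id_apply] }
  refine ⟨WithConv.toConv φ, ?_, fun x => ?_⟩
  · change C.augQuot ((flatRep k C).toEnd 1 (Submodule.Quotient.mk a)) = _
    rw [map_one]
    rfl
  · change C.augQuot ((flatRep k C).toEnd (Env.vec k R L x) (Submodule.Quotient.mk a)) = _
    rw [flatRep_vec]
    rfl

end FreeConnection

namespace LieAlgebroid

variable {k R L : Type*} [Field k] [CharZero k] [CommRing R] [Algebra k R]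
    [LieRing L] [LieAlgebra k L] [Module R L] [LieRingModule L R] [LieRinehartRing R L]
    [LieRinehartAlgebra k R L]

/-- Every linear form on `L` extends to a jet that vanishes at `1`. -/
theorem exists_jet_vec_eq {ι : Type*} [Fintype ι] {lam : ι → L →ₗ[R] R} {l : ι → L}
    (hl : ∀ x, ∑ i, lam i x • l i = x) (φ : L →ₗ[R] R) :
    ∃ α : Jet k R L, α 1 = 0 ∧ ∀ x, α (Env.vec k R L x) = φ x := by
  -- The denominators of the homotopy are inverted in `k`, hence in `R`; this is where the
  -- construction of jets uses characteristic zero.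
  have hs : ∀ n : ℕ, ∃ s : R, s * (n + 2) = 1 := fun n => by
    refine ⟨algebraMap k R ((n : k) + 2)⁻¹, ?_⟩
    have h : ((n : R) + 2) = algebraMap k R ((n : k) + 2) := by
      rw [map_add, map_natCast, map_ofNat]
    rw [h, ← map_mul, inv_mul_cancel₀ (by exact_mod_cast Nat.succ_ne_zero (n + 1)), map_one]
  obtain ⟨a, ha, ha₀, ha₁⟩ := FreeConnection.exists_flat hl hs (Shuffle.exists_lim hl) φ
  obtain ⟨α, hα, hα'⟩ := FreeConnection.exists_jet (k := k)
    (⟨a, FreeConnection.mem_flatTop.2 ha⟩ : (Shuffle.connection hl).flatTop)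
  exact ⟨α, hα.trans ha₀, fun x => (hα' x).trans (ha₁ x)⟩

end LieAlgebroid

/-! ### Derivations of convolution algebras -/

namespace LieAlgebroid

section EnvInduction

variable {k R L : Type*} [CommRing k] [CommRing R] [Algebra k R] [LieRing L] [LieAlgebra k L]
  [Module R L] [LieRingModule L R]

theorem Env.induction_left {p : Env k R L → Prop} (hone : p 1)
    (hfn : ∀ r D, p D → p (Env.fn k R L r * D)) (hvec : ∀ l D, p D → p (Env.vec k R L l * D))
    (hadd : ∀ D E, p D → p E → p (D + E)) (D : Env k R L) : p D := by
  suffices ∀ D E, p E → p (D * E) by simpa using this D 1 hone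
  intro D
  induction D using Env.induction with
  | hfn r => exact hfn r
  | hvec l => exact hvec l
  | hmul D D' hD hD' => intro E hE; rw [mul_assoc]; exact hD _ (hD' _ hE)
  | hadd D D' hD hD' => intro E hE; rw [add_mul]; exact hadd _ _ (hD _ hE) (hD' _ hE)

theorem Env.induction_right {p : Env k R L → Prop} (hone : p 1)
    (hfn : ∀ r D, p D → p (D * Env.fn k R L r)) (hvec : ∀ l D, p D → p (D * Env.vec k R L l))
    (hadd : ∀ D E, p D → p E → p (D + E)) (D : Env k R L) : p D := by
  suffices ∀ D E, p E → p (E * D) by simpa using this D 1 hone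
  intro D
  induction D using Env.induction with
  | hfn r => exact hfn r
  | hvec l => exact hvec l
  | hmul D D' hD hD' => intro E hE; rw [← mul_assoc]; exact hD' _ (hD _ hE)
  | hadd D D' hD hD' => intro E hE; rw [mul_add]; exact hadd _ _ (hD _ hE) (hD' _ hE)

/-- Right multiplication on `U_R L`. -/
def rightMul (E : Env k R L) : Env k R L →ₗ[R] Env k R L where
  toFun D := D * E
  map_add' D D' := add_mul D D' E
  map_smul' r D := smul_mul_assoc r D E

theorem rightMul_apply (D E : Env k R L) : rightMul E D = D * E := rfl

end EnvInduction

section Conv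

variable {k R L : Type*} [CommRing k] [CommRing R] [Algebra k R] [LieRing L] [LieAlgebra k L]
  [Module R L] [LieRingModule L R] [LieRinehartRing R L] [LieRinehartAlgebra k R L]

/-- Elements of `L` are primitive, and right multiplication commutes with the left action of $U$,
through which the comultiplication was defined. -/
theorem comul_mul_vec (D : Env k R L) (l : L) :
    CoalgebraStruct.comul (R := R) (D * Env.vec k R L l) =
      TensorProduct.map (rightMul (Env.vec k R L l)) LinearMap.id
        (CoalgebraStruct.comul (R := R) D) +
      TensorProduct.map LinearMap.id (rightMul (Env.vec k R L l))
        (CoalgebraStruct.comul (R := R) D) := by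
  have h1 : CoalgebraStruct.comul (R := R) D =
      ((envRep k R L).tensor (envRep k R L)).toEnd D (1 ⊗ₜ 1) := rfl
  have h2 : CoalgebraStruct.comul (R := R) (Env.vec k R L l) =
      Env.vec k R L l ⊗ₜ[R] 1 + 1 ⊗ₜ[R] Env.vec k R L l := envComul_vec k R L l
  have hr : ∀ D m, rightMul (Env.vec k R L l) ((envRep k R L).toEnd D m) =
      (envRep k R L).toEnd D (rightMul (Env.vec k R L l) m) := fun D m => mul_assoc D m _
  rw [comul_mul, h1, h2,
    Rep.map_tensor _ _ (envRep k R L) (envRep k R L) _ _ hr (fun _ _ => rfl),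
    Rep.map_tensor _ _ (envRep k R L) (envRep k R L) _ _ (fun _ _ => rfl) hr, map_add]
  simp [rightMul_apply]

/-- In Sweedler notation, $\sum D_{(1)}(r)D_{(2)}=Dr$. Both sides are $U$-linear in $D$ and agree at
$D=1$. -/
theorem sum_evalAt_smul (D : Env k R L) (r : R) :
    TensorProduct.lid R _ (TensorProduct.map (evalAt k R L r) LinearMap.id
      (CoalgebraStruct.comul (R := R) D)) = D * Env.fn k R L r := by
  have h := envRep_ext (envRep k R L)
    ((TensorProduct.lid R (Env k R L)).toLinearMap ∘ₗ
      TensorProduct.map (evalAt k R L r) LinearMap.id ∘ₗ CoalgebraStruct.comul)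
    (rightMul (Env.fn k R L r)) (fun D E => by
      simp only [LinearMap.comp_apply, comul_mul]
      rw [Rep.map_tensor _ _ (baseRep k R L) (envRep k R L) _ _ (evalAt_mul r) (fun _ _ => rfl)]
      refine Rep.map_of_vec _ _ (TensorProduct.lid R (Env k R L)).toLinearMap (fun l x => ?_) D _
      induction x using TensorProduct.induction_on with
      | zero => simp
      | add x y hx hy => simp only [map_add, hx, hy]
      | tmul m n =>
        simp only [Rep.tensor_vec, map_add, LinearEquiv.coe_coe, TensorProduct.lid_tmul,
          baseRep_vec, Rep.vec_smul])
    (fun D E => mul_assoc D E _) (by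
      simp only [LinearMap.comp_apply, comul_one, TensorProduct.map_tmul, LinearEquiv.coe_coe,
        TensorProduct.lid_tmul, evalAt_one, LinearMap.id_apply, rightMul_apply, one_mul,
        Env.smul_def, mul_one])
  exact LinearMap.congr_fun h D

variable {B : Type*} [CommRing B] [Algebra R B] [Algebra k B] [IsScalarTower k R B]

theorem conv_mul_apply (f g : WithConv (Env k R L →ₗ[R] B)) (D : Env k R L) :
    (f * g) D = LinearMap.mul' R B
      (TensorProduct.map f.ofConv g.ofConv (CoalgebraStruct.comul (R := R) D)) := rfl

theorem conv_mul_one_apply (f g : WithConv (Env k R L →ₗ[R] B)) :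
    (f * g) 1 = f 1 * g 1 := by
  rw [conv_mul_apply, comul_one, TensorProduct.map_tmul, LinearMap.mul'_apply]

variable (k) in
/-- Right multiplication by an element of `L`, as a derivation of a convolution algebra. -/
def rightDer (l : L) : Derivation k (WithConv (Env k R L →ₗ[R] B))
    (WithConv (Env k R L →ₗ[R] B)) :=
  Derivation.mk'
    { toFun := fun f => WithConv.toConv (f.ofConv ∘ₗ rightMul (Env.vec k R L l))
      map_add' := fun _ _ => rfl
      map_smul' := fun _ _ => rfl }
    (fun f g => WithConv.ext (LinearMap.ext fun D => by
      change (f * g) (D * Env.vec k R L l) = (f * _ + g * _ : WithConv (Env k R L →ₗ[R] B)) D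
      rw [conv_mul_apply, comul_mul_vec, map_add, map_add, ← LinearMap.comp_apply (TensorProduct.map _ _),
        ← TensorProduct.map_comp, ← LinearMap.comp_apply (TensorProduct.map _ _) (TensorProduct.map LinearMap.id _),
        ← TensorProduct.map_comp, LinearMap.comp_id, LinearMap.comp_id, mul_comm g, add_comm]
      rfl))

theorem rightDer_apply (l : L) (f : WithConv (Env k R L →ₗ[R] B)) (D : Env k R L) :
    rightDer k l f D = f (D * Env.vec k R L l) := rfl

/-- The derivation of a convolution algebra induced by an `R`-linear derivation of `B`. -/
def postDer (δ : Derivation k B B) (hδ : ∀ (r : R) b, δ (r • b) = r • δ b) :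
    Derivation k (WithConv (Env k R L →ₗ[R] B)) (WithConv (Env k R L →ₗ[R] B)) :=
  Derivation.mk'
    { toFun := fun f => WithConv.toConv
        ({ toFun := δ, map_add' := map_add δ, map_smul' := hδ } ∘ₗ f.ofConv)
      map_add' := fun _ _ => WithConv.ext (LinearMap.ext fun _ => map_add δ _ _)
      map_smul' := fun c _ => WithConv.ext (LinearMap.ext fun _ => δ.map_smul c _) }
    (fun f g => WithConv.ext (LinearMap.ext fun D => by
      change δ ((f * g) D) = (f * _) D + (g * _) D
      rw [mul_comm g, conv_mul_apply, conv_mul_apply, conv_mul_apply]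
      induction CoalgebraStruct.comul (R := R) D using TensorProduct.induction_on with
      | zero => simp
      | add x y hx hy => simp only [map_add, hx, hy]; abel
      | tmul x y =>
        simp only [TensorProduct.map_tmul, LinearMap.mul'_apply, Derivation.leibniz, smul_eq_mul,
          LinearMap.comp_apply, LinearMap.coe_mk, AddHom.coe_mk]
        rw [mul_comm (g.ofConv y)]))

/-- `D ↦ θ (f D) - f (l D)`. -/
def leftDual (l : L) (θ : Derivation k B B) (hθ : ∀ (r : R) b, θ (r • b) = ⁅l, r⁆ • b + r • θ b)
    (f : Env k R L →ₗ[R] B) : Env k R L →ₗ[R] B where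
  toFun D := θ (f D) - f (Env.vec k R L l * D)
  map_add' D E := by
    simp only [map_add, mul_add]
    abel
  map_smul' r D := by
    rw [Env.vec_mul_smul, map_add, f.map_smul, f.map_smul, f.map_smul, hθ, RingHom.id_apply,
      smul_sub]
    abel

theorem leftDual_apply (l : L) (θ : Derivation k B B)
    (hθ : ∀ (r : R) b, θ (r • b) = ⁅l, r⁆ • b + r • θ b) (f : Env k R L →ₗ[R] B)
    (D : Env k R L) : leftDual l θ hθ f D = θ (f D) - f (Env.vec k R L l * D) := rfl

/-- The Leibniz rule for `leftDer`, stated for an arbitrary tensor `z` so that it can be checked on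
pure tensors; the case needed is that of a coproduct. -/
theorem leftDual_tensor (l : L) (θ : Derivation k B B)
    (hθ : ∀ (r : R) b, θ (r • b) = ⁅l, r⁆ • b + r • θ b) (f g : Env k R L →ₗ[R] B)
    (z : Env k R L ⊗[R] Env k R L) :
    θ (LinearMap.mul' R B (TensorProduct.map f g z)) - LinearMap.mul' R B (TensorProduct.map f g
        (((envRep k R L).tensor (envRep k R L)).toEnd (Env.vec k R L l) z)) =
      LinearMap.mul' R B (TensorProduct.map f (leftDual l θ hθ g) z) +
        LinearMap.mul' R B (TensorProduct.map (leftDual l θ hθ f) g z) := by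
  have hl : ∀ D, (envRep k R L).toEnd (Env.vec k R L l) D = Env.vec k R L l * D := fun _ => rfl
  induction z using TensorProduct.induction_on with
  | zero => simp
  | add x y hx hy =>
    simp only [map_add] at hx hy ⊢
    rw [add_sub_add_comm, hx, hy]
    abel
  | tmul x y =>
    simp only [Rep.tensor_vec, map_add, TensorProduct.map_tmul, LinearMap.mul'_apply,
      Derivation.leibniz, smul_eq_mul, leftDual_apply, hl]
    ring

/-- The covariant derivative `(¹∇_l f)(D) = θ (f D) - f (l D)` on a convolution algebra. -/
def leftDer (l : L) (θ : Derivation k B B) (hθ : ∀ (r : R) b, θ (r • b) = ⁅l, r⁆ • b + r • θ b) :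
    Derivation k (WithConv (Env k R L →ₗ[R] B)) (WithConv (Env k R L →ₗ[R] B)) :=
  Derivation.mk'
    { toFun := fun f => WithConv.toConv (leftDual l θ hθ f.ofConv)
      map_add' := fun f g => WithConv.ext (LinearMap.ext fun D => by
        change θ (f D + g D) - (f _ + g _) = (θ (f D) - f _) + (θ (g D) - g _)
        rw [map_add]; abel)
      map_smul' := fun c f => WithConv.ext (LinearMap.ext fun D => by
        change θ (c • f D) - c • f _ = c • (θ (f D) - f _)
        rw [θ.map_smul, smul_sub]) }
    (fun f g => WithConv.ext (LinearMap.ext fun D => by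
      have h := leftDual_tensor l θ hθ f.ofConv g.ofConv (CoalgebraStruct.comul (R := R) D)
      rw [← comul_mul] at h
      rw [smul_eq_mul, smul_eq_mul, mul_comm g]
      exact h))

variable (k L B) in
/-- The function `D ↦ D(r)`, as an element of a convolution algebra. -/
def evalConv (r : R) : WithConv (Env k R L →ₗ[R] B) :=
  WithConv.toConv (Algebra.linearMap R B ∘ₗ evalAt k R L r)

/-- Convolution with the function $D\mapsto D(r)$ is translation by right multiplication by $r$,
since $\sum D_{(1)}(r)D_{(2)}=Dr$. This is why the second unit map encodes the right action of $R$
on $U$. -/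
theorem evalConv_mul_apply (r : R) (f : WithConv (Env k R L →ₗ[R] B)) (D : Env k R L) :
    (evalConv k L B r * f) D = f (D * Env.fn k R L r) := by
  rw [conv_mul_apply, ← sum_evalAt_smul]
  induction CoalgebraStruct.comul (R := R) D using TensorProduct.induction_on with
  | zero => simp
  | add x y hx hy => simp only [map_add, hx, hy]
  | tmul x y =>
    simp only [TensorProduct.map_tmul, LinearMap.mul'_apply, TensorProduct.lid_tmul,
      LinearMap.id_apply, map_smul, evalConv, LinearMap.comp_apply, Algebra.linearMap_apply,
      Algebra.smul_def]

variable (k L B) in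
/-- The constants `b ↦ (D ↦ D(1) b)`. -/
def constConv : B →ₐ[k] WithConv (Env k R L →ₗ[R] B) :=
  AlgHom.ofLinearMap
    { toFun := fun b => WithConv.toConv ((evalAt k R L 1).smulRight b)
      map_add' := fun b b' => WithConv.ext (LinearMap.ext fun D => smul_add _ b b')
      map_smul' := fun c b => WithConv.ext (LinearMap.ext fun D => smul_comm _ c b) }
    (WithConv.ext (LinearMap.ext fun D => (Algebra.algebraMap_eq_smul_one _).symm))
    (fun b b' => WithConv.ext (LinearMap.ext fun D => by
      have h := evalAt_mul_fn (k := k) (L := L) (1 : R) 1 D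
      change evalAt k R L 1 D • (b * b') = LinearMap.mul' R B (TensorProduct.map
        ((evalAt k R L 1).smulRight b) ((evalAt k R L 1).smulRight b')
          (CoalgebraStruct.comul (R := R) D))
      rw [one_mul] at h
      rw [← h]
      induction CoalgebraStruct.comul (R := R) D using TensorProduct.induction_on with
      | zero => simp
      | add x y hx hy => simp only [map_add, add_smul, hx, hy]
      | tmul x y =>
        simp only [TensorProduct.map_tmul, LinearMap.mul'_apply, LinearMap.smulRight_apply,
          smul_mul_smul_comm]))

theorem constConv_mul_apply (b : B) (f : WithConv (Env k R L →ₗ[R] B)) (D : Env k R L) :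
    (constConv k L B b * f : WithConv (Env k R L →ₗ[R] B)) D = b * f D := by
  have h := Coalgebra.rTensor_counit_comul (R := R) D
  have h' := congrArg (fun x => LinearMap.mul' R B
    (TensorProduct.map (LinearMap.toSpanSingleton R B b) f.ofConv x)) h
  simp only [TensorProduct.map_tmul, LinearMap.toSpanSingleton_apply, one_smul,
    LinearMap.mul'_apply] at h'
  rw [conv_mul_apply]
  refine Eq.trans ?_ h'
  clear h h'
  rw [LinearMap.rTensor]
  induction CoalgebraStruct.comul (R := R) D using TensorProduct.induction_on with
  | zero => simp
  | add x y hx hy => simp only [map_add, hx, hy]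
  | tmul x y =>
    simp only [TensorProduct.map_tmul, LinearMap.mul'_apply, LinearMap.toSpanSingleton_apply]
    rfl

end Conv

end LieAlgebroid

/-! ### The antipode of the jet algebra -/

namespace LieAlgebroid

variable {k R L : Type*} [CommRing k] [CommRing R] [Algebra k R] [LieRing L] [LieAlgebra k L]
  [Module R L] [LieRingModule L R] [LieRinehartRing R L] [LieRinehartAlgebra k R L]

variable (k R) in
/-- The derivation `¹∇_l` of the jet algebra. -/
def jetDer₁ (l : L) : Derivation k (Jet k R L) (Jet k R L) :=
  leftDer l (LieRinehartAlgebra.anchor k R L l) fun r s => by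
    rw [smul_eq_mul, LieRinehartAlgebra.anchor_apply, LieRinehartAlgebra.anchor_apply,
      LieRinehartRing.leibniz_mul_right, smul_eq_mul, smul_eq_mul, add_comm]

variable (k R) in
/-- The derivation `²∇_l` of the jet algebra. -/
def jetDer₂ (l : L) : Derivation k (Jet k R L) (Jet k R L) := rightDer k l

theorem jetDer₁_apply (l : L) (α : Jet k R L) (D : Env k R L) :
    jetDer₁ k R l α D = ⁅l, α D⁆ - α (Env.vec k R L l * D) := rfl

theorem jetDer₂_apply (l : L) (α : Jet k R L) (D : Env k R L) :
    jetDer₂ k R l α D = α (D * Env.vec k R L l) := rfl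

theorem apply_vec_mul (l : L) (α : Jet k R L) (D : Env k R L) :
    α (Env.vec k R L l * D) = ⁅l, α D⁆ - jetDer₁ k R l α D := by
  rw [jetDer₁_apply, sub_sub_cancel]

theorem nabla₁_vec (l : L) (α : Jet k R L) :
    (nabla₁ k R L).toEnd (Env.vec k R L l) α = jetDer₁ k R l α :=
  WithConv.ext (LinearMap.ext fun D => nabla₁_vec_apply l α D)

theorem nabla₂_vec (l : L) (α : Jet k R L) :
    nabla₂ k R L (Env.vec k R L l) α = jetDer₂ k R l α := rfl

theorem nabla₂_fn (r : R) (α : Jet k R L) :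
    nabla₂ k R L (Env.fn k R L r) α = unit₂ k R L r * α :=
  WithConv.ext (LinearMap.ext fun D => (evalConv_mul_apply r α D).symm)

theorem jetDer₁_jetDer₂ (l m : L) (α : Jet k R L) :
    jetDer₁ k R l (jetDer₂ k R m α) = jetDer₂ k R m (jetDer₁ k R l α) :=
  WithConv.ext (LinearMap.ext fun D => by
    change ⁅l, α (D * _)⁆ - α (_ * D * _) = ⁅l, α (D * _)⁆ - α (_ * (D * _))
    rw [mul_assoc])

/-- Left and right multiplication in $U$ commute. -/
theorem nabla₁_nabla₂ (D E : Env k R L) (α : Jet k R L) :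
    (nabla₁ k R L).toEnd D (nabla₂ k R L E α) = nabla₂ k R L E ((nabla₁ k R L).toEnd D α) := by
  induction D using Env.induction generalizing α with
  | hfn r => rw [Rep.toEnd_fn, Rep.toEnd_fn]; rfl
  | hvec l =>
    rw [nabla₁_vec, nabla₁_vec]
    refine WithConv.ext (LinearMap.ext fun D => ?_)
    change ⁅l, α (D * _)⁆ - α (_ * D * _) = ⁅l, α (D * _)⁆ - α (_ * (D * _))
    rw [mul_assoc]
  | hmul D D' hD hD' => simp only [map_mul, Module.End.mul_apply, hD, hD']
  | hadd D D' hD hD' => simp only [map_add, LinearMap.add_apply, hD, hD']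

theorem jetDer₁_unit₁ (l : L) (r : R) : jetDer₁ k R l (unit₁ k R L r) = unit₁ k R L ⁅l, r⁆ :=
  WithConv.ext (LinearMap.ext fun D => by
    change ⁅l, r * evalAt k R L 1 D⁆ - r * evalAt k R L 1 (Env.vec k R L l * D) =
      ⁅l, r⁆ * evalAt k R L 1 D
    rw [evalAt_mul, baseRep_vec, LieRinehartRing.leibniz_mul_right, smul_eq_mul]
    ring)

theorem jetDer₁_unit₂ (l : L) (r : R) : jetDer₁ k R l (unit₂ k R L r) = 0 :=
  WithConv.ext (LinearMap.ext fun D => by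
    change ⁅l, evalAt k R L r D⁆ - evalAt k R L r (Env.vec k R L l * D) = 0
    rw [evalAt_mul, baseRep_vec, sub_self])

theorem jetDer₂_unit₂ (l : L) (r : R) : jetDer₂ k R l (unit₂ k R L r) = unit₂ k R L ⁅l, r⁆ :=
  WithConv.ext (LinearMap.ext fun D => by
    change (baseRep k R L).toEnd (D * Env.vec k R L l) r = (baseRep k R L).toEnd D ⁅l, r⁆
    rw [map_mul, Module.End.mul_apply, baseRep_vec])

theorem jetDer₂_unit₁ (l : L) (r : R) : jetDer₂ k R l (unit₁ k R L r) = 0 :=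
  WithConv.ext (LinearMap.ext fun D => by
    change r * (baseRep k R L).toEnd (D * Env.vec k R L l) 1 = 0
    rw [map_mul, Module.End.mul_apply, baseRep_vec, lie_one_eq, map_zero, mul_zero])

theorem jetDer₂_smul (l : L) (r : R) (α : Jet k R L) :
    jetDer₂ k R l (r • α) = r • jetDer₂ k R l α := rfl

theorem smul_eq_unit₁_mul (r : R) (α : Jet k R L) : r • α = unit₁ k R L r * α :=
  Algebra.smul_def r α

theorem jetDer₁_smul (l : L) (r : R) (α : Jet k R L) :
    jetDer₁ k R l (r • α) = ⁅l, r⁆ • α + r • jetDer₁ k R l α := by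
  rw [smul_eq_unit₁_mul, Derivation.leibniz, jetDer₁_unit₁, smul_eq_unit₁_mul, smul_eq_unit₁_mul,
    smul_eq_mul, smul_eq_mul]
  ring

theorem jetDer₂_smul_vec (l : L) (r : R) (α : Jet k R L) :
    jetDer₂ k R (r • l) α = unit₂ k R L r * jetDer₂ k R l α := by
  rw [← nabla₂_vec, map_smul, Env.smul_def, map_mul, Module.End.mul_apply, nabla₂_fn, nabla₂_vec]

theorem jetDer₂_lie (l m : L) (α : Jet k R L) : jetDer₂ k R ⁅l, m⁆ α =
    jetDer₂ k R l (jetDer₂ k R m α) - jetDer₂ k R m (jetDer₂ k R l α) := by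
  rw [← nabla₂_vec, Env.vec_lie, map_sub, map_mul, map_mul]
  rfl

theorem jetDer₂_add_vec (l m : L) (α : Jet k R L) :
    jetDer₂ k R (l + m) α = jetDer₂ k R l α + jetDer₂ k R m α := by
  rw [← nabla₂_vec, map_add, map_add]
  rfl

theorem jetCounit_unit₁ (r : R) : jetCounit k R L (unit₁ k R L r) = r :=
  (congrArg (r * ·) (evalAt_one 1)).trans (mul_one r)

theorem jetCounit_unit₂ (r : R) : jetCounit k R L (unit₂ k R L r) = r :=
  evalAt_one r

/-- Maps to the jet algebra are determined by their counits, if their images under `¹∇` are. -/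
theorem eq_of_jetDer₁ {X : Type*} (δ : L → X → X) {f g : X → Jet k R L}
    (hf : ∀ l x, jetDer₁ k R l (f x) = f (δ l x)) (hg : ∀ l x, jetDer₁ k R l (g x) = g (δ l x))
    (h : ∀ x, jetCounit k R L (f x) = jetCounit k R L (g x)) (x : X) : f x = g x := by
  suffices ∀ (D : Env k R L) x, f x D = g x D from
    WithConv.ext (LinearMap.ext fun D => this D x)
  intro D
  induction D using Env.induction_left with
  | hone => exact h
  | hfn r D hD => intro x; rw [← Env.smul_def, map_smul, map_smul, hD]
  | hvec l D hD => intro x; rw [apply_vec_mul, apply_vec_mul, hf, hg, hD, hD]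
  | hadd D E hD hE => intro x; rw [map_add, map_add, hD, hE]

/-! #### Construction of the antipode -/

variable (k R L) in
/-- The `k`-linear maps `J_R L → R` that are linear for the second `R`-module structure. -/
def rightDual : Submodule R (Jet k R L →ₗ[k] R) where
  carrier := {σ | ∀ r α, σ (unit₂ k R L r * α) = r * σ α}
  add_mem' := fun {σ τ} hσ hτ r α => by
    rw [LinearMap.add_apply, LinearMap.add_apply, hσ, hτ, mul_add]
  zero_mem' := fun r α => by simp
  smul_mem' := fun c σ hσ r α => by
    rw [LinearMap.smul_apply, LinearMap.smul_apply, hσ, smul_eq_mul, smul_eq_mul, mul_left_comm]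

/-- The action `(l σ)(α) = l(σ(α)) - σ(²∇_l α)`. -/
def rightDualAct (l : L) (σ : rightDual k R L) : rightDual k R L :=
  ⟨(LieModule.toEnd k L R l : Module.End k R) ∘ₗ σ.1 - σ.1 ∘ₗ (jetDer₂ k R l : _ →ₗ[k] _),
    fun r α => by
      change ⁅l, σ.1 (unit₂ k R L r * α)⁆ - σ.1 (jetDer₂ k R l (unit₂ k R L r * α)) =
        r * (⁅l, σ.1 α⁆ - σ.1 (jetDer₂ k R l α))
      rw [σ.2, Derivation.leibniz, jetDer₂_unit₂, smul_eq_mul, smul_eq_mul, map_add, σ.2,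
        mul_comm α, σ.2, LieRinehartRing.leibniz_mul_right, smul_eq_mul]
      ring⟩

theorem rightDual_ext {σ τ : rightDual k R L} (h : ∀ α, σ.1 α = τ.1 α) : σ = τ :=
  Subtype.ext (LinearMap.ext h)

/-- `rightDualAct` as a `k`-linear endomorphism. -/
def rightDualEnd (l : L) : Module.End k (rightDual k R L) where
  toFun := rightDualAct l
  map_add' σ τ := rightDual_ext fun α => by
    change ⁅l, σ.1 α + τ.1 α⁆ - (σ.1 (jetDer₂ k R l α) + τ.1 (jetDer₂ k R l α)) =
      (⁅l, σ.1 α⁆ - σ.1 (jetDer₂ k R l α)) + (⁅l, τ.1 α⁆ - τ.1 (jetDer₂ k R l α))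
    rw [lie_add]; abel
  map_smul' c σ := rightDual_ext fun α => by
    change ⁅l, c • σ.1 α⁆ - c • σ.1 (jetDer₂ k R l α) = c • (⁅l, σ.1 α⁆ - σ.1 (jetDer₂ k R l α))
    rw [smul_sub]
    exact congrArg (· - c • σ.1 (jetDer₂ k R l α))
      ((LieModule.toEnd k L R l).map_smul c (σ.1 α))

variable (k R) in
/-- `rightDualAct` as an additive map to endomorphisms. -/
def rightDualConn : L →+ Module.End k (rightDual k R L) where
  toFun := rightDualEnd
  map_zero' := LinearMap.ext fun σ => rightDual_ext fun α => by
    change ⁅(0 : L), σ.1 α⁆ - σ.1 (jetDer₂ k R 0 α) = 0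
    rw [zero_lie, ← nabla₂_vec, map_zero, map_zero, LinearMap.zero_apply, map_zero, sub_zero]
  map_add' := (fun l m => LinearMap.ext fun σ => rightDual_ext fun α => by
      change ⁅l + m, σ.1 α⁆ - σ.1 (jetDer₂ k R (l + m) α) =
        (⁅l, σ.1 α⁆ - σ.1 (jetDer₂ k R l α)) + (⁅m, σ.1 α⁆ - σ.1 (jetDer₂ k R m α))
      rw [add_lie, jetDer₂_add_vec, map_add]
      abel)

variable (k R L) in
/-- The action of `U_R L` on `rightDual`. -/
def rightDualRep : Rep k R L (rightDual k R L) :=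
  Rep.mk' (rightDualConn k R)
    (fun r l σ => rightDual_ext fun α => by
      change ⁅r • l, σ.1 α⁆ - σ.1 (jetDer₂ k R (r • l) α) =
        r * (⁅l, σ.1 α⁆ - σ.1 (jetDer₂ k R l α))
      rw [LieRinehartRing.lie_smul_eq_mul, jetDer₂_smul_vec, σ.2, mul_sub])
    (fun l r σ => rightDual_ext fun α => by
      change ⁅l, r * σ.1 α⁆ - r * σ.1 (jetDer₂ k R l α) =
        ⁅l, r⁆ * σ.1 α + r * (⁅l, σ.1 α⁆ - σ.1 (jetDer₂ k R l α))
      rw [LieRinehartRing.leibniz_mul_right, smul_eq_mul]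
      ring)
    (fun l m σ => rightDual_ext fun α => by
      change ⁅⁅l, m⁆, σ.1 α⁆ - σ.1 (jetDer₂ k R ⁅l, m⁆ α) =
        (⁅l, ⁅m, σ.1 α⁆ - σ.1 (jetDer₂ k R m α)⁆ - (⁅m, σ.1 (jetDer₂ k R l α)⁆ -
          σ.1 (jetDer₂ k R m (jetDer₂ k R l α)))) -
        (⁅m, ⁅l, σ.1 α⁆ - σ.1 (jetDer₂ k R l α)⁆ - (⁅l, σ.1 (jetDer₂ k R m α)⁆ -
          σ.1 (jetDer₂ k R l (jetDer₂ k R m α))))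
      rw [jetDer₂_lie, map_sub, lie_sub, lie_sub, leibniz_lie l m (σ.1 α)]
      abel)

theorem rightDualRep_vec (l : L) :
    (rightDualRep k R L).toEnd (Env.vec k R L l) = rightDualConn k R l := by
  rw [rightDualRep, Rep.mk'_vec]

variable (k R L) in
/-- The counit, as an element of `rightDual`. -/
def counitDual : rightDual k R L :=
  ⟨(jetCounit k R L).toLinearMap, fun r α => by
    change jetCounit k R L (unit₂ k R L r * α) = r * jetCounit k R L α
    rw [map_mul, jetCounit_unit₂]⟩

variable (k R L) in
/-- The antipode as a `k`-linear map. -/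
def antipodeₗ : Jet k R L →ₗ[k] Jet k R L where
  toFun α := WithConv.toConv
    { toFun := fun D => ((rightDualRep k R L).toEnd D (counitDual k R L)).1 α
      map_add' := fun D E => by rw [map_add]; rfl
      map_smul' := fun r D => by
        rw [Env.smul_def, map_mul, Module.End.mul_apply, Rep.toEnd_fn]; rfl }
  map_add' α β := WithConv.ext (LinearMap.ext fun D =>
    map_add ((rightDualRep k R L).toEnd D (counitDual k R L)).1 α β)
  map_smul' c α := WithConv.ext (LinearMap.ext fun D =>
    map_smul ((rightDualRep k R L).toEnd D (counitDual k R L)).1 c α)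

theorem antipodeₗ_apply (α : Jet k R L) (D : Env k R L) :
    antipodeₗ k R L α D = ((rightDualRep k R L).toEnd D (counitDual k R L)).1 α := rfl

theorem jetCounit_antipodeₗ (α : Jet k R L) :
    jetCounit k R L (antipodeₗ k R L α) = jetCounit k R L α := by
  rw [jetCounit_apply, antipodeₗ_apply, map_one]
  rfl

theorem antipodeₗ_vec_mul (l : L) (α : Jet k R L) (D : Env k R L) :
    antipodeₗ k R L α (Env.vec k R L l * D) =
      ⁅l, antipodeₗ k R L α D⁆ - antipodeₗ k R L (jetDer₂ k R l α) D := by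
  have h : (rightDualRep k R L).toEnd (Env.vec k R L l * D) (counitDual k R L) =
      rightDualConn k R l ((rightDualRep k R L).toEnd D (counitDual k R L)) := by
    rw [map_mul, Module.End.mul_apply, rightDualRep_vec]
  exact congrArg (fun τ : rightDual k R L => τ.1 α) h

theorem jetDer₁_antipodeₗ (l : L) (α : Jet k R L) :
    jetDer₁ k R l (antipodeₗ k R L α) = antipodeₗ k R L (jetDer₂ k R l α) := by
  refine WithConv.ext (LinearMap.ext fun D => ?_)
  rw [jetDer₁_apply, antipodeₗ_vec_mul, sub_sub_cancel]

/-- Induction on $D$ from the left: since $S$ carries ${}^2\nabla_l$ to ${}^1\nabla_l$ and both are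
derivations, the identity at $lD$ follows from identities at $D$ for other pairs of jets. -/
theorem antipodeₗ_mul (α β : Jet k R L) :
    antipodeₗ k R L (α * β) = antipodeₗ k R L α * antipodeₗ k R L β := by
  suffices ∀ (D : Env k R L) α β,
      antipodeₗ k R L (α * β) D = (antipodeₗ k R L α * antipodeₗ k R L β) D from
    WithConv.ext (LinearMap.ext fun D => this D α β)
  intro D
  induction D using Env.induction_left with
  | hone =>
    intro α β
    change jetCounit k R L (antipodeₗ k R L (α * β)) =
      jetCounit k R L (antipodeₗ k R L α * antipodeₗ k R L β)
    rw [map_mul (jetCounit k R L), jetCounit_antipodeₗ, jetCounit_antipodeₗ, jetCounit_antipodeₗ,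
      map_mul (jetCounit k R L)]
  | hfn r D hD => intro α β; rw [← Env.smul_def, map_smul, map_smul, hD]
  | hvec l D hD =>
    intro α β
    rw [apply_vec_mul, apply_vec_mul, hD, jetDer₁_antipodeₗ, Derivation.leibniz,
      Derivation.leibniz, jetDer₁_antipodeₗ, jetDer₁_antipodeₗ, map_add]
    change _ - (antipodeₗ k R L (α * jetDer₂ k R l β) D + antipodeₗ k R L (β * jetDer₂ k R l α) D) =
      _ - ((antipodeₗ k R L α * antipodeₗ k R L (jetDer₂ k R l β)) D +
        (antipodeₗ k R L β * antipodeₗ k R L (jetDer₂ k R l α)) D)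
    rw [hD, hD]
  | hadd D E hD hE => intro α β; rw [map_add, map_add, hD, hE]

theorem antipodeₗ_unit₂ (r : R) : antipodeₗ k R L (unit₂ k R L r) = unit₁ k R L r :=
  eq_of_jetDer₁ (fun l r => ⁅l, r⁆) (f := fun r => antipodeₗ k R L (unit₂ k R L r))
    (fun l r => by rw [jetDer₁_antipodeₗ, jetDer₂_unit₂]) (fun l r => jetDer₁_unit₁ l r)
    (fun r => by rw [jetCounit_antipodeₗ, jetCounit_unit₁, jetCounit_unit₂]) r

/-- Both sides turn ${}^2\nabla_m$ into ${}^1\nabla_m$, so it suffices to compare counits. There the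
claim reduces to $\epsilon({}^1\nabla_l\beta)+\epsilon({}^2\nabla_l\beta)=l(\epsilon(\beta))$. -/
theorem jetDer₂_antipodeₗ (l : L) (α : Jet k R L) :
    jetDer₂ k R l (antipodeₗ k R L α) = antipodeₗ k R L (jetDer₁ k R l α) := by
  refine eq_of_jetDer₁ (fun m α => jetDer₂ k R m α)
    (f := fun α => jetDer₂ k R l (antipodeₗ k R L α))
    (g := fun α => antipodeₗ k R L (jetDer₁ k R l α))
    (fun m α => by rw [jetDer₁_jetDer₂, jetDer₁_antipodeₗ])
    (fun m α => by rw [jetDer₁_antipodeₗ, jetDer₁_jetDer₂]) (fun α => ?_) α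
  have h₂ : ∀ β : Jet k R L, jetCounit k R L (jetDer₂ k R l β) = β (Env.vec k R L l) := fun β => by
    rw [jetCounit_apply, jetDer₂_apply, one_mul]
  have h₁ : ∀ β : Jet k R L, jetCounit k R L (jetDer₁ k R l β) =
      ⁅l, jetCounit k R L β⁆ - β (Env.vec k R L l) := fun β => by
    rw [jetCounit_apply, jetDer₁_apply, mul_one, jetCounit_apply]
  have h₃ : antipodeₗ k R L α (Env.vec k R L l) =
      ⁅l, jetCounit k R L α⁆ - α (Env.vec k R L l) := by
    have := h₁ (antipodeₗ k R L α)
    rw [jetDer₁_antipodeₗ, jetCounit_antipodeₗ, jetCounit_antipodeₗ, h₂, eq_sub_iff_add_eq'] at this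
    rw [← this, add_sub_cancel_right]
  rw [h₂, jetCounit_antipodeₗ, h₁, h₃]

/-- $S^2$ commutes with ${}^1\nabla$ and preserves the counit, as does the identity. -/
theorem antipodeₗ_antipodeₗ (α : Jet k R L) : antipodeₗ k R L (antipodeₗ k R L α) = α :=
  eq_of_jetDer₁ (fun l α => jetDer₁ k R l α)
    (f := fun α => antipodeₗ k R L (antipodeₗ k R L α)) (g := fun α => α)
    (fun l α => by rw [jetDer₁_antipodeₗ, jetDer₂_antipodeₗ]) (fun l α => rfl)
    (fun α => by rw [jetCounit_antipodeₗ, jetCounit_antipodeₗ]) α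

variable (k R L) in
/-- The antipode of the jet algebra. -/
def antipode : Jet k R L ≃ₐ[k] Jet k R L :=
  AlgEquiv.ofLinearEquiv
    (LinearEquiv.ofInvolutive (antipodeₗ k R L) antipodeₗ_antipodeₗ)
    (by
      change antipodeₗ k R L 1 = 1
      rw [← map_one (unit₂ k R L), antipodeₗ_unit₂, map_one, map_one])
    antipodeₗ_mul

theorem antipode_antipode (α : Jet k R L) : antipode k R L (antipode k R L α) = α :=
  antipodeₗ_antipodeₗ α

theorem jetCounit_antipode (α : Jet k R L) :
    jetCounit k R L (antipode k R L α) = jetCounit k R L α := jetCounit_antipodeₗ α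

theorem antipode_unit₂ (r : R) : antipode k R L (unit₂ k R L r) = unit₁ k R L r :=
  antipodeₗ_unit₂ r

theorem antipode_unit₁ (r : R) : antipode k R L (unit₁ k R L r) = unit₂ k R L r := by
  rw [← antipode_unit₂, antipode_antipode]

theorem jetDer₁_antipode (l : L) (α : Jet k R L) :
    jetDer₁ k R l (antipode k R L α) = antipode k R L (jetDer₂ k R l α) := jetDer₁_antipodeₗ l α

theorem jetDer₂_antipode (l : L) (α : Jet k R L) :
    jetDer₂ k R l (antipode k R L α) = antipode k R L (jetDer₁ k R l α) := jetDer₂_antipodeₗ l α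

theorem nabla₁_antipode (D : Env k R L) (α : Jet k R L) :
    (nabla₁ k R L).toEnd D (antipode k R L α) = antipode k R L (nabla₂ k R L D α) := by
  induction D using Env.induction generalizing α with
  | hfn r => rw [Rep.toEnd_fn, nabla₂_fn, map_mul, antipode_unit₂, smul_eq_unit₁_mul]
  | hvec l => rw [nabla₁_vec, jetDer₁_antipode]; rfl
  | hmul D D' hD hD' => simp only [map_mul, Module.End.mul_apply, hD, hD']
  | hadd D D' hD hD' => simp only [map_add, LinearMap.add_apply, hD, hD']

theorem pair₁_antipode (D : Env k R L) (α : Jet k R L) :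
    pair₁ D (antipode k R L α) = pair₂ D α := by
  change jetCounit k R L ((nabla₁ k R L).toEnd D (antipode k R L α)) =
    jetCounit k R L (nabla₂ k R L D α)
  rw [nabla₁_antipode, jetCounit_antipode]

theorem pair₁_eq (D : Env k R L) (α : Jet k R L) : pair₁ D α = antipode k R L α D := by
  rw [← antipode_antipode α, pair₁_antipode, pair₂_apply, antipode_antipode]

/-- Since $\langle\beta,D\rangle_1=(S\beta)(D)$ and $\langle\alpha,D\rangle_2=\alpha(D)$, the
condition says $S\beta=\alpha$; now apply the involution $S$. -/
theorem pair₁_eq_pair₂_iff (α β : Jet k R L) :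
    (∀ D : Env k R L, pair₁ D β = pair₂ D α) ↔ β = antipode k R L α := by
  refine ⟨fun h => ?_, fun h D => by rw [h, pair₁_antipode]⟩
  rw [← antipode_antipode β]
  refine congrArg _ (WithConv.ext (LinearMap.ext fun D => ?_))
  exact (pair₁_eq D β).symm.trans ((h D).trans (pair₂_apply D α))

end LieAlgebroid

/-! ### The adic topology of the jet algebra -/

namespace LieAlgebroid

section Filtration

variable {k R L : Type*} [CommRing k] [CommRing R] [Algebra k R] [LieRing L] [LieAlgebra k L]
  [Module R L] [LieRingModule L R] [LieRinehartRing R L] [LieRinehartAlgebra k R L]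
  {B : Type*} [CommRing B] [Algebra k B] [Algebra R B] [IsScalarTower k R B]
  {ι : Type*} [Fintype ι] {lam : ι → L →ₗ[R] R} {e : ι → L}

/-- Since $D\cdot(rl)=(Dr)l$, coefficients in $R$ of elements of $L$ become convolution factors
$D\mapsto D(r)$. -/
theorem rightDer_eq_sum (he : ∀ x, ∑ i, lam i x • e i = x) (x : L)
    (f : WithConv (Env k R L →ₗ[R] B)) :
    rightDer k x f = ∑ i, evalConv k L B (lam i x) * rightDer k (e i) f := by
  refine WithConv.ext (LinearMap.ext fun D => ?_)
  have h : (∑ i, evalConv k L B (lam i x) * rightDer k (e i) f).ofConv D =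
      ∑ i, (evalConv k L B (lam i x) * rightDer k (e i) f).ofConv D := by
    rw [WithConv.ofConv_sum, LinearMap.sum_apply]
  rw [h]
  conv_lhs => rw [← he x, rightDer_apply, map_sum, Finset.mul_sum, map_sum]
  refine Finset.sum_congr rfl fun i _ => ?_
  rw [evalConv_mul_apply, rightDer_apply, map_smul, Env.smul_def, mul_assoc]

theorem rightDer_lie (x y : L) (f : WithConv (Env k R L →ₗ[R] B)) :
    rightDer k ⁅x, y⁆ f = rightDer k x (rightDer k y f) - rightDer k y (rightDer k x f) :=
  WithConv.ext (LinearMap.ext fun D => by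
    change f (D * Env.vec k R L ⁅x, y⁆) = f (D * Env.vec k R L x * Env.vec k R L y) -
      f (D * Env.vec k R L y * Env.vec k R L x)
    rw [Env.vec_lie, mul_sub, map_sub, mul_assoc, mul_assoc])

theorem evalConv_one_apply (r : R) : evalConv k L B r 1 = algebraMap R B r :=
  congrArg (algebraMap R B) (evalAt_one r)

/-- Right translation of an element of a convolution algebra. -/
def rightTranslate (E : Env k R L) (f : WithConv (Env k R L →ₗ[R] B)) :
    WithConv (Env k R L →ₗ[R] B) :=
  WithConv.toConv (f.ofConv ∘ₗ rightMul E)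

theorem rightTranslate_apply (E : Env k R L) (f : WithConv (Env k R L →ₗ[R] B)) (D : Env k R L) :
    rightTranslate E f D = f (D * E) := rfl

theorem rightTranslate_mul (D E : Env k R L) (f : WithConv (Env k R L →ₗ[R] B)) :
    rightTranslate (D * E) f = rightTranslate D (rightTranslate E f) :=
  WithConv.ext (LinearMap.ext fun D' => by
    rw [rightTranslate_apply, rightTranslate_apply, rightTranslate_apply, mul_assoc])

theorem rightTranslate_add (D E : Env k R L) (f : WithConv (Env k R L →ₗ[R] B)) :
    rightTranslate (D + E) f = rightTranslate D f + rightTranslate E f :=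
  WithConv.ext (LinearMap.ext fun D' => by
    change f (D' * (D + E)) = f (D' * D) + f (D' * E)
    rw [mul_add, map_add])

theorem rightTranslate_fn (r : R) (f : WithConv (Env k R L →ₗ[R] B)) :
    rightTranslate (Env.fn k R L r) f = evalConv k L B r * f :=
  WithConv.ext (LinearMap.ext fun D => (evalConv_mul_apply r f D).symm)

/-- Right translations are continuous for the filtration by the order. -/
theorem exists_rightTranslate_mem {κ : Type*}
    {δ : κ → Derivation k (WithConv (Env k R L →ₗ[R] B)) (WithConv (Env k R L →ₗ[R] B))}
    {K : Ideal (WithConv (Env k R L →ₗ[R] B))} (he : ∀ x, ∑ i, lam i x • e i = x) (j : ι → κ)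
    (hj : ∀ i f, δ (j i) f = rightDer k (e i) f) (E : Env k R L) :
    ∃ p, ∀ n f, f ∈ ordIdeal δ K (n + p) → rightTranslate E f ∈ ordIdeal δ K n := by
  induction E using Env.induction with
  | hfn r =>
    refine ⟨0, fun n f hf => ?_⟩
    rw [rightTranslate_fn]
    exact Ideal.mul_mem_left _ _ hf
  | hvec x =>
    refine ⟨1, fun n f hf => ?_⟩
    have : rightTranslate (Env.vec k R L x) f = rightDer k x f := rfl
    rw [this, rightDer_eq_sum he]
    refine sum_mem fun i _ => Ideal.mul_mem_left _ _ ?_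
    rw [← hj]
    exact (mem_ordIdeal_succ.1 hf).2 (j i)
  | hmul D E hD hE =>
    obtain ⟨p, hp⟩ := hD
    obtain ⟨q, hq⟩ := hE
    refine ⟨p + q, fun n f hf => ?_⟩
    rw [rightTranslate_mul]
    exact hp n _ (hq (n + p) f (by rwa [add_assoc]))
  | hadd D E hD hE =>
    obtain ⟨p, hp⟩ := hD
    obtain ⟨q, hq⟩ := hE
    refine ⟨p + q, fun n f hf => ?_⟩
    rw [rightTranslate_add]
    exact add_mem (hp n f (ordIdeal_antitone (by omega) hf))
      (hq n f (ordIdeal_antitone (by omega) hf))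

end Filtration

/-! ### Coordinates on jets and the filtration by order -/

section JetFrame

variable {k R L : Type*} [CommRing k] [CommRing R] [Algebra k R]
  [LieRing L] [LieAlgebra k L] [Module R L] [LieRingModule L R] [LieRinehartRing R L]
  [LieRinehartAlgebra k R L] {ι : Type*} [Fintype ι]

variable (k) in
/-- A finite dual basis of `L`, together with jets extending its linear forms. -/
structure JetCoords (lam : ι → L →ₗ[R] R) (e : ι → L) (t : ι → Jet k R L) : Prop where
  sum_smul : ∀ x, ∑ i, lam i x • e i = x
  coord_one : ∀ i, t i 1 = 0
  coord_vec : ∀ i x, t i (Env.vec k R L x) = lam i x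

variable {lam : ι → L →ₗ[R] R} {e : ι → L} {t : ι → Jet k R L}

theorem JetCoords.coord_mem (h : JetCoords k lam e t) (i : ι) :
    t i ∈ RingHom.ker (jetCounit k R L) := h.coord_one i

/-- To first order ${}^2\nabla_{e_i}t_j$ is $\lambda_j(e_i)$, in general only an idempotent matrix.
`IsFrame` asks only that these entries also express each derivation through the others, which
follows from $\sum\lambda_j(e_i)e_j=e_i$. -/
theorem JetCoords.isFrame (h : JetCoords k lam e t) :
    IsFrame (fun i => jetDer₂ k R (e i)) (RingHom.ker (jetCounit k R L)) t where
  coord_mem := h.coord_mem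
  der i := by
    refine ⟨fun j => unit₂ k R L (lam j (e i)), fun j => ?_, fun a => ?_⟩
    · rw [RingHom.mem_ker, map_sub, jetCounit_unit₂, jetCounit_apply, jetDer₂_apply, one_mul,
        h.coord_vec, sub_self]
    · exact rightDer_eq_sum h.sum_smul (e i) a
  bracket i j :=
    ⟨fun m => unit₂ k R L (lam m ⁅e i, e j⁆), fun a => by
      rw [← jetDer₂_lie]
      exact rightDer_eq_sum h.sum_smul _ a⟩

/-- Jets of high order vanish on any given differential operator. -/
theorem JetCoords.exists_apply_eq_zero (h : JetCoords k lam e t) (D : Env k R L) :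
    ∃ N, ∀ α ∈ ordIdeal (fun i => jetDer₂ k R (e i)) (RingHom.ker (jetCounit k R L)) N,
      α D = 0 := by
  obtain ⟨p, hp⟩ := exists_rightTranslate_mem (K := RingHom.ker (jetCounit k R L))
    (δ := fun i => jetDer₂ k R (e i)) h.sum_smul id (fun i f => rfl) D
  -- Evaluation at `D` is right translation by `D` followed by evaluation at `1`. Translation loses
  -- at most `p` orders, and one order is enough to vanish at `1`.
  refine ⟨1 + p, fun α hα => ?_⟩
  have : α (1 * D) = 0 := mem_ordIdeal_one.1 (hp 1 α hα)
  rwa [one_mul] at this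

/-- The filtration by the order is closed. -/
theorem mem_ordIdeal_of_apply {n : ℕ} {α : Jet k R L}
    (hα : ∀ D, ∃ β ∈ ordIdeal (fun i => jetDer₂ k R (e i)) (RingHom.ker (jetCounit k R L)) n,
      α D = β D) :
    α ∈ ordIdeal (fun i => jetDer₂ k R (e i)) (RingHom.ker (jetCounit k R L)) n := by
  induction n generalizing α with
  | zero => exact mem_ordIdeal_zero _
  | succ n ih =>
    refine mem_ordIdeal_succ.2 ⟨?_, fun i => ih fun D => ?_⟩
    · obtain ⟨β, hβ, h⟩ := hα 1
      exact h.trans (mem_ordIdeal_succ.1 hβ).1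
    · obtain ⟨β, hβ, h⟩ := hα (D * Env.vec k R L (e i))
      exact ⟨_, (mem_ordIdeal_succ.1 hβ).2 i, h⟩

theorem JetCoords.eq_zero (h : JetCoords k lam e t) (α : Jet k R L)
    (hα : ∀ n, α ∈ ordIdeal (fun i => jetDer₂ k R (e i)) (RingHom.ker (jetCounit k R L)) n) :
    α = 0 :=
  WithConv.ext (LinearMap.ext fun D => by
    obtain ⟨N, hN⟩ := h.exists_apply_eq_zero D
    exact hN α (hα N))

theorem sub_mem_ordIdeal {A κ : Type*} [CommRing A] [Algebra k A] {δ : κ → Derivation k A A}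
    {K : Ideal A} {f : ℕ → A} (hf : ∀ n, f (n + 1) - f n ∈ ordIdeal δ K n) {m n : ℕ}
    (h : n ≤ m) : f m - f n ∈ ordIdeal δ K n := by
  induction m, h using Nat.le_induction with
  | base => rw [sub_self]; exact zero_mem _
  | succ m h ih =>
    rw [← sub_add_sub_cancel _ (f m)]
    exact add_mem (ordIdeal_antitone h (hf m)) ih

/-- The values at each `D` are eventually constant, because jets of high order vanish at `D`. The
pointwise limit has the right order since the filtration is closed under pointwise approximation. -/
theorem JetCoords.exists_lim (h : JetCoords k lam e t) (f : ℕ → Jet k R L)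
    (hf : ∀ n, f (n + 1) - f n ∈
      ordIdeal (fun i => jetDer₂ k R (e i)) (RingHom.ker (jetCounit k R L)) n) :
    ∃ α, ∀ n, α - f n ∈
      ordIdeal (fun i => jetDer₂ k R (e i)) (RingHom.ker (jetCounit k R L)) n := by
  choose N hN using h.exists_apply_eq_zero
  have hN' : ∀ D m, N D ≤ m → f (N D) D = f m D := fun D m hm => by
    have := hN D _ (sub_mem_ordIdeal hf hm)
    exact (sub_eq_zero.1 this).symm
  let α : Env k R L →ₗ[R] R :=
    { toFun := fun D => f (N D) D
      map_add' := fun D E => by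
        rw [hN' D (N D + N E + N (D + E)) (by omega), hN' E (N D + N E + N (D + E)) (by omega),
          hN' (D + E) (N D + N E + N (D + E)) (by omega), map_add]
      map_smul' := fun r D => by
        rw [hN' D (N D + N (r • D)) (by omega), hN' (r • D) (N D + N (r • D)) (by omega),
          map_smul, RingHom.id_apply] }
  refine ⟨WithConv.toConv α, fun n => mem_ordIdeal_of_apply fun D =>
    ⟨f (N D + n) - f n, sub_mem_ordIdeal hf (by omega), ?_⟩⟩
  change f (N D) D - f n D = f (N D + n) D - f n D
  rw [hN' D (N D + n) (by omega)]

end JetFrame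

/-! ### Existence of coordinates and adic completeness of the jet algebra -/

section JetComplete

variable {k R L : Type*} [Field k] [CharZero k] [CommRing R] [Algebra k R]
  [LieRing L] [LieAlgebra k L] [Module R L] [LieRingModule L R] [LieRinehartRing R L]
  [LieRinehartAlgebra k R L]

/-- A finite projective module is a direct summand of some $R^n$; the projection and inclusion give
a finite dual basis, and its linear forms extend to jets. -/
theorem exists_jetCoords [Module.Finite R L] [Module.Projective R L] :
    ∃ (n : ℕ) (lam : Fin n → L →ₗ[R] R) (e : Fin n → L) (t : Fin n → Jet k R L),
      JetCoords k lam e t := by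
  obtain ⟨n, f, g, -, -, hfg⟩ := Module.Finite.exists_comp_eq_id_of_projective R L
  have h : ∀ x, ∑ i, (LinearMap.proj i ∘ₗ g) x • f (Pi.single i 1) = x := fun x => by
    conv_rhs => rw [← LinearMap.id_apply (R := R) x, ← hfg, LinearMap.comp_apply,
      ← Finset.univ_sum_single (g x), map_sum]
    refine Finset.sum_congr rfl fun i _ => ?_
    rw [← map_smul, ← Pi.single_smul, smul_eq_mul, mul_one]
    rfl
  choose t ht ht' using fun i => exists_jet_vec_eq (k := k) h (LinearMap.proj i ∘ₗ g)
  exact ⟨n, _, _, t, h, ht, ht'⟩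

variable {ι : Type*} [Fintype ι] {lam : ι → L →ₗ[R] R} {e : ι → L} {t : ι → Jet k R L}

theorem JetCoords.ordIdeal_eq_pow (h : JetCoords k lam e t) (n : ℕ) :
    ordIdeal (fun i => jetDer₂ k R (e i)) (RingHom.ker (jetCounit k R L)) n =
      RingHom.ker (jetCounit k R L) ^ n :=
  h.isFrame.ordIdeal_eq_pow h.eq_zero h.exists_lim n

theorem JetCoords.ker_eq_span (h : JetCoords k lam e t) :
    RingHom.ker (jetCounit k R L) = Ideal.span (Set.range t) :=
  h.isFrame.span_eq h.eq_zero h.exists_lim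

theorem JetCoords.euler_sub_mem (h : JetCoords k lam e t) (i : ι) :
    euler (fun i => jetDer₂ k R (e i)) t (t i) - t i ∈ RingHom.ker (jetCounit k R L) ^ 2 := by
  have := h.isFrame.euler_sub_mem (mem_ordIdeal_one.2 (h.coord_mem i))
  rwa [h.ordIdeal_eq_pow, Nat.cast_one, one_mul] at this

theorem JetCoords.isAdicComplete (h : JetCoords k lam e t) :
    IsAdicComplete (RingHom.ker (jetCounit k R L)) (Jet k R L) where
  haus' α hα := h.eq_zero α fun n => by
    have := hα n
    rwa [SModEq.zero, smul_eq_mul, Ideal.mul_top, ← h.ordIdeal_eq_pow] at this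
  prec' f hf := by
    have hf' : ∀ n, f (n + 1) - f n ∈
        ordIdeal (fun i => jetDer₂ k R (e i)) (RingHom.ker (jetCounit k R L)) n := fun n => by
      have := (hf (Nat.le_succ n)).symm
      rwa [SModEq.sub_mem, smul_eq_mul, Ideal.mul_top, ← h.ordIdeal_eq_pow] at this
    obtain ⟨α, hα⟩ := h.exists_lim f hf'
    refine ⟨α, fun n => SModEq.symm ?_⟩
    rw [SModEq.sub_mem, smul_eq_mul, Ideal.mul_top, ← h.ordIdeal_eq_pow]
    exact hα n

end JetComplete

end LieAlgebroid

/-! ### Derivations of bimodule tensor products and of completions -/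

section Dual

variable {k A C : Type*} [CommRing k] [CommRing A] [Algebra k A] [CommRing C] [Algebra k C]

/-- The algebra map to the dual numbers given by an algebra map and a derivation over it. -/
def dualHom (f : A →ₐ[k] C) (δ : Derivation k A A) : A →ₐ[k] TrivSqZeroExt C C :=
  AlgHom.ofLinearMap
    { toFun := fun a => TrivSqZeroExt.inl (f a) + TrivSqZeroExt.inr (f (δ a))
      map_add' := fun a b => by
        ext <;> simp
      map_smul' := fun c a => by
        ext <;> simp }
    (by ext <;> simp)
    (fun a b => by ext <;> simp [mul_comm])

theorem fst_dualHom (f : A →ₐ[k] C) (δ : Derivation k A A) (a : A) :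
    (dualHom f δ a).fst = f a := by
  simp [dualHom]

theorem snd_dualHom (f : A →ₐ[k] C) (δ : Derivation k A A) (a : A) :
    (dualHom f δ a).snd = f (δ a) := by
  simp [dualHom]

/-- The derivation defined by an algebra map to the dual numbers that lifts the identity. -/
def dualDer (φ : C →ₐ[k] TrivSqZeroExt C C) (hφ : ∀ c, (φ c).fst = c) : Derivation k C C :=
  Derivation.mk'
    { toFun := fun c => (φ c).snd
      map_add' := fun a b => by simp
      map_smul' := fun c a => by simp }
    (fun a b => by
      change (φ (a * b)).snd = a • (φ b).snd + b • (φ a).snd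
      simp [hφ, mul_comm])

theorem dualDer_apply (φ : C →ₐ[k] TrivSqZeroExt C C) (hφ : ∀ c, (φ c).fst = c) (c : C) :
    dualDer φ hφ c = (φ c).snd := rfl

end Dual

namespace FormalGroupoid

variable {k R A : Type*} [CommRing k] [CommRing R] [Algebra k R] [CommRing A] [Algebra k A]

section Tensor

variable {s t : R →ₐ[k] A}

theorem tensor₂_induction {p : Tensor₂ s t → Prop} (hl : ∀ a, p (inl s t a))
    (hr : ∀ a, p (inr s t a)) (hmul : ∀ x y, p x → p y → p (x * y))
    (hadd : ∀ x y, p x → p y → p (x + y)) (x : Tensor₂ s t) : p x := by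
  obtain ⟨y, rfl⟩ := Ideal.Quotient.mk_surjective x
  change p (mk₂ s t y)
  induction y using TensorProduct.induction_on with
  | zero => simpa using hl 0
  | add x y hx hy => rw [map_add]; exact hadd _ _ hx hy
  | tmul a b =>
    have : a ⊗ₜ[k] b = (a ⊗ₜ 1) * ((1 : A) ⊗ₜ b) := by simp
    rw [this, map_mul]
    exact hmul _ _ (hl a) (hr b)

theorem tensor₃_induction {p : Tensor₃ s t → Prop} (h₁ : ∀ a, p (in₁ s t a))
    (h₂ : ∀ a, p (in₂ s t a)) (h₃ : ∀ a, p (in₃ s t a)) (hmul : ∀ x y, p x → p y → p (x * y))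
    (hadd : ∀ x y, p x → p y → p (x + y)) (x : Tensor₃ s t) : p x := by
  obtain ⟨y, rfl⟩ := Ideal.Quotient.mk_surjective x
  change p (mk₃ s t y)
  have h0 : p 0 := by simpa using h₁ 0
  induction y using TensorProduct.induction_on with
  | zero => rw [map_zero]; exact h0
  | add x y hx hy => rw [map_add]; exact hadd _ _ hx hy
  | tmul a b =>
    have : a ⊗ₜ[k] b = (a ⊗ₜ 1) * ((1 : A) ⊗ₜ b) := by simp
    rw [this, map_mul]
    refine hmul _ _ (h₁ a) ?_
    clear this
    induction b using TensorProduct.induction_on with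
    | zero => rw [TensorProduct.tmul_zero, map_zero]; exact h0
    | add x y hx hy => rw [TensorProduct.tmul_add, map_add]; exact hadd _ _ hx hy
    | tmul b c =>
      have : (1 : A) ⊗ₜ[k] (b ⊗ₜ[k] c) = (1 ⊗ₜ (b ⊗ₜ 1)) * ((1 : A) ⊗ₜ ((1 : A) ⊗ₜ c)) := by simp
      rw [this, map_mul]
      exact hmul _ _ (h₂ b) (h₃ c)

/-- The algebra map `a ⊗ b ⊗ c ↦ f a * g b * h c` on `A ⊗_R A ⊗_R A`. -/
def lift₃ {B : Type*} [CommRing B] [Algebra k B] (f g h : A →ₐ[k] B)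
    (hfg : ∀ r, f (t r) = g (s r)) (hgh : ∀ r, g (t r) = h (s r)) : Tensor₃ s t →ₐ[k] B :=
  Ideal.Quotient.liftₐ (rel₃ s t)
    (Algebra.TensorProduct.productMap f (Algebra.TensorProduct.productMap g h)) (by
    have : rel₃ s t ≤ RingHom.ker
        (Algebra.TensorProduct.productMap f (Algebra.TensorProduct.productMap g h)) := by
      refine Ideal.span_le.2 ?_
      rintro _ (⟨r, rfl⟩ | ⟨r, rfl⟩)
      · simp [RingHom.mem_ker, hfg]
      · simp [RingHom.mem_ker, hgh]
    exact fun a ha => this ha)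

section lift₃

variable {B : Type*} [CommRing B] [Algebra k B] (f g h : A →ₐ[k] B)
    (hfg : ∀ r, f (t r) = g (s r)) (hgh : ∀ r, g (t r) = h (s r)) (a : A)

theorem lift₃_in₁ : lift₃ f g h hfg hgh (in₁ s t a) = f a := by
  change Algebra.TensorProduct.productMap f (Algebra.TensorProduct.productMap g h) (a ⊗ₜ 1) = f a
  simp

theorem lift₃_in₂ : lift₃ f g h hfg hgh (in₂ s t a) = g a := by
  change Algebra.TensorProduct.productMap f (Algebra.TensorProduct.productMap g h)
    (1 ⊗ₜ (a ⊗ₜ 1)) = g a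
  simp

theorem lift₃_in₃ : lift₃ f g h hfg hgh (in₃ s t a) = h a := by
  change Algebra.TensorProduct.productMap f (Algebra.TensorProduct.productMap g h)
    (1 ⊗ₜ (1 ⊗ₜ a)) = h a
  simp

end lift₃

/-- A derivation is an algebra map to the dual numbers lifting the identity, so the universal
property of the tensor product for algebra maps applies. Only the bimodule relation must be checked,
and this is `h`. -/
theorem exists_derivation₂ (δ δ' : Derivation k A A)
    (h : ∀ r, inl s t (δ (t r)) = inr s t (δ' (s r))) :
    ∃ d : Derivation k (Tensor₂ s t) (Tensor₂ s t),
      (∀ a, d (inl s t a) = inl s t (δ a)) ∧ ∀ a, d (inr s t a) = inr s t (δ' a) := by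
  let φ : Tensor₂ s t →ₐ[k] TrivSqZeroExt (Tensor₂ s t) (Tensor₂ s t) :=
    lift₂ (dualHom (inl s t) δ) (dualHom (inr s t) δ') fun r => by
      refine TrivSqZeroExt.ext ?_ ?_
      · rw [fst_dualHom, fst_dualHom, inl_t]
      · rw [snd_dualHom, snd_dualHom, h]
  have hφ : ∀ x, (φ x).fst = x := fun x => by
    induction x using tensor₂_induction with
    | hl a => rw [lift₂_inl, fst_dualHom]
    | hr a => rw [lift₂_inr, fst_dualHom]
    | hmul x y hx hy => rw [map_mul, TrivSqZeroExt.fst_mul, hx, hy]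
    | hadd x y hx hy => rw [map_add, TrivSqZeroExt.fst_add, hx, hy]
  refine ⟨dualDer φ hφ, fun a => ?_, fun a => ?_⟩
  · rw [dualDer_apply, lift₂_inl, snd_dualHom]
  · rw [dualDer_apply, lift₂_inr, snd_dualHom]

theorem exists_derivation₃ (δ δ' δ'' : Derivation k A A)
    (h : ∀ r, in₁ s t (δ (t r)) = in₂ s t (δ' (s r)))
    (h' : ∀ r, in₂ s t (δ' (t r)) = in₃ s t (δ'' (s r))) :
    ∃ d : Derivation k (Tensor₃ s t) (Tensor₃ s t), (∀ a, d (in₁ s t a) = in₁ s t (δ a)) ∧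
      (∀ a, d (in₂ s t a) = in₂ s t (δ' a)) ∧ ∀ a, d (in₃ s t a) = in₃ s t (δ'' a) := by
  let φ : Tensor₃ s t →ₐ[k] TrivSqZeroExt (Tensor₃ s t) (Tensor₃ s t) :=
    lift₃ (dualHom (in₁ s t) δ) (dualHom (in₂ s t) δ') (dualHom (in₃ s t) δ'')
      (fun r => by
        refine TrivSqZeroExt.ext ?_ ?_
        · rw [fst_dualHom, fst_dualHom, in₁_t]
        · rw [snd_dualHom, snd_dualHom, h])
      (fun r => by
        refine TrivSqZeroExt.ext ?_ ?_
        · rw [fst_dualHom, fst_dualHom, in₂_t]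
        · rw [snd_dualHom, snd_dualHom, h'])
  have hφ : ∀ x, (φ x).fst = x := fun x => by
    induction x using tensor₃_induction with
    | h₁ a => rw [lift₃_in₁, fst_dualHom]
    | h₂ a => rw [lift₃_in₂, fst_dualHom]
    | h₃ a => rw [lift₃_in₃, fst_dualHom]
    | hmul x y hx hy => rw [map_mul, TrivSqZeroExt.fst_mul, hx, hy]
    | hadd x y hx hy => rw [map_add, TrivSqZeroExt.fst_add, hx, hy]
  refine ⟨dualDer φ hφ, fun a => ?_, fun a => ?_, fun a => ?_⟩
  · rw [dualDer_apply, lift₃_in₁, snd_dualHom]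
  · rw [dualDer_apply, lift₃_in₂, snd_dualHom]
  · rw [dualDer_apply, lift₃_in₃, snd_dualHom]

end Tensor

/-! ### Continuous extensions of derivations to completions -/

section Derives

variable {B C : Type*} [CommRing B] [CommRing C] [Algebra k B] [Algebra k C]
  {I : Ideal B} {K : Ideal C}

/-- The element `y` of the completion of `C` is the image of `x` under the continuous extension of
the derivation `δ` of `C`. -/
def Derives (δ : Derivation k C C) (x y : AdicCompletion K C) : Prop :=
  ∀ (n : ℕ) (c : C), AdicCompletion.evalₐ K (n + 1) x = Ideal.Quotient.mk _ c →
    AdicCompletion.evalₐ K n y = Ideal.Quotient.mk _ (δ c)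

variable {δ : Derivation k C C} {x x' y y' : AdicCompletion K C}

/-- It suffices to check one representative at each level. -/
theorem derives_of_exists (h : ∀ n : ℕ, ∃ c : C,
    AdicCompletion.evalₐ K (n + 1) x = Ideal.Quotient.mk _ c ∧
      AdicCompletion.evalₐ K n y = Ideal.Quotient.mk _ (δ c)) : Derives δ x y := by
  intro n c hc
  obtain ⟨c', h₁, h₂⟩ := h n
  rw [h₂, Ideal.Quotient.eq, ← map_sub]
  rw [hc, Ideal.Quotient.eq] at h₁
  refine Derivation.map_pow_succ_mem δ n ?_
  rw [← neg_sub]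
  exact neg_mem h₁

theorem eval_of_eval_succ {n : ℕ} {c : C}
    (h : AdicCompletion.evalₐ K (n + 1) x = Ideal.Quotient.mk _ c) :
    AdicCompletion.evalₐ K n x = Ideal.Quotient.mk _ c := by
  rw [← factor_evalₐ (Nat.le_succ n), h, Ideal.Quotient.factor_mk]

theorem Derives.add (h : Derives δ x y) (h' : Derives δ x' y') :
    Derives δ (x + x') (y + y') := by
  refine derives_of_exists fun n => ?_
  obtain ⟨c, hc⟩ := Ideal.Quotient.mk_surjective (AdicCompletion.evalₐ K (n + 1) x)
  obtain ⟨c', hc'⟩ := Ideal.Quotient.mk_surjective (AdicCompletion.evalₐ K (n + 1) x')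
  refine ⟨c + c', ?_, ?_⟩
  · rw [map_add, map_add, hc, hc']
  · rw [map_add, h n c hc.symm, h' n c' hc'.symm, map_add, map_add]

theorem Derives.mul (h : Derives δ x y) (h' : Derives δ x' y') :
    Derives δ (x * x') (x * y' + x' * y) := by
  refine derives_of_exists fun n => ?_
  obtain ⟨c, hc⟩ := Ideal.Quotient.mk_surjective (AdicCompletion.evalₐ K (n + 1) x)
  obtain ⟨c', hc'⟩ := Ideal.Quotient.mk_surjective (AdicCompletion.evalₐ K (n + 1) x')
  refine ⟨c * c', ?_, ?_⟩
  · rw [map_mul, map_mul, hc, hc']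
  · rw [map_add, map_mul, map_mul, h n c hc.symm, h' n c' hc'.symm, eval_of_eval_succ hc.symm,
      eval_of_eval_succ hc'.symm, Derivation.leibniz, map_add, smul_eq_mul, smul_eq_mul, map_mul,
      map_mul]

theorem derives_of (c : C) :
    Derives δ (AdicCompletion.of K C c) (AdicCompletion.of K C (δ c)) :=
  derives_of_exists fun _ => ⟨c, AdicCompletion.evalₐ_of .., AdicCompletion.evalₐ_of ..⟩

theorem Derives.extend {f : B →ₐ[k] AdicCompletion K C} (hf : IsCts I K f) {δ' : Derivation k B B}
    (h : ∀ b, Derives δ (f b) (f (δ' b))) {x y : AdicCompletion I B} (hxy : Derives δ' x y) :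
    Derives δ (extend f hf x) (extend f hf y) := by
  intro n c hc
  obtain ⟨b, hb⟩ := Ideal.Quotient.mk_surjective (AdicCompletion.evalₐ I (n + 1) x)
  rw [evalₐ_extend, extendAux_apply f hf (n + 1) x b hb] at hc
  rw [evalₐ_extend, extendAux_apply f hf n y (δ' b) (hxy n b hb.symm).symm]
  exact h b n c hc

variable {s t : R →ₐ[k] A} {ε : A →ₐ[k] R}

/-- By the Leibniz rule for `Derives`, intertwining need only be verified on the two factors;
continuity carries it to the completion. -/
theorem Derives.clift₂ {f g : A →ₐ[k] AdicCompletion K C} (h : ∀ r, f (t r) = g (s r))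
    (hf : IsCts (RingHom.ker ε) K f) (hg : IsCts (RingHom.ker ε) K g)
    {d : Derivation k (Tensor₂ s t) (Tensor₂ s t)} {δ₁ δ₂ : A → A}
    (hl : ∀ a, d (inl s t a) = inl s t (δ₁ a)) (hr : ∀ a, d (inr s t a) = inr s t (δ₂ a))
    (hfd : ∀ a, Derives δ (f a) (f (δ₁ a))) (hgd : ∀ a, Derives δ (g a) (g (δ₂ a)))
    {x y : CTensor₂ s t ε} (hxy : Derives d x y) :
    Derives δ (clift₂ ε f g h hf hg x) (clift₂ ε f g h hf hg y) := by
  refine Derives.extend _ (fun b => ?_) hxy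
  induction b using tensor₂_induction with
  | hl a => rw [hl, lift₂_inl, lift₂_inl]; exact hfd a
  | hr a => rw [hr, lift₂_inr, lift₂_inr]; exact hgd a
  | hmul x y hx hy =>
    rw [Derivation.leibniz, smul_eq_mul, smul_eq_mul, map_mul, map_add, map_mul, map_mul]
    exact hx.mul hy
  | hadd x y hx hy => rw [map_add, map_add, map_add]; exact hx.add hy

/-- Continuous algebra maps to a completion that intertwine the same operators with derivations
whose order filtration is the adic one are equal if they agree on the image of `s`. -/
theorem eq_of_derives {ι : Type*} {δ : ι → Derivation k C C}
    (hδ : ∀ n, ordIdeal δ K n ≤ K ^ n) {f g : A →ₐ[k] AdicCompletion K C} (δ' : ι → A → A)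
    (hs : ∀ r, ε (s r) = r) (hf : IsCts (RingHom.ker ε) K f) (hg : IsCts (RingHom.ker ε) K g)
    (hfg : ∀ r, f (s r) = g (s r))
    (hfd : ∀ i a, Derives (δ i) (f a) (f (δ' i a)))
    (hgd : ∀ i a, Derives (δ i) (g a) (g (δ' i a))) (a : A) : f a = g a := by
  have h1 : ∀ a, AdicCompletion.evalₐ K 1 (f a) = AdicCompletion.evalₐ K 1 (g a) := fun a => by
    have ha : a - s (ε a) ∈ RingHom.ker ε := by
      rw [RingHom.mem_ker, map_sub, hs, sub_self]
    have hf' := hf _ ha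
    have hg' := hg _ ha
    rw [map_sub, map_sub, sub_eq_zero] at hf' hg'
    rw [hf', hg', hfg]
  suffices ∀ n a, AdicCompletion.evalₐ K n (f a) = AdicCompletion.evalₐ K n (g a) from
    AdicCompletion.ext_evalₐ fun n => this n a
  intro n
  induction n with
  | zero => intro a; rw [← factor_evalₐ (Nat.zero_le 1), h1, factor_evalₐ (Nat.zero_le 1)]
  | succ n ih =>
    intro a
    obtain ⟨c, hc⟩ := Ideal.Quotient.mk_surjective (AdicCompletion.evalₐ K (n + 1) (f a))
    obtain ⟨c', hc'⟩ := Ideal.Quotient.mk_surjective (AdicCompletion.evalₐ K (n + 1) (g a))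
    rw [← hc, ← hc', Ideal.Quotient.eq]
    -- The difference of representatives lies in `K` by `h1`. Its derivatives represent `f (δ' i a)
    -- - g (δ' i a)`, which vanishes modulo `K ^ n` by induction. Hence the difference has order `n
    -- + 1`, and `hδ` puts it in the adic power.
    refine hδ _ (mem_ordIdeal_succ.2 ⟨?_, fun i => pow_le_ordIdeal n ?_⟩)
    · have := h1 a
      rw [← factor_evalₐ (Nat.le_add_left 1 n), ← hc, ← factor_evalₐ (Nat.le_add_left 1 n), ← hc',
        Ideal.Quotient.factor_mk, Ideal.Quotient.factor_mk, Ideal.Quotient.eq, pow_one] at this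
      exact this
    · rw [map_sub, ← Ideal.Quotient.eq, ← hfd i a n c hc.symm, ← hgd i a n c' hc'.symm, ih]

end Derives

end FormalGroupoid

/-! ### The comultiplication of the jet algebra -/

section OrdIdealComap

variable {k W A ι : Type*} [CommRing k] [CommRing W] [Algebra k W] [CommRing A] [Algebra k A]

theorem map_mem_ordIdeal_iff {d : ι → Derivation k W W} {δ : ι → Derivation k A A} {K : Ideal W}
    {K' : Ideal A} (P : W →ₐ[k] A) (hd : ∀ i w, δ i (P w) = P (d i w))
    (hK : ∀ w, P w ∈ K' ↔ w ∈ K) (n : ℕ) (w : W) :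
    P w ∈ ordIdeal δ K' n ↔ w ∈ ordIdeal d K n := by
  induction n generalizing w with
  | zero => exact iff_of_true (mem_ordIdeal_zero _) (mem_ordIdeal_zero _)
  | succ n ih => simp only [mem_ordIdeal_succ, hK, hd, ih]

end OrdIdealComap

namespace FormalGroupoid

variable {k R A : Type*} [CommRing k] [CommRing R] [Algebra k R] [CommRing A] [Algebra k A]
  {s t : R →ₐ[k] A} {ε : A →ₐ[k] R}

/-- Modulo `ideal₂`, every element of the tensor product is congruent to the scalar from $R$ given
by its augmentation. -/
theorem mem_ideal₂_iff (hs : ∀ r, ε (s r) = r) (ht : ∀ r, ε (t r) = r)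
    {ε₂ : Tensor₂ s t →ₐ[k] R} (hl : ∀ a, ε₂ (inl s t a) = ε a) (hr : ∀ a, ε₂ (inr s t a) = ε a)
    (w : Tensor₂ s t) : ε₂ w = 0 ↔ w ∈ ideal₂ s t ε := by
  have hl' : ∀ a, ε a = 0 → inl s t a ∈ ideal₂ s t ε := fun a ha =>
    Ideal.mem_sup_left (Ideal.mem_map_of_mem _ ha)
  have hr' : ∀ a, ε a = 0 → inr s t a ∈ ideal₂ s t ε := fun a ha =>
    Ideal.mem_sup_right (Ideal.mem_map_of_mem _ ha)
  constructor
  · intro hw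
    have key : w - inl s t (s (ε₂ w)) ∈ ideal₂ s t ε := by
      clear hw
      induction w using tensor₂_induction with
      | hl a =>
        rw [hl, ← map_sub]
        exact hl' _ (by rw [map_sub, hs, sub_self])
      | hr a =>
        have : inr s t a - inl s t (s (ε a)) =
            inr s t (a - s (ε a)) + inl s t (t (ε a) - s (ε a)) := by
          rw [map_sub, map_sub, inl_t]
          ring
        rw [hr, this]
        exact add_mem (hr' _ (by rw [map_sub, hs, sub_self]))
          (hl' _ (by rw [map_sub, hs, ht, sub_self]))
      | hmul x y hx hy =>
        have : x * y - inl s t (s (ε₂ (x * y))) =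
            x * (y - inl s t (s (ε₂ y))) + inl s t (s (ε₂ y)) * (x - inl s t (s (ε₂ x))) := by
          rw [map_mul, map_mul, map_mul]
          ring
        rw [this]
        exact add_mem (Ideal.mul_mem_left _ _ hy) (Ideal.mul_mem_left _ _ hx)
      | hadd x y hx hy =>
        rw [map_add, map_add, map_add, add_sub_add_comm]
        exact add_mem hx hy
    rwa [hw, map_zero, map_zero, sub_zero] at key
  · have : ideal₂ s t ε ≤ RingHom.ker ε₂ := by
      refine sup_le (Ideal.map_le_iff_le_comap.2 fun a ha => ?_)
        (Ideal.map_le_iff_le_comap.2 fun a ha => ?_)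
      · rw [Ideal.mem_comap, RingHom.mem_ker, hl]; exact ha
      · rw [Ideal.mem_comap, RingHom.mem_ker, hr]; exact ha
    exact fun hw => this hw

end FormalGroupoid

namespace LieAlgebroid

open FormalGroupoid

section Conv

variable {k R L : Type*} [CommRing k] [CommRing R] [Algebra k R] [LieRing L] [LieAlgebra k L]
  [Module R L] [LieRingModule L R] [LieRinehartRing R L] [LieRinehartAlgebra k R L]
  {B : Type*} [CommRing B] [Algebra k B] [Algebra R B] [IsScalarTower k R B]

variable (k R L B) in
/-- Evaluation at `1`, as an algebra map. -/
def evalOne : WithConv (Env k R L →ₗ[R] B) →ₐ[k] B :=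
  AlgHom.ofLinearMap
    { toFun := fun f => f 1
      map_add' := fun _ _ => rfl
      map_smul' := fun _ _ => rfl }
    (by
      change algebraMap R B (evalAt k R L 1 1) = 1
      rw [evalAt_one, map_one])
    (fun f g => conv_mul_one_apply f g)

variable (k R L B) in
/-- The algebra map from jets to a convolution algebra induced by the structure map of `B`. -/
def extendScalars : Jet k R L →ₐ[k] WithConv (Env k R L →ₗ[R] B) :=
  AlgHom.ofLinearMap
    { toFun := fun α => WithConv.toConv (Algebra.linearMap R B ∘ₗ α.ofConv)
      map_add' := fun α β => WithConv.ext (LinearMap.ext fun D =>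
        map_add (algebraMap R B) (α D) (β D))
      map_smul' := fun c α => WithConv.ext (LinearMap.ext fun D => by
        change algebraMap R B (c • α D) = c • algebraMap R B (α D)
        rw [Algebra.algebraMap_eq_smul_one, Algebra.algebraMap_eq_smul_one, smul_assoc]) }
    rfl
    (fun α β => WithConv.ext (LinearMap.ext fun D => by
      change algebraMap R B ((α * β) D) = LinearMap.mul' R B (TensorProduct.map
        (Algebra.linearMap R B ∘ₗ α.ofConv) (Algebra.linearMap R B ∘ₗ β.ofConv)
          (CoalgebraStruct.comul (R := R) D))
      rw [Jet.mul_apply]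
      induction CoalgebraStruct.comul (R := R) D using TensorProduct.induction_on with
      | zero => simp
      | add x y hx hy => simp only [map_add, hx, hy]
      | tmul x y => simp only [TensorProduct.map_tmul, LinearMap.mul'_apply, map_mul,
          LinearMap.comp_apply, Algebra.linearMap_apply]))

theorem evalAt_one_mul_vec (D : Env k R L) (l : L) :
    evalAt k R L 1 (D * Env.vec k R L l) = 0 := by
  change (baseRep k R L).toEnd (D * Env.vec k R L l) 1 = 0
  rw [map_mul, Module.End.mul_apply, baseRep_vec, lie_one_eq, map_zero]

end Conv

end LieAlgebroid

namespace LieAlgebroid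

open FormalGroupoid

/-! ### Families of jets, where tensors and coproducts are compared -/

section JetJet

variable {k R L : Type*} [CommRing k] [CommRing R] [Algebra k R] [LieRing L] [LieAlgebra k L]
  [Module R L] [LieRingModule L R] [LieRinehartRing R L] [LieRinehartAlgebra k R L]

variable (k R L) in
/-- The algebra of families of jets parametrized by differential operators. -/
def JetJet : Type _ := WithConv (Env k R L →ₗ[R] Jet k R L)

instance : CommRing (JetJet k R L) :=
  inferInstanceAs (CommRing (WithConv (Env k R L →ₗ[R] Jet k R L)))

instance : Algebra k (JetJet k R L) :=
  inferInstanceAs (Algebra k (WithConv (Env k R L →ₗ[R] Jet k R L)))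

/-- The underlying linear map of a family of jets. -/
def JetJet.toLin (f : JetJet k R L) : Env k R L →ₗ[R] Jet k R L := WithConv.ofConv f

instance : CoeFun (JetJet k R L) fun _ => Env k R L → Jet k R L := ⟨fun f => f.toLin⟩

variable (k R L) in
/-- The uncompleted bimodule tensor product of two copies of the jet algebra. -/
abbrev JetTensor₂ : Type _ := Tensor₂ (unit₁ k R L) (unit₂ k R L)

theorem JetJet.ext {f g : JetJet k R L} (h : ∀ D, f D = g D) : f = g :=
  WithConv.ext (LinearMap.ext h)

theorem JetJet.sum_apply {ι : Type*} (s : Finset ι) (f : ι → JetJet k R L) (D : Env k R L) :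
    (∑ i ∈ s, f i) D = ∑ i ∈ s, f i D := by
  induction s using Finset.cons_induction with
  | empty => rfl
  | cons i s hi ih => rw [Finset.sum_cons, Finset.sum_cons, ← ih]; rfl

theorem JetJet.mul_one_apply (f g : JetJet k R L) : (f * g) 1 = f 1 * g 1 :=
  conv_mul_one_apply f g

variable (k R L) in
/-- Jets as constant families. -/
def constJet : Jet k R L →ₐ[k] JetJet k R L := constConv k L (Jet k R L)

variable (k R L) in
/-- Jets as families of scalars. -/
def scalarJet : Jet k R L →ₐ[k] JetJet k R L := extendScalars k R L (Jet k R L)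

variable (k R L) in
/-- The augmentation of the algebra of families of jets. -/
def jetJetCounit : JetJet k R L →ₐ[k] R := (jetCounit k R L).comp (evalOne k R L (Jet k R L))

theorem constJet_apply (α : Jet k R L) (D : Env k R L) :
    constJet k R L α D = evalAt k R L 1 D • α := rfl

theorem scalarJet_apply (α : Jet k R L) (D : Env k R L) :
    scalarJet k R L α D = unit₁ k R L (α D) := rfl

theorem jetJetCounit_constJet (α : Jet k R L) :
    jetJetCounit k R L (constJet k R L α) = jetCounit k R L α := by
  change jetCounit k R L (evalAt k R L 1 1 • α) = _
  rw [evalAt_one, one_smul]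

theorem jetJetCounit_scalarJet (α : Jet k R L) :
    jetJetCounit k R L (scalarJet k R L α) = jetCounit k R L α :=
  jetCounit_unit₁ (α 1)

theorem constJet_unit₁ (r : R) : constJet k R L (unit₁ k R L r) = scalarJet k R L (unit₁ k R L r) :=
  JetJet.ext fun D => by
    rw [constJet_apply, scalarJet_apply, smul_eq_unit₁_mul, ← map_mul, mul_comm]
    rfl

/-! #### Derivations of `JetJet` -/

variable (k R) in
/-- The action of `²∇_l` on the values. -/
def valueDer (l : L) : Derivation k (JetJet k R L) (JetJet k R L) :=
  postDer (jetDer₂ k R l) (jetDer₂_smul l)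

variable (k R) in
/-- The diagonal action of `l`. -/
def diagDer (l : L) : Derivation k (JetJet k R L) (JetJet k R L) :=
  leftDer l (jetDer₁ k R l) (jetDer₁_smul l)

variable (k R) in
/-- The action of `²∇_l` on the parameters. -/
def paramDer (l : L) : Derivation k (JetJet k R L) (JetJet k R L) := rightDer k l

variable (k L) in
/-- The family `D ↦ D(r)` of scalars. -/
def evalJet (r : R) : JetJet k R L := evalConv k L (Jet k R L) r

theorem paramDer_apply (l : L) (f : JetJet k R L) (D : Env k R L) :
    paramDer k R l f D = f (D * Env.vec k R L l) := rfl

theorem evalJet_mul_apply (r : R) (f : JetJet k R L) (D : Env k R L) :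
    (evalJet k L r * f) D = f (D * Env.fn k R L r) := evalConv_mul_apply r f D

theorem constJet_mul_apply (α : Jet k R L) (f : JetJet k R L) (D : Env k R L) :
    (constJet k R L α * f) D = α * f D := constConv_mul_apply α f D

theorem jetJetCounit_evalJet (r : R) :
    jetJetCounit k R L (evalJet k L r) = r := by
  change jetCounit k R L (evalConv k L (Jet k R L) r 1) = r
  rw [evalConv_one_apply]
  exact jetCounit_unit₁ r

theorem valueDer_apply (l : L) (f : JetJet k R L) (D : Env k R L) :
    valueDer k R l f D = jetDer₂ k R l (f D) := rfl

theorem diagDer_apply (l : L) (f : JetJet k R L) (D : Env k R L) :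
    diagDer k R l f D = jetDer₁ k R l (f D) - f (Env.vec k R L l * D) := rfl

theorem valueDer_constJet (l : L) (α : Jet k R L) :
    valueDer k R l (constJet k R L α) = constJet k R L (jetDer₂ k R l α) :=
  JetJet.ext fun D => by
    rw [valueDer_apply, constJet_apply, constJet_apply, jetDer₂_smul]

theorem valueDer_scalarJet (l : L) (α : Jet k R L) :
    valueDer k R l (scalarJet k R L α) = 0 :=
  JetJet.ext fun D => by
    rw [valueDer_apply, scalarJet_apply, jetDer₂_unit₁]
    rfl

theorem paramDer_constJet (l : L) (α : Jet k R L) :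
    paramDer k R l (constJet k R L α) = 0 :=
  JetJet.ext fun D => by
    rw [paramDer_apply, constJet_apply, evalAt_one_mul_vec, zero_smul]
    rfl

theorem paramDer_scalarJet (l : L) (α : Jet k R L) :
    paramDer k R l (scalarJet k R L α) = scalarJet k R L (jetDer₂ k R l α) := rfl

theorem diagDer_constJet (l : L) (α : Jet k R L) :
    diagDer k R l (constJet k R L α) = constJet k R L (jetDer₁ k R l α) :=
  JetJet.ext fun D => by
    rw [diagDer_apply, constJet_apply, constJet_apply, constJet_apply, jetDer₁_smul, evalAt_mul,
      baseRep_vec, add_sub_cancel_left]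

theorem diagDer_scalarJet (l : L) (α : Jet k R L) :
    diagDer k R l (scalarJet k R L α) = scalarJet k R L (jetDer₁ k R l α) :=
  JetJet.ext fun D => by
    rw [diagDer_apply, scalarJet_apply, scalarJet_apply, scalarJet_apply, jetDer₁_unit₁,
      ← map_sub, jetDer₁_apply]

theorem valueDer_paramDer (l m : L) (f : JetJet k R L) :
    valueDer k R l (paramDer k R m f) = paramDer k R m (valueDer k R l f) := rfl

theorem valueDer_lie (l m : L) (f : JetJet k R L) : valueDer k R ⁅l, m⁆ f =
    valueDer k R l (valueDer k R m f) - valueDer k R m (valueDer k R l f) :=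
  JetJet.ext fun D => jetDer₂_lie l m (f D)

theorem valueDer_eq_sum {ι : Type*} [Fintype ι] {lam : ι → L →ₗ[R] R} {e : ι → L}
    (he : ∀ x, ∑ i, lam i x • e i = x) (x : L) (f : JetJet k R L) :
    valueDer k R x f = ∑ i, constJet k R L (unit₂ k R L (lam i x)) * valueDer k R (e i) f :=
  JetJet.ext fun D => by
    rw [JetJet.sum_apply]
    refine (rightDer_eq_sum he x (f D)).trans (Finset.sum_congr rfl fun i _ => ?_)
    exact (constJet_mul_apply (unit₂ k R L (lam i x)) (valueDer k R (e i) f) D).symm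

theorem paramDer_eq_sum {ι : Type*} [Fintype ι] {lam : ι → L →ₗ[R] R} {e : ι → L}
    (he : ∀ x, ∑ i, lam i x • e i = x) (x : L) (f : JetJet k R L) :
    paramDer k R x f = ∑ i, evalJet k L (lam i x) * paramDer k R (e i) f :=
  rightDer_eq_sum he x f

theorem paramDer_lie (l m : L) (f : JetJet k R L) : paramDer k R ⁅l, m⁆ f =
    paramDer k R l (paramDer k R m f) - paramDer k R m (paramDer k R l f) :=
  rightDer_lie l m f

/-! #### The map from the bimodule tensor product -/

variable (k R L) in
/-- The algebra map `α ↦ (E ↦ E(1) S(α))`. -/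
def constAntipode : Jet k R L →ₐ[k] JetJet k R L :=
  (constJet k R L).comp (antipode k R L).toAlgHom

theorem constAntipode_unit₂ (r : R) :
    constAntipode k R L (unit₂ k R L r) = scalarJet k R L (unit₁ k R L r) := by
  rw [← constJet_unit₁, ← antipode_unit₂]
  rfl

variable (k R L) in
/-- The algebra map `α ⊗ β ↦ (E ↦ β(E) S(α))`. -/
def toJetJet : JetTensor₂ k R L →ₐ[k] JetJet k R L :=
  lift₂ (s := unit₁ k R L) (t := unit₂ k R L) (B := JetJet k R L) 
    (constAntipode k R L) (scalarJet k R L) constAntipode_unit₂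

theorem toJetJet_inl (α : Jet k R L) :
    toJetJet k R L (inl _ _ α) = constJet k R L (antipode k R L α) :=
  lift₂_inl (B := JetJet k R L) (constAntipode k R L) (scalarJet k R L) constAntipode_unit₂ α

theorem toJetJet_inr (α : Jet k R L) :
    toJetJet k R L (inr _ _ α) = scalarJet k R L α :=
  lift₂_inr (B := JetJet k R L) (constAntipode k R L) (scalarJet k R L) constAntipode_unit₂ α

variable (k R L) in
/-- The augmentation of the bimodule tensor product. -/
def tensorCounit : JetTensor₂ k R L →ₐ[k] R := (jetJetCounit k R L).comp (toJetJet k R L)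

theorem tensorCounit_inl (α : Jet k R L) :
    tensorCounit k R L (inl _ _ α) = jetCounit k R L α := by
  rw [tensorCounit, AlgHom.comp_apply, toJetJet_inl, jetJetCounit_constJet, jetCounit_antipode]

theorem tensorCounit_inr (α : Jet k R L) :
    tensorCounit k R L (inr _ _ α) = jetCounit k R L α := by
  rw [tensorCounit, AlgHom.comp_apply, toJetJet_inr, jetJetCounit_scalarJet]

theorem toJetJet_mem_ker_iff (w : JetTensor₂ k R L) :
    toJetJet k R L w ∈ RingHom.ker (jetJetCounit k R L) ↔
      w ∈ ideal₂ (unit₁ k R L) (unit₂ k R L) (jetCounit k R L) :=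
  mem_ideal₂_iff (ε := jetCounit k R L) jetCounit_unit₁ jetCounit_unit₂
    (ε₂ := tensorCounit k R L) tensorCounit_inl tensorCounit_inr w

/-- Because $\langle\alpha,D\rangle_1=(S\alpha)(D)$ and $\langle\beta,E\rangle_2=\beta(E)$, pairing
with $D,E$ becomes evaluation of a family at $E$ and of the resulting jet at $D$. -/
theorem pairTensor_eq (D E : Env k R L) (y : Jet k R L ⊗[k] Jet k R L) :
    pairTensor D E y = toJetJet k R L (mk₂ _ _ y) E D := by
  induction y using TensorProduct.induction_on with
  | zero => rw [map_zero, map_zero, map_zero]; rfl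
  | add x y hx hy => rw [map_add, map_add, map_add, hx, hy]; rfl
  | tmul α β =>
    have h : mk₂ (unit₁ k R L) (unit₂ k R L) (α ⊗ₜ[k] β) = inl _ _ α * inr _ _ β := by
      change _ = mk₂ _ _ (α ⊗ₜ 1) * mk₂ _ _ (1 ⊗ₜ β)
      rw [← map_mul, Algebra.TensorProduct.tmul_mul_tmul, mul_one, one_mul]
    rw [h, map_mul, toJetJet_inl, toJetJet_inr, pairTensor_tmul, pair₁_eq, pair₂_apply]
    have h' : (constJet k R L (antipode k R L α) * scalarJet k R L β) E =
        β E • antipode k R L α := by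
      rw [constJet_mul_apply, scalarJet_apply, smul_eq_unit₁_mul, mul_comm]
    rw [h', mul_comm]
    rfl

/-- Derivations that are intertwined by `toJetJet` on generators are intertwined. -/
theorem toJetJet_der {d : Derivation k (JetTensor₂ k R L) (JetTensor₂ k R L)}
    {δ : Derivation k (JetJet k R L) (JetJet k R L)}
    (hl : ∀ a, δ (toJetJet k R L (inl _ _ a)) = toJetJet k R L (d (inl _ _ a)))
    (hr : ∀ a, δ (toJetJet k R L (inr _ _ a)) = toJetJet k R L (d (inr _ _ a)))
    (w : JetTensor₂ k R L) : δ (toJetJet k R L w) = toJetJet k R L (d w) := by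
  induction w using tensor₂_induction with
  | hl a => exact hl a
  | hr a => exact hr a
  | hmul x y hx hy =>
    rw [map_mul, Derivation.leibniz, Derivation.leibniz, hx, hy, smul_eq_mul, smul_eq_mul,
      smul_eq_mul, smul_eq_mul, map_add, map_mul, map_mul]
  | hadd x y hx hy => rw [map_add, map_add, map_add, map_add, hx, hy]

variable (k R L) in
/-- The families `E ↦ S(²∇_E α)`. -/
def translates : Jet k R L →ₗ[k] JetJet k R L where
  toFun α := WithConv.toConv
    { toFun := fun E => antipode k R L (nabla₂ k R L E α)
      map_add' := fun D E => by rw [map_add, LinearMap.add_apply, map_add]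
      map_smul' := fun r D => by
        rw [Env.smul_def, map_mul, Module.End.mul_apply, nabla₂_fn, map_mul, antipode_unit₂,
          RingHom.id_apply, smul_eq_unit₁_mul] }
  map_add' α β := JetJet.ext fun D => by
    change antipode k R L (nabla₂ k R L D (α + β)) = antipode k R L (nabla₂ k R L D α) +
      antipode k R L (nabla₂ k R L D β)
    rw [map_add, map_add]
  map_smul' c α := JetJet.ext fun D => by
    change antipode k R L (nabla₂ k R L D (c • α)) = c • antipode k R L (nabla₂ k R L D α)
    rw [map_smul, map_smul]

theorem translates_apply (α : Jet k R L) (E : Env k R L) :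
    translates k R L α E = antipode k R L (nabla₂ k R L E α) := rfl

theorem paramDer_translates (l : L) (α : Jet k R L) :
    paramDer k R l (translates k R L α) = translates k R L (jetDer₂ k R l α) :=
  JetJet.ext fun D => by
    rw [paramDer_apply, translates_apply, translates_apply, map_mul]
    rfl

theorem valueDer_translates (l : L) (α : Jet k R L) :
    valueDer k R l (translates k R L α) = translates k R L (jetDer₁ k R l α) :=
  JetJet.ext fun D => by
    rw [valueDer_apply, translates_apply, translates_apply, jetDer₂_antipode, ← nabla₁_vec,
      ← nabla₁_vec, nabla₁_nabla₂]

/-- ${}^1\nabla_lS({}^2\nabla_E\alpha)=S({}^2\nabla_{lE}\alpha)$: the two terms of the diagonal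
action cancel. The antipode axioms and the middle case of coassociativity come from this. -/
theorem diagDer_translates (l : L) (α : Jet k R L) :
    diagDer k R l (translates k R L α) = 0 :=
  JetJet.ext fun D => by
    rw [diagDer_apply, translates_apply, translates_apply, jetDer₁_antipode, map_mul]
    exact sub_self _

theorem translates_unit₂_mul (r : R) (α : Jet k R L) :
    translates k R L (unit₂ k R L r * α) =
      evalJet k L r * translates k R L α :=
  JetJet.ext fun D => by
    rw [evalJet_mul_apply, translates_apply, translates_apply, map_mul (nabla₂ k R L), Module.End.mul_apply,
      nabla₂_fn]

/-- Induction on $D$ from the right: the parameter derivations act on both sides by the Leibniz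
rule, and right multiplication by $r$ is a convolution factor. At $D=1$ the claim is the
multiplicativity of $S$. -/
theorem translates_mul (α β : Jet k R L) :
    translates k R L (α * β) = translates k R L α * translates k R L β := by
  suffices ∀ (D : Env k R L) α β,
      translates k R L (α * β) D = (translates k R L α * translates k R L β) D from
    JetJet.ext fun D => this D α β
  intro D
  induction D using Env.induction_right with
  | hone =>
    intro α β
    rw [JetJet.mul_one_apply, translates_apply, translates_apply, translates_apply, map_one]
    exact map_mul (antipode k R L) α β
  | hfn r D hD =>
    intro α β
    rw [← evalJet_mul_apply, ← evalJet_mul_apply, ← mul_assoc, ← translates_unit₂_mul,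
      ← translates_unit₂_mul, ← hD, mul_assoc]
  | hvec l D hD =>
    intro α β
    rw [← paramDer_apply, ← paramDer_apply, paramDer_translates,
      Derivation.leibniz, Derivation.leibniz, paramDer_translates, paramDer_translates, map_add]
    exact congrArg₂ (· + ·) (hD _ _) (hD _ _)
  | hadd D E hD hE => intro α β; rw [map_add, map_add, hD, hE]

theorem nabla₂_one (E : Env k R L) :
    nabla₂ k R L E 1 = unit₂ k R L (evalAt k R L 1 E) :=
  WithConv.ext (LinearMap.ext fun D => evalAt_mul 1 D E)

theorem translates_unit₂ (r : R) :
    translates k R L (unit₂ k R L r) = scalarJet k R L (unit₂ k R L r) :=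
  JetJet.ext fun D => by
    rw [translates_apply, scalarJet_apply]
    have : nabla₂ k R L D (unit₂ k R L r) = unit₂ k R L (unit₂ k R L r D) :=
      WithConv.ext (LinearMap.ext fun E => evalAt_mul r E D)
    rw [this, antipode_unit₂]

theorem translates_unit₁ (r : R) :
    translates k R L (unit₁ k R L r) = constJet k R L (unit₂ k R L r) :=
  JetJet.ext fun D => by
    rw [translates_apply, constJet_apply]
    have : nabla₂ k R L D (unit₁ k R L r) = r • nabla₂ k R L D 1 :=
      WithConv.ext (LinearMap.ext fun E => rfl)
    rw [this, nabla₂_one, smul_eq_unit₁_mul, map_mul, antipode_unit₁, antipode_unit₂,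
      smul_eq_unit₁_mul, mul_comm]

variable (k R L) in
/-- `translates` as an algebra map. -/
def translatesHom : Jet k R L →ₐ[k] JetJet k R L :=
  AlgHom.ofLinearMap (translates k R L)
    (by rw [← map_one (unit₂ k R L), translates_unit₂, map_one, map_one]) translates_mul

theorem jetJetCounit_translates (α : Jet k R L) :
    jetJetCounit k R L (translates k R L α) = jetCounit k R L α := by
  change jetCounit k R L (antipode k R L (nabla₂ k R L 1 α)) = _
  rw [jetCounit_antipode, map_one]
  rfl

theorem translates_apply_apply (α : Jet k R L) (D E : Env k R L) :
    translates k R L α E D = jetCounit k R L ((nabla₁ k R L).toEnd D (nabla₂ k R L E α)) :=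
  (pair₁_eq D (nabla₂ k R L E α)).symm

end JetJet

end LieAlgebroid

/-! ### Lifting algebra maps through a dense filtered image -/

section Approximation

variable {k W C A : Type*} [CommRing k] [CommRing W] [Algebra k W] [CommRing C] [Algebra k C]
  [CommRing A] [Algebra k A] {K : Ideal W} {F : ℕ → Ideal C}

/-- An algebra map to a filtered algebra lifts to the completion of an algebra `W` that approximates
its elements. -/
theorem exists_lift_adicCompletion (hF : Antitone F) (P : W →ₐ[k] C)
    (hP : ∀ n w, P w ∈ F n ↔ w ∈ K ^ n) (happ : ∀ n c, ∃ w, c - P w ∈ F n) (Ψ : A →ₐ[k] C) :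
    ∃ Δ : A →ₐ[k] AdicCompletion K W, ∀ n a w,
      AdicCompletion.evalₐ K n (Δ a) = Ideal.Quotient.mk _ w ↔ P w - Ψ a ∈ F n := by
  -- `P` induces isomorphisms of the truncations: injective by `hP`, surjective by `happ`. Inverting
  -- them on the classes of `Ψ a` gives the components of the lift.
  let θ : ∀ n, (W ⧸ K ^ n) →ₐ[k] C ⧸ F n := fun n =>
    Ideal.quotientMapₐ (F n) P fun w hw => (hP n w).2 hw
  have hθ : ∀ n w, θ n (Ideal.Quotient.mk _ w) = Ideal.Quotient.mk _ (P w) := fun n w => rfl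
  have hbij : ∀ n, Function.Bijective (θ n) := fun n => by
    refine ⟨(injective_iff_map_eq_zero _).2 fun x hx => ?_, fun y => ?_⟩
    · obtain ⟨w, rfl⟩ := Ideal.Quotient.mk_surjective x
      rw [hθ, Ideal.Quotient.eq_zero_iff_mem, hP] at hx
      exact Ideal.Quotient.eq_zero_iff_mem.2 hx
    · obtain ⟨c, rfl⟩ := Ideal.Quotient.mk_surjective y
      obtain ⟨w, hw⟩ := happ n c
      exact ⟨Ideal.Quotient.mk _ w, ((Ideal.Quotient.eq).2 hw).symm⟩
  let D : ∀ n, A →ₐ[k] W ⧸ K ^ n := fun n =>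
    ((AlgEquiv.ofBijective (θ n) (hbij n)).symm : (C ⧸ F n) →ₐ[k] W ⧸ K ^ n).comp
      ((Ideal.Quotient.mkₐ k (F n)).comp Ψ)
  have hD : ∀ n a w, D n a = Ideal.Quotient.mk _ w ↔ P w - Ψ a ∈ F n := fun n a w => by
    have : D n a = Ideal.Quotient.mk _ w ↔ Ideal.Quotient.mk (F n) (Ψ a) =
        AlgEquiv.ofBijective (θ n) (hbij n) (Ideal.Quotient.mk _ w) :=
      (AlgEquiv.ofBijective (θ n) (hbij n)).symm_apply_eq
    rw [this, eq_comm, ← Ideal.Quotient.eq]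
    rfl
  refine ⟨AdicCompletion.liftAlgHom K D fun {m n} h => AlgHom.ext fun a => ?_, fun n a w => ?_⟩
  · obtain ⟨w, hw⟩ := Ideal.Quotient.mk_surjective (D n a)
    rw [AlgHom.comp_apply, ← hw]
    refine ((hD m a w).2 ?_).symm
    exact hF h ((hD n a w).1 hw.symm)
  · rw [AdicCompletion.evalₐ_liftAlgHom, hD]

/-- Derivations that intertwine `P` and `Ψ` are intertwined by the lift. -/
theorem derives_of_intertwine {P : W →ₐ[k] C} {f : A → C} {g : A → AdicCompletion K W}
    (hg : ∀ n a w, AdicCompletion.evalₐ K n (g a) = Ideal.Quotient.mk _ w ↔ P w - f a ∈ F n)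
    {d : Derivation k W W} {δ : Derivation k C C} (hd : ∀ w, δ (P w) = P (d w))
    (hδ : ∀ n, ∀ c ∈ F (n + 1), δ c ∈ F n) {a b : A} (hab : δ (f a) = f b) :
    FormalGroupoid.Derives d (g a) (g b) := by
  intro n w hw
  rw [hg] at hw ⊢
  rw [← hd, ← hab, ← map_sub]
  exact hδ n _ hw

end Approximation

namespace LieAlgebroid

open FormalGroupoid

/-! ### The filtration by order on families of jets -/

section JetJetFrame

variable {k R L : Type*} [CommRing k] [CommRing R] [Algebra k R] [LieRing L] [LieAlgebra k L]
  [Module R L] [LieRingModule L R] [LieRinehartRing R L] [LieRinehartAlgebra k R L]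
  {ι : Type*} [Fintype ι] {lam : ι → L →ₗ[R] R} {e : ι → L} {t : ι → Jet k R L}

variable (k R) in
/-- The derivations of `JetJet` defined by a family of elements of `L`. -/
def jetJetDer (e : ι → L) : ι ⊕ ι → Derivation k (JetJet k R L) (JetJet k R L) :=
  Sum.elim (fun i => valueDer k R (e i)) (fun i => paramDer k R (e i))

variable (k R) in
/-- The filtration of `JetJet` by the order. -/
def jetJetOrd (e : ι → L) : ℕ → Ideal (JetJet k R L) :=
  ordIdeal (jetJetDer k R e) (RingHom.ker (jetJetCounit k R L))

/-- The coordinates of the bimodule tensor product. -/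
def tensorCoord (t : ι → Jet k R L) : ι ⊕ ι → JetTensor₂ k R L :=
  Sum.elim (fun i => inl _ _ (antipode k R L (t i))) (fun i => inr _ _ (t i))

theorem toJetJet_coord_inl (i : ι) :
    toJetJet k R L (tensorCoord t (Sum.inl i)) = constJet k R L (t i) := by
  rw [tensorCoord, Sum.elim_inl, toJetJet_inl, antipode_antipode]

theorem toJetJet_coord_inr (i : ι) :
    toJetJet k R L (tensorCoord t (Sum.inr i)) = scalarJet k R L (t i) := by
  rw [tensorCoord, Sum.elim_inr, toJetJet_inr]

theorem jetCounit_jetDer₂ (l : L) (α : Jet k R L) :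
    jetCounit k R L (jetDer₂ k R l α) = α (Env.vec k R L l) := by
  rw [jetCounit_apply, jetDer₂_apply, one_mul]

/-- Value and parameter derivations commute and each kills the coordinates of the other kind, so the
frame is assembled from two blocks, each behaving as in `JetCoords.isFrame`. -/
theorem JetCoords.isFrame_jetJet (h : JetCoords k lam e t) :
    IsFrame (jetJetDer k R e) (RingHom.ker (jetJetCounit k R L))
      (fun i => toJetJet k R L (tensorCoord t i)) where
  coord_mem i := by
    rcases i with i | i
    · rw [toJetJet_coord_inl, RingHom.mem_ker, jetJetCounit_constJet]; exact h.coord_one i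
    · rw [toJetJet_coord_inr, RingHom.mem_ker, jetJetCounit_scalarJet]; exact h.coord_one i
  der i := by
    rcases i with i | i
    · refine ⟨Sum.elim (fun j => constJet k R L (unit₂ k R L (lam j (e i)))) 0, ?_, fun a => ?_⟩
      · rintro (j | j)
        · rw [toJetJet_coord_inl, RingHom.mem_ker, jetJetDer, Sum.elim_inl, Sum.elim_inl,
            valueDer_constJet, map_sub, jetJetCounit_constJet, jetJetCounit_constJet,
            jetCounit_unit₂, jetCounit_jetDer₂, h.coord_vec, sub_self]
        · rw [toJetJet_coord_inr, jetJetDer, Sum.elim_inl, Sum.elim_inr, valueDer_scalarJet,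
            Pi.zero_apply, sub_zero]
          exact zero_mem _
      · rw [Fintype.sum_sum_type]
        simp only [jetJetDer, Sum.elim_inl, Sum.elim_inr, Pi.zero_apply, zero_mul,
          Finset.sum_const_zero, add_zero]
        exact valueDer_eq_sum h.sum_smul _ a
    · refine ⟨Sum.elim 0 (fun j => evalJet k L (lam j (e i))), ?_, fun a => ?_⟩
      · rintro (j | j)
        · rw [toJetJet_coord_inl, jetJetDer, Sum.elim_inr, Sum.elim_inl, paramDer_constJet,
            Pi.zero_apply, sub_zero]
          exact zero_mem _
        · rw [toJetJet_coord_inr, RingHom.mem_ker, jetJetDer, Sum.elim_inr, Sum.elim_inr,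
            paramDer_scalarJet, map_sub, jetJetCounit_scalarJet, jetJetCounit_evalJet,
            jetCounit_jetDer₂, h.coord_vec, sub_self]
      · rw [Fintype.sum_sum_type]
        simp only [jetJetDer, Sum.elim_inl, Sum.elim_inr, Pi.zero_apply, zero_mul,
          Finset.sum_const_zero, zero_add]
        exact paramDer_eq_sum h.sum_smul _ a
  bracket i j := by
    rcases i with i | i <;> rcases j with j | j
    · refine ⟨Sum.elim (fun m => constJet k R L (unit₂ k R L (lam m ⁅e i, e j⁆))) 0, fun a => ?_⟩
      rw [Fintype.sum_sum_type]
      simp only [jetJetDer, Sum.elim_inl, Sum.elim_inr, Pi.zero_apply, zero_mul,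
        Finset.sum_const_zero, add_zero]
      rw [← valueDer_lie]
      exact valueDer_eq_sum h.sum_smul _ a
    · exact ⟨0, fun a => by simp [jetJetDer, valueDer_paramDer]⟩
    · exact ⟨0, fun a => by simp [jetJetDer, valueDer_paramDer]⟩
    · refine ⟨Sum.elim 0 (fun m => evalJet k L (lam m ⁅e i, e j⁆)), fun a => ?_⟩
      rw [Fintype.sum_sum_type]
      simp only [jetJetDer, Sum.elim_inl, Sum.elim_inr, Pi.zero_apply, zero_mul,
        Finset.sum_const_zero, zero_add]
      rw [← paramDer_lie]
      exact paramDer_eq_sum h.sum_smul _ a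

theorem mem_jetJetOrd_succ {n : ℕ} {f : JetJet k R L} : f ∈ jetJetOrd k R e (n + 1) ↔
    f 1 1 = 0 ∧ (∀ i, valueDer k R (e i) f ∈ jetJetOrd k R e n) ∧
      ∀ i, paramDer k R (e i) f ∈ jetJetOrd k R e n := by
  refine mem_ordIdeal_succ.trans (and_congr Iff.rfl Sum.forall)

theorem valueDer_mem_jetJetOrd (he : ∀ x, ∑ i, lam i x • e i = x) (l : L) (n : ℕ)
    (f : JetJet k R L) (hf : f ∈ jetJetOrd k R e (n + 1)) :
    valueDer k R l f ∈ jetJetOrd k R e n := by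
  rw [valueDer_eq_sum he]
  exact sum_mem fun i _ => Ideal.mul_mem_left _ _ ((mem_jetJetOrd_succ.1 hf).2.1 i)

theorem paramDer_mem_jetJetOrd (he : ∀ x, ∑ i, lam i x • e i = x) (l : L) (n : ℕ)
    (f : JetJet k R L) (hf : f ∈ jetJetOrd k R e (n + 1)) :
    paramDer k R l f ∈ jetJetOrd k R e n := by
  rw [paramDer_eq_sum he]
  exact sum_mem fun i _ => Ideal.mul_mem_left _ _ ((mem_jetJetOrd_succ.1 hf).2.2 i)

theorem valueDer_diagDer (l m : L) (f : JetJet k R L) :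
    valueDer k R l (diagDer k R m f) = diagDer k R m (valueDer k R l f) :=
  JetJet.ext fun D => by
    rw [valueDer_apply, diagDer_apply, diagDer_apply, valueDer_apply, valueDer_apply, map_sub,
      jetDer₁_jetDer₂]

theorem paramDer_diagDer (l m : L) (f : JetJet k R L) :
    paramDer k R l (diagDer k R m f) = diagDer k R m (paramDer k R l f) :=
  JetJet.ext fun D => by
    rw [paramDer_apply, diagDer_apply, diagDer_apply, paramDer_apply, paramDer_apply, mul_assoc]

/-- The diagonal action is not given as a combination of the frame derivations, but it commutes with
them. Its value at the base point is made of $f(1)(1)$ and of first derivatives there, all zero when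
$f$ has order at least two. -/
theorem diagDer_mem_jetJetOrd (he : ∀ x, ∑ i, lam i x • e i = x) (l : L) (n : ℕ)
    (f : JetJet k R L) (hf : f ∈ jetJetOrd k R e (n + 1)) :
    diagDer k R l f ∈ jetJetOrd k R e n := by
  induction n generalizing f with
  | zero => exact mem_ordIdeal_zero _
  | succ n ih =>
    have hf' := mem_jetJetOrd_succ.1 hf
    refine mem_jetJetOrd_succ.2 ⟨?_, fun i => ?_, fun i => ?_⟩
    · have h₁ := (mem_jetJetOrd_succ.1 (valueDer_mem_jetJetOrd he l _ f hf)).1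
      have h₂ := (mem_jetJetOrd_succ.1 (paramDer_mem_jetJetOrd he l _ f hf)).1
      rw [valueDer_apply, jetDer₂_apply, one_mul] at h₁
      rw [paramDer_apply, one_mul] at h₂
      have : diagDer k R l f 1 1 =
          ⁅l, f 1 1⁆ - f 1 (Env.vec k R L l * 1) - f (Env.vec k R L l * 1) 1 := rfl
      rw [this, mul_one, h₁, h₂, hf'.1, lie_zero, sub_zero, sub_zero]
    · rw [valueDer_diagDer]; exact ih _ (hf'.2.1 i)
    · rw [paramDer_diagDer]; exact ih _ (hf'.2.2 i)

/-- Families of high order vanish on any given pair of differential operators. -/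
theorem JetCoords.exists_apply_apply_eq_zero (h : JetCoords k lam e t) (D E : Env k R L) :
    ∃ N, ∀ f ∈ jetJetOrd k R e N, f E D = 0 := by
  obtain ⟨p, hp⟩ := exists_rightTranslate_mem (δ := jetJetDer k R e)
    (K := RingHom.ker (jetJetCounit k R L)) h.sum_smul Sum.inr (fun i f => rfl) E
  obtain ⟨N, hN⟩ := h.exists_apply_eq_zero D
  -- Evaluation at the parameter `1` does not lower the order, since value derivations become
  -- ${}^2\nabla$. Together with translation by `E` this reduces the claim to single jets.
  have hev : ∀ n (f : JetJet k R L), f ∈ jetJetOrd k R e n → f 1 ∈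
      ordIdeal (fun i => jetDer₂ k R (e i)) (RingHom.ker (jetCounit k R L)) n := by
    intro n
    induction n with
    | zero => exact fun f _ => mem_ordIdeal_zero _
    | succ n ih =>
      intro f hf
      have hf' := mem_jetJetOrd_succ.1 hf
      exact mem_ordIdeal_succ.2 ⟨hf'.1, fun i => ih _ (hf'.2.1 i)⟩
  refine ⟨N + p, fun f hf => ?_⟩
  have : f (1 * E) D = 0 := hN _ (hev N _ (hp N f hf))
  rwa [one_mul] at this

/-- The filtration by the order is closed. -/
theorem mem_jetJetOrd_of_apply {n : ℕ} {f : JetJet k R L}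
    (hf : ∀ D E, ∃ g ∈ jetJetOrd k R e n, f E D = g E D) : f ∈ jetJetOrd k R e n := by
  induction n generalizing f with
  | zero => exact mem_ordIdeal_zero _
  | succ n ih =>
    refine mem_jetJetOrd_succ.2 ⟨?_, fun i => ih fun D E => ?_, fun i => ih fun D E => ?_⟩
    · obtain ⟨g, hg, h⟩ := hf 1 1
      exact h.trans (mem_jetJetOrd_succ.1 hg).1
    · obtain ⟨g, hg, h⟩ := hf (D * Env.vec k R L (e i)) E
      exact ⟨_, (mem_jetJetOrd_succ.1 hg).2.1 i, h⟩
    · obtain ⟨g, hg, h⟩ := hf D (E * Env.vec k R L (e i))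
      exact ⟨_, (mem_jetJetOrd_succ.1 hg).2.2 i, h⟩

/-! #### Derivations of the bimodule tensor products -/

theorem exists_leftTensorDer (l : L) :
    ∃ d : Derivation k (JetTensor₂ k R L) (JetTensor₂ k R L),
      (∀ a, d (inl _ _ a) = inl _ _ (jetDer₁ k R l a)) ∧ ∀ a, d (inr _ _ a) = 0 := by
  obtain ⟨d, h, h'⟩ := exists_derivation₂ (s := unit₁ k R L) (t := unit₂ k R L) (jetDer₁ k R l) 0
    fun r => by rw [jetDer₁_unit₂, Derivation.zero_apply, map_zero, map_zero]
  exact ⟨d, h, fun a => by rw [h', Derivation.zero_apply, map_zero]⟩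

theorem exists_rightTensorDer (l : L) :
    ∃ d : Derivation k (JetTensor₂ k R L) (JetTensor₂ k R L),
      (∀ a, d (inl _ _ a) = 0) ∧ ∀ a, d (inr _ _ a) = inr _ _ (jetDer₂ k R l a) := by
  obtain ⟨d, h, h'⟩ := exists_derivation₂ (s := unit₁ k R L) (t := unit₂ k R L) 0 (jetDer₂ k R l)
    fun r => by rw [jetDer₂_unit₁, Derivation.zero_apply, map_zero, map_zero]
  exact ⟨d, fun a => by rw [h, Derivation.zero_apply, map_zero], h'⟩

/-- Neither summand need respect the bimodule relation by itself. Together they do: ${}^2\nabla_l$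
on $1_2(r)$ and ${}^1\nabla_l$ on $1_1(r)$ give the matching elements attached to $l(r)$. -/
theorem exists_diagTensorDer (l : L) :
    ∃ d : Derivation k (JetTensor₂ k R L) (JetTensor₂ k R L),
      (∀ a, d (inl _ _ a) = inl _ _ (jetDer₂ k R l a)) ∧
        ∀ a, d (inr _ _ a) = inr _ _ (jetDer₁ k R l a) :=
  exists_derivation₂ (jetDer₂ k R l) (jetDer₁ k R l)
    fun r => by rw [jetDer₁_unit₁, jetDer₂_unit₂, inl_t]

variable (k R) in
/-- The derivation `¹∇_l ⊗ 1`. -/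
def leftTensorDer (l : L) : Derivation k (JetTensor₂ k R L) (JetTensor₂ k R L) :=
  (exists_leftTensorDer l).choose

variable (k R) in
/-- The derivation `1 ⊗ ²∇_l`. -/
def rightTensorDer (l : L) : Derivation k (JetTensor₂ k R L) (JetTensor₂ k R L) :=
  (exists_rightTensorDer l).choose

variable (k R) in
/-- The derivation `²∇_l ⊗ 1 + 1 ⊗ ¹∇_l`. -/
def diagTensorDer (l : L) : Derivation k (JetTensor₂ k R L) (JetTensor₂ k R L) :=
  (exists_diagTensorDer l).choose

theorem leftTensorDer_inl (l : L) (a : Jet k R L) :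
    leftTensorDer k R l (inl _ _ a) = inl _ _ (jetDer₁ k R l a) :=
  (exists_leftTensorDer l).choose_spec.1 a

theorem leftTensorDer_inr (l : L) (a : Jet k R L) : leftTensorDer k R l (inr _ _ a) = 0 :=
  (exists_leftTensorDer l).choose_spec.2 a

theorem rightTensorDer_inl (l : L) (a : Jet k R L) : rightTensorDer k R l (inl _ _ a) = 0 :=
  (exists_rightTensorDer l).choose_spec.1 a

theorem rightTensorDer_inr (l : L) (a : Jet k R L) :
    rightTensorDer k R l (inr _ _ a) = inr _ _ (jetDer₂ k R l a) :=
  (exists_rightTensorDer l).choose_spec.2 a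

theorem diagTensorDer_inl (l : L) (a : Jet k R L) :
    diagTensorDer k R l (inl _ _ a) = inl _ _ (jetDer₂ k R l a) :=
  (exists_diagTensorDer l).choose_spec.1 a

theorem diagTensorDer_inr (l : L) (a : Jet k R L) :
    diagTensorDer k R l (inr _ _ a) = inr _ _ (jetDer₁ k R l a) :=
  (exists_diagTensorDer l).choose_spec.2 a

theorem valueDer_toJetJet (l : L) (w : JetTensor₂ k R L) :
    valueDer k R l (toJetJet k R L w) = toJetJet k R L (leftTensorDer k R l w) :=
  toJetJet_der
    (fun a => by
      rw [leftTensorDer_inl, toJetJet_inl, toJetJet_inl, valueDer_constJet, jetDer₂_antipode])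
    (fun a => by rw [leftTensorDer_inr, toJetJet_inr, valueDer_scalarJet, map_zero]) w

theorem paramDer_toJetJet (l : L) (w : JetTensor₂ k R L) :
    paramDer k R l (toJetJet k R L w) = toJetJet k R L (rightTensorDer k R l w) :=
  toJetJet_der
    (fun a => by rw [rightTensorDer_inl, toJetJet_inl, paramDer_constJet, map_zero])
    (fun a => by rw [rightTensorDer_inr, toJetJet_inr, toJetJet_inr, paramDer_scalarJet]) w

theorem diagDer_toJetJet (l : L) (w : JetTensor₂ k R L) :
    diagDer k R l (toJetJet k R L w) = toJetJet k R L (diagTensorDer k R l w) :=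
  toJetJet_der
    (fun a => by
      rw [diagTensorDer_inl, toJetJet_inl, toJetJet_inl, diagDer_constJet, jetDer₁_antipode])
    (fun a => by rw [diagTensorDer_inr, toJetJet_inr, toJetJet_inr, diagDer_scalarJet]) w

variable (k R) in
/-- The derivations of the bimodule tensor product defined by a family of elements of `L`. -/
def tensorDer (e : ι → L) : ι ⊕ ι → Derivation k (JetTensor₂ k R L) (JetTensor₂ k R L) :=
  Sum.elim (fun i => leftTensorDer k R (e i)) (fun i => rightTensorDer k R (e i))

theorem toJetJet_mem_jetJetOrd_iff (n : ℕ) (w : JetTensor₂ k R L) :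
    toJetJet k R L w ∈ jetJetOrd k R e n ↔ w ∈ ordIdeal (tensorDer k R e)
      (ideal₂ (unit₁ k R L) (unit₂ k R L) (jetCounit k R L)) n :=
  map_mem_ordIdeal_iff (toJetJet k R L)
    (fun i w => by
      rcases i with i | i
      · exact valueDer_toJetJet (e i) w
      · exact paramDer_toJetJet (e i) w)
    toJetJet_mem_ker_iff n w

end JetJetFrame

end LieAlgebroid

theorem Ideal.map_mem_pow_of_forall {k A B : Type*} [CommRing k] [CommRing A] [CommRing B]
    [Algebra k A] [Algebra k B] {I : Ideal A} {K : Ideal B} (f : A →ₐ[k] B)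
    (hf : ∀ a ∈ I, f a ∈ K) (n : ℕ) {a : A} (ha : a ∈ I ^ n) : f a ∈ K ^ n :=
  Ideal.le_comap_pow f n (Ideal.pow_right_mono (show I ≤ K.comap f from hf) n ha)

theorem Ideal.map_eq_span_range {ι k A B : Type*} [CommRing k] [CommRing A] [CommRing B]
    [Algebra k A] [Algebra k B] {I : Ideal A} {z : ι → A} (hI : I = Ideal.span (Set.range z))
    (f : A →ₐ[k] B) : I.map f = Ideal.span (Set.range fun i => f (z i)) := by
  rw [hI, Ideal.map_span, ← Set.range_comp]
  rfl

namespace LieAlgebroid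

open FormalGroupoid

/-! ### Existence and characterization of the comultiplication -/

section

variable {k R L : Type*} [Field k] [CharZero k] [CommRing R] [Algebra k R] [LieRing L]
  [LieAlgebra k L] [Module R L] [LieRingModule L R] [LieRinehartRing R L]
  [LieRinehartAlgebra k R L]
  {ι : Type*} [Fintype ι] {lam : ι → L →ₗ[R] R} {e : ι → L} {t : ι → Jet k R L}

theorem antipode_mem_ker {α : Jet k R L} (hα : α ∈ RingHom.ker (jetCounit k R L)) :
    antipode k R L α ∈ RingHom.ker (jetCounit k R L) := by
  rw [RingHom.mem_ker, jetCounit_antipode]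
  exact hα

theorem JetCoords.ker_eq_span_antipode (h : JetCoords k lam e t) :
    RingHom.ker (jetCounit k R L) =
      Ideal.span (Set.range fun i => antipode k R L (t i)) := by
  refine le_antisymm (fun a ha => ?_) (Ideal.span_le.2 (Set.range_subset_iff.2 fun i =>
    antipode_mem_ker (h.coord_mem i)))
  have := Ideal.mem_map_of_mem (antipode k R L).toAlgHom (antipode_mem_ker ha)
  rw [Ideal.map_eq_span_range h.ker_eq_span] at this
  have h' : (antipode k R L).toAlgHom (antipode k R L a) = a := antipode_antipode a
  rw [h'] at this
  exact this

/-- The antipode carries the Euler derivation of ${}^2\nabla$ and $t$ to that of ${}^1\nabla$ and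
$S(t)$; this transports first-order estimates to the other side. -/
theorem sum_antipode_mul (a : Jet k R L) :
    ∑ i, antipode k R L (t i) * jetDer₁ k R (e i) (antipode k R L a) =
      antipode k R L (euler (fun i => jetDer₂ k R (e i)) t a) := by
  rw [euler_apply, map_sum]
  exact Finset.sum_congr rfl fun i _ => by rw [map_mul, jetDer₁_antipode]

theorem JetCoords.antipode_euler_sub_mem (h : JetCoords k lam e t) (i : ι) :
    antipode k R L (euler (fun i => jetDer₂ k R (e i)) t (t i)) - antipode k R L (t i) ∈
      RingHom.ker (jetCounit k R L) ^ 2 := by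
  rw [← map_sub]
  exact Ideal.map_mem_pow_of_forall (antipode k R L).toAlgHom (fun a ha => antipode_mem_ker ha) 2
    (h.euler_sub_mem i)

theorem JetCoords.ordIdeal_jetDer₂_le (h : JetCoords k lam e t) (n : ℕ) :
    ordIdeal (fun i => jetDer₂ k R (e i)) (RingHom.ker (jetCounit k R L)) n ≤
      RingHom.ker (jetCounit k R L) ^ n := (h.ordIdeal_eq_pow n).le

/-- The mirror image under $S$, with the coordinates $S(t_i)$. -/
theorem JetCoords.ordIdeal_jetDer₁_le (h : JetCoords k lam e t) (n : ℕ) :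
    ordIdeal (fun i => jetDer₁ k R (e i)) (RingHom.ker (jetCounit k R L)) n ≤
      RingHom.ker (jetCounit k R L) ^ n := by
  refine ordIdeal_le_pow (z := fun i => antipode k R L (t i))
    (fun i => antipode_mem_ker (h.coord_mem i)) h.ker_eq_span_antipode ?_ n
  rintro _ ⟨j, rfl⟩
  rw [euler_apply, sum_antipode_mul]
  exact h.antipode_euler_sub_mem j

theorem inl_mem_ideal₂ {a : Jet k R L} (ha : a ∈ RingHom.ker (jetCounit k R L)) :
    inl (unit₁ k R L) (unit₂ k R L) a ∈ ideal₂ (unit₁ k R L) (unit₂ k R L) (jetCounit k R L) :=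
  Ideal.mem_sup_left (Ideal.mem_map_of_mem _ ha)

theorem inr_mem_ideal₂ {a : Jet k R L} (ha : a ∈ RingHom.ker (jetCounit k R L)) :
    inr (unit₁ k R L) (unit₂ k R L) a ∈ ideal₂ (unit₁ k R L) (unit₂ k R L) (jetCounit k R L) :=
  Ideal.mem_sup_right (Ideal.mem_map_of_mem _ ha)

theorem JetCoords.ideal₂_eq_span (h : JetCoords k lam e t) :
    ideal₂ (unit₁ k R L) (unit₂ k R L) (jetCounit k R L) =
      Ideal.span (Set.range (tensorCoord t)) := by
  rw [tensorCoord, Set.Sum.elim_range, Ideal.span_union, ideal₂,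
    Ideal.map_eq_span_range h.ker_eq_span (inr (unit₁ k R L) (unit₂ k R L)),
    Ideal.map_eq_span_range h.ker_eq_span_antipode (inl (unit₁ k R L) (unit₂ k R L))]

/-- The left factor is measured by ${}^1\nabla$ with coordinates $S(t_i)$, the right one by
${}^2\nabla$ with $t_i$. Each derivation kills the other factor, so the Euler derivation splits and
is the identity on generators modulo the square. -/
theorem JetCoords.ordIdeal_tensorDer_le (h : JetCoords k lam e t) (n : ℕ) :
    ordIdeal (tensorDer k R e) (ideal₂ (unit₁ k R L) (unit₂ k R L) (jetCounit k R L)) n ≤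
      ideal₂ (unit₁ k R L) (unit₂ k R L) (jetCounit k R L) ^ n := by
  refine ordIdeal_le_pow (z := tensorCoord t) ?_ h.ideal₂_eq_span ?_ n
  · rintro (i | i)
    · exact inl_mem_ideal₂ (antipode_mem_ker (h.coord_mem i))
    · exact inr_mem_ideal₂ (h.coord_mem i)
  · rintro _ ⟨j | j, rfl⟩
    · have : euler (tensorDer k R e) (tensorCoord t) (tensorCoord t (Sum.inl j)) =
          inl (unit₁ k R L) (unit₂ k R L)
            (antipode k R L (euler (fun i => jetDer₂ k R (e i)) t (t j))) := by
        rw [euler_apply, Fintype.sum_sum_type, ← sum_antipode_mul, map_sum]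
        simp only [tensorDer, tensorCoord, Sum.elim_inl, Sum.elim_inr, leftTensorDer_inl,
          rightTensorDer_inl, mul_zero, Finset.sum_const_zero, add_zero, map_mul]
      rw [this, tensorCoord, Sum.elim_inl, ← map_sub]
      exact Ideal.map_mem_pow_of_forall (inl (unit₁ k R L) (unit₂ k R L))
        (fun a ha => inl_mem_ideal₂ ha) 2 (h.antipode_euler_sub_mem j)
    · have : euler (tensorDer k R e) (tensorCoord t) (tensorCoord t (Sum.inr j)) =
          inr (unit₁ k R L) (unit₂ k R L) (euler (fun i => jetDer₂ k R (e i)) t (t j)) := by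
        rw [euler_apply, Fintype.sum_sum_type, euler_apply, map_sum]
        simp only [tensorDer, tensorCoord, Sum.elim_inl, Sum.elim_inr, leftTensorDer_inr,
          rightTensorDer_inr, mul_zero, Finset.sum_const_zero, zero_add, map_mul]
      rw [this, tensorCoord, Sum.elim_inr, ← map_sub]
      exact Ideal.map_mem_pow_of_forall (inr (unit₁ k R L) (unit₂ k R L))
        (fun a ha => inr_mem_ideal₂ ha) 2 (h.euler_sub_mem j)

/-- The adic topology of the tensor product is the one induced from families of jets. With the
density in the next lemma, this identifies all truncations. -/
theorem JetCoords.toJetJet_mem_iff (h : JetCoords k lam e t) (n : ℕ) (w : JetTensor₂ k R L) :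
    toJetJet k R L w ∈ jetJetOrd k R e n ↔
      w ∈ ideal₂ (unit₁ k R L) (unit₂ k R L) (jetCounit k R L) ^ n := by
  rw [toJetJet_mem_jetJetOrd_iff]
  exact ⟨fun hw => h.ordIdeal_tensorDer_le n hw, fun hw => pow_le_ordIdeal n hw⟩

theorem JetCoords.exists_sub_toJetJet_mem (h : JetCoords k lam e t) (n : ℕ) (f : JetJet k R L) :
    ∃ w, f - toJetJet k R L w ∈ jetJetOrd k R e n :=
  h.isFrame_jetJet.exists_sub_mem (toJetJet k R L)
    (fun f => ⟨inr _ _ (unit₁ k R L (jetJetCounit k R L f)), by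
      rw [RingHom.mem_ker, map_sub, toJetJet_inr, jetJetCounit_scalarJet, jetCounit_unit₁,
        sub_self]⟩) n f

variable (k R) in
/-- The defining property of the comultiplication: `Δ α` is represented by `E ↦ S(²∇_E α)`. -/
def IsJetComul (e : ι → L) (Δ : Jet k R L →ₐ[k] JetTensor k R L) : Prop :=
  ∀ n α w, AdicCompletion.evalₐ _ n (Δ α) = Ideal.Quotient.mk _ w ↔
    toJetJet k R L w - translates k R L α ∈ jetJetOrd k R e n

theorem JetCoords.exists_comul (h : JetCoords k lam e t) :
    ∃ Δ : Jet k R L →ₐ[k] JetTensor k R L, IsJetComul k R e Δ :=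
  exists_lift_adicCompletion (A := Jet k R L) ordIdeal_antitone (toJetJet k R L)
    h.toJetJet_mem_iff h.exists_sub_toJetJet_mem (translatesHom k R L)

variable {Δ : Jet k R L →ₐ[k] JetTensor k R L}

/-- The pairings with all $D,E$ are the values of the corresponding family. Elements of high order
vanish at a given pair, which gives existence; closedness of the filtration under pointwise
approximation gives uniqueness. -/
theorem JetCoords.hasPairing_iff (h : JetCoords k lam e t) (hΔ : IsJetComul k R e Δ)
    (α : Jet k R L) (x : JetTensor k R L) :
    (∀ D E : Env k R L,
      HasPairing x D E (jetCounit k R L ((nabla₁ k R L).toEnd D (nabla₂ k R L E α)))) ↔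
        x = Δ α := by
  constructor
  · intro hx
    refine AdicCompletion.ext_evalₐ fun n => ?_
    obtain ⟨w, hw⟩ := Ideal.Quotient.mk_surjective (AdicCompletion.evalₐ _ n x)
    rw [← hw, eq_comm, hΔ]
    refine mem_jetJetOrd_of_apply fun D E => ?_
    obtain ⟨N, hN⟩ := hx D E
    -- A truncation at level `n + N` is fine enough for the pairing at this `D` and `E`, yet still
    -- agrees with `w` modulo order `n`. The finer representative may depend on `D` and `E`.
    obtain ⟨w', hw'⟩ := Ideal.Quotient.mk_surjective (AdicCompletion.evalₐ _ (n + N) x)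
    obtain ⟨y, rfl⟩ : ∃ y, mk₂ (unit₁ k R L) (unit₂ k R L) y = w' :=
      Ideal.Quotient.mk_surjective w'
    have hy := hN (n + N) (Nat.le_add_left N n) y hw'.symm
    rw [pairTensor_eq, ← translates_apply_apply] at hy
    refine ⟨toJetJet k R L (w - mk₂ _ _ y), ?_, ?_⟩
    · rw [h.toJetJet_mem_iff, ← Ideal.Quotient.eq, hw,
        ← factor_evalₐ (Nat.le_add_right n N), ← hw', Ideal.Quotient.factor_mk]
    · rw [map_sub]
      change toJetJet k R L w E D - translates k R L α E D =
        toJetJet k R L w E D - toJetJet k R L (mk₂ _ _ y) E D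
      rw [hy]
  · rintro rfl D E
    obtain ⟨N, hN⟩ := h.exists_apply_apply_eq_zero D E
    refine ⟨N, fun n hn y hy => ?_⟩
    rw [hΔ] at hy
    have h' : toJetJet k R L (mk₂ _ _ y) E D - translates k R L α E D = 0 :=
      hN _ (ordIdeal_antitone hn hy)
    rw [pairTensor_eq, sub_eq_zero.1 h', translates_apply_apply]

theorem IsJetComul.isCts (hΔ : IsJetComul k R e Δ) :
    IsCts (RingHom.ker (jetCounit k R L))
      (ideal₂ (unit₁ k R L) (unit₂ k R L) (jetCounit k R L)) Δ := by
  intro α hα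
  rw [← map_zero (Ideal.Quotient.mk _), hΔ, map_zero, zero_sub]
  refine neg_mem (mem_ordIdeal_one.2 ?_)
  rw [RingHom.mem_ker, jetJetCounit_translates]
  exact hα

theorem IsJetComul.map_unit₁ (hΔ : IsJetComul k R e Δ) (r : R) :
    Δ (unit₁ k R L r) = AdicCompletion.of _ _ (inl _ _ (unit₁ k R L r)) :=
  AdicCompletion.ext_evalₐ fun n => by
    rw [AdicCompletion.evalₐ_of, hΔ, toJetJet_inl, antipode_unit₁, translates_unit₁, sub_self]
    exact zero_mem _

theorem IsJetComul.map_unit₂ (hΔ : IsJetComul k R e Δ) (r : R) :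
    Δ (unit₂ k R L r) = AdicCompletion.of _ _ (inr _ _ (unit₂ k R L r)) :=
  AdicCompletion.ext_evalₐ fun n => by
    rw [AdicCompletion.evalₐ_of, hΔ, toJetJet_inr, translates_unit₂, sub_self]
    exact zero_mem _

theorem IsJetComul.isBimoduleMap (hΔ : IsJetComul k R e Δ) : IsBimoduleMap Δ where
  left r a := by rw [map_mul, hΔ.map_unit₁]
  right a r := by rw [map_mul, hΔ.map_unit₂]

theorem JetCoords.derives_left (h : JetCoords k lam e t) (hΔ : IsJetComul k R e Δ) (l : L)
    (α : Jet k R L) : Derives (leftTensorDer k R l) (Δ α) (Δ (jetDer₁ k R l α)) :=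
  derives_of_intertwine hΔ (valueDer_toJetJet l) (valueDer_mem_jetJetOrd h.sum_smul l)
    (valueDer_translates l α)

theorem JetCoords.derives_right (h : JetCoords k lam e t) (hΔ : IsJetComul k R e Δ) (l : L)
    (α : Jet k R L) : Derives (rightTensorDer k R l) (Δ α) (Δ (jetDer₂ k R l α)) :=
  derives_of_intertwine hΔ (paramDer_toJetJet l) (paramDer_mem_jetJetOrd h.sum_smul l)
    (paramDer_translates l α)

theorem JetCoords.derives_diag (h : JetCoords k lam e t) (hΔ : IsJetComul k R e Δ) (l : L)
    (α : Jet k R L) : Derives (diagTensorDer k R l) (Δ α) 0 := by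
  have := derives_of_intertwine hΔ (diagDer_toJetJet l) (diagDer_mem_jetJetOrd h.sum_smul l)
    (a := α) (b := 0) (by rw [diagDer_translates, map_zero])
  rwa [map_zero] at this

end

end LieAlgebroid

/-! ### The axioms of a formal groupoid -/

namespace FormalGroupoid

variable {k R A : Type*} [CommRing k] [CommRing R] [Algebra k R] [CommRing A] [Algebra k A]

section

variable {C : Type*} [CommRing C] [Algebra k C] {K : Ideal C} {δ : Derivation k C C}

theorem derives_of_eq {c c' : C} (h : δ c = c') :
    Derives δ (AdicCompletion.of K C c) (AdicCompletion.of K C c') := by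
  subst h
  exact derives_of c

theorem derives_of_eq_zero {c : C} (h : δ c = 0) : Derives δ (AdicCompletion.of K C c) 0 := by
  rw [← map_zero (AdicCompletion.of K C)]
  exact derives_of_eq h

theorem derives_zero (x : AdicCompletion K C) : Derives (0 : Derivation k C C) x 0 :=
  fun n c _ => by rw [Derivation.zero_apply, map_zero, map_zero]

end

variable {s t : R →ₐ[k] A} {ε : A →ₐ[k] R}

/-- The derivations `dl`, `dr`, `dd` of `A ⊗_R A` are `D₁ ⊗ 1`, `1 ⊗ D₂` and `D₂ ⊗ 1 + 1 ⊗ D₁`, and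
they map `Δ a` to `Δ (D₁ a)`, `Δ (D₂ a)` and zero. -/
structure IsInvariant (Δ : A →ₐ[k] CTensor₂ s t ε) (D₁ D₂ : Derivation k A A)
    (dl dr dd : Derivation k (Tensor₂ s t) (Tensor₂ s t)) : Prop where
  left_inl : ∀ a, dl (inl s t a) = inl s t (D₁ a)
  left_inr : ∀ a, dl (inr s t a) = 0
  right_inl : ∀ a, dr (inl s t a) = 0
  right_inr : ∀ a, dr (inr s t a) = inr s t (D₂ a)
  diag_inl : ∀ a, dd (inl s t a) = inl s t (D₂ a)
  diag_inr : ∀ a, dd (inr s t a) = inr s t (D₁ a)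
  derives_left : ∀ a, Derives dl (Δ a) (Δ (D₁ a))
  derives_right : ∀ a, Derives dr (Δ a) (Δ (D₂ a))
  derives_diag : ∀ a, Derives dd (Δ a) 0

/-- The derivations `d₁`, `d₂`, `d₃` of `A ⊗_R A ⊗_R A` are `D₁ ⊗ 1 ⊗ 1`,
`1 ⊗ (D₂ ⊗ 1 + 1 ⊗ D₁)` and `1 ⊗ 1 ⊗ D₂`. -/
structure IsTriple (D₁ D₂ : Derivation k A A)
    (d₁ d₂ d₃ : Derivation k (Tensor₃ s t) (Tensor₃ s t)) : Prop where
  first_in₁ : ∀ a, d₁ (in₁ s t a) = in₁ s t (D₁ a)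
  first_in₂ : ∀ a, d₁ (in₂ s t a) = 0
  first_in₃ : ∀ a, d₁ (in₃ s t a) = 0
  middle_in₁ : ∀ a, d₂ (in₁ s t a) = 0
  middle_in₂ : ∀ a, d₂ (in₂ s t a) = in₂ s t (D₂ a)
  middle_in₃ : ∀ a, d₂ (in₃ s t a) = in₃ s t (D₁ a)
  last_in₁ : ∀ a, d₃ (in₁ s t a) = 0
  last_in₂ : ∀ a, d₃ (in₂ s t a) = 0
  last_in₃ : ∀ a, d₃ (in₃ s t a) = in₃ s t (D₂ a)

variable {Δ : A →ₐ[k] CTensor₂ s t ε} {D₁ D₂ : Derivation k A A}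
  {dl dr dd : Derivation k (Tensor₂ s t) (Tensor₂ s t)}
  {d₁ d₂ d₃ : Derivation k (Tensor₃ s t) (Tensor₃ s t)}

section clift₂

variable {C : Type*} [CommRing C] [Algebra k C] {K : Ideal C} {δ : Derivation k C C}
  {f g : A →ₐ[k] AdicCompletion K C} (h : ∀ r, f (t r) = g (s r))
  (hf : IsCts (RingHom.ker ε) K f) (hg : IsCts (RingHom.ker ε) K g)

theorem IsInvariant.clift₂_left (hI : IsInvariant Δ D₁ D₂ dl dr dd)
    (hfd : ∀ a, Derives δ (f a) (f (D₁ a))) (hgd : ∀ a, Derives δ (g a) 0) (a : A) :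
    Derives δ (clift₂ ε f g h hf hg (Δ a)) (clift₂ ε f g h hf hg (Δ (D₁ a))) :=
  Derives.clift₂ h hf hg (δ₂ := fun _ => 0) hI.left_inl
    (fun a => by rw [hI.left_inr, map_zero]) hfd
    (fun a => by rw [map_zero]; exact hgd a) (hI.derives_left a)

theorem IsInvariant.clift₂_right (hI : IsInvariant Δ D₁ D₂ dl dr dd)
    (hfd : ∀ a, Derives δ (f a) 0) (hgd : ∀ a, Derives δ (g a) (g (D₂ a))) (a : A) :
    Derives δ (clift₂ ε f g h hf hg (Δ a)) (clift₂ ε f g h hf hg (Δ (D₂ a))) :=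
  Derives.clift₂ h hf hg (δ₁ := fun _ => 0) (fun a => by rw [hI.right_inl, map_zero])
    hI.right_inr (fun a => by rw [map_zero]; exact hfd a) hgd (hI.derives_right a)

theorem IsInvariant.clift₂_diag (hI : IsInvariant Δ D₁ D₂ dl dr dd)
    (hfd : ∀ a, Derives δ (f a) (f (D₂ a))) (hgd : ∀ a, Derives δ (g a) (g (D₁ a))) (a : A) :
    Derives δ (clift₂ ε f g h hf hg (Δ a)) 0 := by
  rw [← map_zero (clift₂ ε f g h hf hg)]
  exact Derives.clift₂ h hf hg hI.diag_inl hI.diag_inr hfd hgd (hI.derives_diag a)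

theorem derives_clift₂_zero (hfd : ∀ a, Derives δ (f a) 0) (hgd : ∀ a, Derives δ (g a) 0)
    (x : CTensor₂ s t ε) : Derives δ (clift₂ ε f g h hf hg x) 0 := by
  rw [← map_zero (clift₂ ε f g h hf hg)]
  refine Derives.clift₂ h hf hg (δ₁ := fun _ => 0) (δ₂ := fun _ => 0) (fun a => ?_) (fun a => ?_)
    (fun a => ?_) (fun a => ?_) (derives_zero x)
  · rw [Derivation.zero_apply, map_zero]
  · rw [Derivation.zero_apply, map_zero]
  · rw [map_zero]; exact hfd a
  · rw [map_zero]; exact hgd a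

end clift₂

/-! ### The axioms from invariance under derivations -/

section coassoc

theorem IsInvariant.first_in₁₂ (hI : IsInvariant Δ D₁ D₂ dl dr dd)
    (hT : IsTriple D₁ D₂ d₁ d₂ d₃) (a : A) :
    Derives d₁ (in₁₂ s t ε (Δ a)) (in₁₂ s t ε (Δ (D₁ a))) :=
  hI.clift₂_left _ _ _ (fun a => derives_of_eq (hT.first_in₁ a))
    (fun a => derives_of_eq_zero (hT.first_in₂ a)) a

theorem IsInvariant.middle_in₁₂ (hI : IsInvariant Δ D₁ D₂ dl dr dd)
    (hT : IsTriple D₁ D₂ d₁ d₂ d₃) (a : A) :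
    Derives d₂ (in₁₂ s t ε (Δ a)) (in₁₂ s t ε (Δ (D₂ a))) :=
  hI.clift₂_right _ _ _ (fun a => derives_of_eq_zero (hT.middle_in₁ a))
    (fun a => derives_of_eq (hT.middle_in₂ a)) a

theorem IsTriple.last_in₁₂ (hT : IsTriple D₁ D₂ d₁ d₂ d₃) (x : CTensor₂ s t ε) :
    Derives d₃ (in₁₂ s t ε x) 0 :=
  derives_clift₂_zero _ _ _ (fun a => derives_of_eq_zero (hT.last_in₁ a))
    (fun a => derives_of_eq_zero (hT.last_in₂ a)) x

theorem IsTriple.first_in₂₃ (hT : IsTriple D₁ D₂ d₁ d₂ d₃) (x : CTensor₂ s t ε) :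
    Derives d₁ (in₂₃ s t ε x) 0 :=
  derives_clift₂_zero _ _ _ (fun a => derives_of_eq_zero (hT.first_in₂ a))
    (fun a => derives_of_eq_zero (hT.first_in₃ a)) x

theorem IsInvariant.middle_in₂₃ (hI : IsInvariant Δ D₁ D₂ dl dr dd)
    (hT : IsTriple D₁ D₂ d₁ d₂ d₃) (a : A) : Derives d₂ (in₂₃ s t ε (Δ a)) 0 :=
  hI.clift₂_diag _ _ _ (fun a => derives_of_eq (hT.middle_in₂ a))
    (fun a => derives_of_eq (hT.middle_in₃ a)) a

theorem IsInvariant.last_in₂₃ (hI : IsInvariant Δ D₁ D₂ dl dr dd)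
    (hT : IsTriple D₁ D₂ d₁ d₂ d₃) (a : A) :
    Derives d₃ (in₂₃ s t ε (Δ a)) (in₂₃ s t ε (Δ (D₂ a))) :=
  hI.clift₂_right _ _ _ (fun a => derives_of_eq_zero (hT.last_in₂ a))
    (fun a => derives_of_eq (hT.last_in₃ a)) a

variable (hb : IsBimoduleMap Δ) (hc : IsCts (RingHom.ker ε) (ideal₂ s t ε) Δ)

theorem comulLeft_unit (r : R) :
    comulLeft Δ hb hc (Δ (s r)) = AdicCompletion.of _ _ (in₁ s t (s r)) := by
  rw [hb.map_s, comulLeft]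
  refine (clift₂_inl _ _ _ _ _ _).trans ?_
  rw [AlgHom.comp_apply, hb.map_s, in₁₂]
  exact clift₂_inl _ _ _ _ _ _

theorem comulRight_unit (r : R) :
    comulRight Δ hb hc (Δ (s r)) = AdicCompletion.of _ _ (in₁ s t (s r)) := by
  rw [hb.map_s, comulRight]
  exact clift₂_inl _ _ _ _ _ _

variable {ι : Type*} {D₁ D₂ : ι → Derivation k A A}
  {dl dr dd : ι → Derivation k (Tensor₂ s t) (Tensor₂ s t)}
  {d₁ d₂ d₃ : ι → Derivation k (Tensor₃ s t) (Tensor₃ s t)}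

/-- Both composites carry $D_1$ to the first derivation of the triple tensor product and $D_2$ to
the last, are killed by the middle one, and agree on $s(R)$; rigidity makes them equal. -/
theorem coassoc_of_isInvariant (hI : ∀ i, IsInvariant Δ (D₁ i) (D₂ i) (dl i) (dr i) (dd i))
    (hT : ∀ i, IsTriple (D₁ i) (D₂ i) (d₁ i) (d₂ i) (d₃ i)) (hs : ∀ r, ε (s r) = r)
    (hδ : ∀ n, ordIdeal (Sum.elim d₁ (Sum.elim d₂ d₃)) (ideal₃ s t ε) n ≤ ideal₃ s t ε ^ n)
    (a : A) : comulLeft Δ hb hc (Δ a) = comulRight Δ hb hc (Δ a) := by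
  have hL : IsCts (RingHom.ker ε) (ideal₃ s t ε) ((in₁₂ s t ε).comp Δ) :=
    hc.comp_clift₂ _ _ _ _ _
  have hR : IsCts (RingHom.ker ε) (ideal₃ s t ε) ((in₂₃ s t ε).comp Δ) :=
    hc.comp_clift₂ _ _ _ _ _
  refine eq_of_derives hδ (f := (comulLeft Δ hb hc).comp Δ) (g := (comulRight Δ hb hc).comp Δ)
    (Sum.elim (fun i => D₁ i) (Sum.elim (fun _ _ => 0) (fun i => D₂ i)))
    hs (hc.comp_clift₂ _ _ _ _ _) (hc.comp_clift₂ _ _ _ _ _) (fun r => ?_) ?_ ?_ a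
  · exact (comulLeft_unit hb hc r).trans (comulRight_unit hb hc r).symm
  · rintro (i | i | i) a
    · exact (hI i).clift₂_left _ hL (isCts_in₃ s t ε) ((hI i).first_in₁₂ (hT i))
        (fun a => derives_of_eq_zero ((hT i).first_in₃ a)) a
    · change Derives (d₂ i) (comulLeft Δ hb hc (Δ a)) (comulLeft Δ hb hc (Δ 0))
      rw [map_zero, map_zero]
      exact (hI i).clift₂_diag _ hL (isCts_in₃ s t ε) ((hI i).middle_in₁₂ (hT i))
        (fun a => derives_of_eq ((hT i).middle_in₃ a)) a
    · exact (hI i).clift₂_right _ hL (isCts_in₃ s t ε) (fun a => (hT i).last_in₁₂ (Δ a))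
        (fun a => derives_of_eq ((hT i).last_in₃ a)) a
  · rintro (i | i | i) a
    · exact (hI i).clift₂_left _ (isCts_in₁ s t ε) hR (fun a => derives_of_eq ((hT i).first_in₁ a))
        (fun a => (hT i).first_in₂₃ (Δ a)) a
    · change Derives (d₂ i) (comulRight Δ hb hc (Δ a)) (comulRight Δ hb hc (Δ 0))
      rw [map_zero, map_zero]
      exact derives_clift₂_zero _ (isCts_in₁ s t ε) hR (fun a => derives_of_eq_zero ((hT i).middle_in₁ a))
        ((hI i).middle_in₂₃ (hT i)) (Δ a)
    · exact (hI i).clift₂_right _ (isCts_in₁ s t ε) hR (fun a => derives_of_eq_zero ((hT i).last_in₁ a))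
        ((hI i).last_in₂₃ (hT i)) a

theorem isCts_unit_counit (u : R →ₐ[k] A) : IsCts (RingHom.ker ε) (RingHom.ker ε)
    ((ofₐ k (RingHom.ker ε)).comp (u.comp ε)) :=
  isCts_ofₐ fun a ha => by
    rw [RingHom.mem_ker] at ha
    rw [AlgHom.comp_apply, ha, map_zero]
    exact zero_mem _

variable (hs : ∀ r, ε (s r) = r) (ht : ∀ r, ε (t r) = r)

/-- Since $D_2$ kills $s(R)$, the map $a\mapsto\sum s(\epsilon(a_{(1)}))a_{(2)}$ commutes with
$D_2$, as the identity does. The other counit law uses $D_1$ and $t$. -/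
theorem counit_comul_of_isInvariant (hb : IsBimoduleMap Δ)
    (hc : IsCts (RingHom.ker ε) (ideal₂ s t ε) Δ)
    (hI : ∀ i, IsInvariant Δ (D₁ i) (D₂ i) (dl i) (dr i) (dd i))
    (hδ₂ : ∀ n, ordIdeal D₂ (RingHom.ker ε) n ≤ RingHom.ker ε ^ n)
    (hD₂ : ∀ i r, D₂ i (s r) = 0) (a : A) :
    counitLeft hs ht (Δ a) = AdicCompletion.of (RingHom.ker ε) _ a := by
  refine eq_of_derives hδ₂ (f := (counitLeft hs ht).comp Δ) (g := ofₐ k (RingHom.ker ε))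
    (fun i => D₂ i) hs (hc.comp_clift₂ _ _ _ _ _) isCts_id (fun r => ?_) (fun i a => ?_)
    (fun i a => derives_of _) a
  · rw [AlgHom.comp_apply, hb.map_s]
    refine (clift₂_inl _ _ _ _ _ _).trans ?_
    rw [AlgHom.comp_apply, AlgHom.comp_apply, hs]
  · exact (hI i).clift₂_right _ (isCts_unit_counit s) isCts_id
      (fun a => derives_of_eq_zero (hD₂ i (ε a)))
      (fun a => derives_of a) a

theorem comul_counit_of_isInvariant (hb : IsBimoduleMap Δ)
    (hc : IsCts (RingHom.ker ε) (ideal₂ s t ε) Δ)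
    (hI : ∀ i, IsInvariant Δ (D₁ i) (D₂ i) (dl i) (dr i) (dd i))
    (hδ₁ : ∀ n, ordIdeal D₁ (RingHom.ker ε) n ≤ RingHom.ker ε ^ n)
    (hD₁ : ∀ i r, D₁ i (t r) = 0) (a : A) :
    counitRight hs ht (Δ a) = AdicCompletion.of (RingHom.ker ε) _ a := by
  refine eq_of_derives hδ₁ (f := (counitRight hs ht).comp Δ) (g := ofₐ k (RingHom.ker ε))
    (fun i => D₁ i) hs (hc.comp_clift₂ _ _ _ _ _) isCts_id (fun r => ?_) (fun i a => ?_)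
    (fun i a => derives_of _) a
  · rw [AlgHom.comp_apply, hb.map_s]
    exact clift₂_inl _ _ _ _ _ _
  · exact (hI i).clift₂_left _ isCts_id (isCts_unit_counit t) (fun a => derives_of a)
      (fun a => derives_of_eq_zero (hD₁ i (ε a))) a

variable {S : A ≃ₐ[k] A} (hSt : ∀ r, S (t r) = s r) (hSs : ∀ r, S (s r) = t r)
  (hSε : ∀ a, ε (S a) = ε a)

theorem isCts_antipode (hSε : ∀ a, ε (S a) = ε a) : IsCts (RingHom.ker ε) (RingHom.ker ε)
    ((ofₐ k (RingHom.ker ε)).comp (S : A →ₐ[k] A)) :=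
  isCts_ofₐ fun a ha => (hSε a).trans ha

/-- $a\otimes b\mapsto S(a)b$ carries the diagonal derivation to $D_1$, because $D_1S=SD_2$. Hence
$\sum S(a_{(1)})a_{(2)}$ is annihilated by $D_1$, as is $t(\epsilon(a))$, and the two agree for
$a=s(r)$. -/
theorem antipode_comul_of_isInvariant (hs : ∀ r, ε (s r) = r) (hSs : ∀ r, S (s r) = t r)
    (hb : IsBimoduleMap Δ) (hc : IsCts (RingHom.ker ε) (ideal₂ s t ε) Δ)
    (hI : ∀ i, IsInvariant Δ (D₁ i) (D₂ i) (dl i) (dr i) (dd i))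
    (hδ₁ : ∀ n, ordIdeal D₁ (RingHom.ker ε) n ≤ RingHom.ker ε ^ n)
    (hD₁ : ∀ i r, D₁ i (t r) = 0) (hS : ∀ i a, D₁ i (S a) = S (D₂ i a)) (a : A) :
    antipodeLeft S hSt hSε (Δ a) = AdicCompletion.of (RingHom.ker ε) _ (t (ε a)) := by
  refine eq_of_derives hδ₁ (f := (antipodeLeft S hSt hSε).comp Δ)
    (g := (ofₐ k (RingHom.ker ε)).comp (t.comp ε)) (fun _ _ => 0) hs
    (hc.comp_clift₂ _ _ _ _ _) (isCts_unit_counit t) (fun r => ?_) (fun i a => ?_)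
    (fun i a => ?_) a
  · rw [AlgHom.comp_apply, hb.map_s]
    refine (clift₂_inl _ _ _ _ _ _).trans ?_
    rw [AlgHom.comp_apply, AlgHom.comp_apply, AlgHom.comp_apply, hs, ← hSs]
    rfl
  · rw [map_zero]
    exact (hI i).clift₂_diag _ (isCts_antipode hSε) isCts_id (fun a => derives_of_eq (hS i a))
      (fun a => derives_of a) a
  · rw [map_zero]
    exact derives_of_eq_zero (hD₁ i (ε a))

theorem comul_antipode_of_isInvariant (hs : ∀ r, ε (s r) = r)
    (hb : IsBimoduleMap Δ) (hc : IsCts (RingHom.ker ε) (ideal₂ s t ε) Δ)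
    (hI : ∀ i, IsInvariant Δ (D₁ i) (D₂ i) (dl i) (dr i) (dd i))
    (hδ₂ : ∀ n, ordIdeal D₂ (RingHom.ker ε) n ≤ RingHom.ker ε ^ n)
    (hD₂ : ∀ i r, D₂ i (s r) = 0) (hS : ∀ i a, D₂ i (S a) = S (D₁ i a)) (a : A) :
    antipodeRight S hSs hSε (Δ a) = AdicCompletion.of (RingHom.ker ε) _ (s (ε a)) := by
  refine eq_of_derives hδ₂ (f := (antipodeRight S hSs hSε).comp Δ)
    (g := (ofₐ k (RingHom.ker ε)).comp (s.comp ε)) (fun _ _ => 0) hs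
    (hc.comp_clift₂ _ _ _ _ _) (isCts_unit_counit s) (fun r => ?_) (fun i a => ?_)
    (fun i a => ?_) a
  · rw [AlgHom.comp_apply, hb.map_s]
    refine (clift₂_inl _ _ _ _ _ _).trans ?_
    rw [AlgHom.comp_apply, AlgHom.comp_apply, hs]
  · rw [map_zero]
    exact (hI i).clift₂_diag _ isCts_id (isCts_antipode hSε) (fun a => derives_of a)
      (fun a => derives_of_eq (hS i a)) a
  · rw [map_zero]
    exact derives_of_eq_zero (hD₂ i (ε a))

end coassoc

end FormalGroupoid

namespace LieAlgebroid

open FormalGroupoid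

/-! ### Derivations and coordinates of the triple tensor product -/

section TripleTensor

variable {k R L : Type*} [CommRing k] [CommRing R] [Algebra k R] [LieRing L] [LieAlgebra k L]
  [Module R L] [LieRingModule L R] [LieRinehartRing R L] [LieRinehartAlgebra k R L]

variable (k R L) in
/-- The uncompleted bimodule tensor product of three copies of the jet algebra. -/
abbrev JetTensor₃ : Type _ := Tensor₃ (unit₁ k R L) (unit₂ k R L)

variable (k R L) in
/-- The ideal of definition of the triple tensor product. -/
abbrev jetIdeal₃ : Ideal (JetTensor₃ k R L) :=
  ideal₃ (unit₁ k R L) (unit₂ k R L) (jetCounit k R L)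

theorem exists_firstDer (l : L) :
    ∃ d : Derivation k (JetTensor₃ k R L) (JetTensor₃ k R L),
      (∀ a, d (in₁ _ _ a) = in₁ _ _ (jetDer₁ k R l a)) ∧ (∀ a, d (in₂ _ _ a) = 0) ∧
        ∀ a, d (in₃ _ _ a) = 0 := by
  obtain ⟨d, h, h', h''⟩ := exists_derivation₃ (s := unit₁ k R L) (t := unit₂ k R L)
    (jetDer₁ k R l) 0 0
    (fun r => by rw [jetDer₁_unit₂, Derivation.zero_apply, map_zero, map_zero])
    (fun r => by rw [Derivation.zero_apply, Derivation.zero_apply, map_zero, map_zero])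
  exact ⟨d, h, fun a => by rw [h', Derivation.zero_apply, map_zero],
    fun a => by rw [h'', Derivation.zero_apply, map_zero]⟩

theorem exists_middleDer (l : L) :
    ∃ d : Derivation k (JetTensor₃ k R L) (JetTensor₃ k R L),
      (∀ a, d (in₁ _ _ a) = 0) ∧ (∀ a, d (in₂ _ _ a) = in₂ _ _ (jetDer₂ k R l a)) ∧
        ∀ a, d (in₃ _ _ a) = in₃ _ _ (jetDer₁ k R l a) := by
  obtain ⟨d, h, h', h''⟩ := exists_derivation₃ (s := unit₁ k R L) (t := unit₂ k R L)
    0 (jetDer₂ k R l) (jetDer₁ k R l)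
    (fun r => by rw [jetDer₂_unit₁, Derivation.zero_apply, map_zero, map_zero])
    (fun r => by rw [jetDer₂_unit₂, jetDer₁_unit₁, in₂_t])
  exact ⟨d, fun a => by rw [h, Derivation.zero_apply, map_zero], h', h''⟩

theorem exists_lastDer (l : L) :
    ∃ d : Derivation k (JetTensor₃ k R L) (JetTensor₃ k R L),
      (∀ a, d (in₁ _ _ a) = 0) ∧ (∀ a, d (in₂ _ _ a) = 0) ∧
        ∀ a, d (in₃ _ _ a) = in₃ _ _ (jetDer₂ k R l a) := by
  obtain ⟨d, h, h', h''⟩ := exists_derivation₃ (s := unit₁ k R L) (t := unit₂ k R L)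
    0 0 (jetDer₂ k R l)
    (fun r => by rw [Derivation.zero_apply, Derivation.zero_apply, map_zero, map_zero])
    (fun r => by rw [jetDer₂_unit₁, Derivation.zero_apply, map_zero, map_zero])
  exact ⟨d, fun a => by rw [h, Derivation.zero_apply, map_zero],
    fun a => by rw [h', Derivation.zero_apply, map_zero], h''⟩

variable (k R) in
/-- The derivation `¹∇_l ⊗ 1 ⊗ 1`. -/
def firstDer (l : L) : Derivation k (JetTensor₃ k R L) (JetTensor₃ k R L) :=
  (exists_firstDer l).choose

variable (k R) in
/-- The derivation `1 ⊗ (²∇_l ⊗ 1 + 1 ⊗ ¹∇_l)`. -/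
def middleDer (l : L) : Derivation k (JetTensor₃ k R L) (JetTensor₃ k R L) :=
  (exists_middleDer l).choose

variable (k R) in
/-- The derivation `1 ⊗ 1 ⊗ ²∇_l`. -/
def lastDer (l : L) : Derivation k (JetTensor₃ k R L) (JetTensor₃ k R L) :=
  (exists_lastDer l).choose

variable (l : L) (a : Jet k R L)

theorem firstDer_in₁ : firstDer k R l (in₁ _ _ a) = in₁ _ _ (jetDer₁ k R l a) :=
  (exists_firstDer l).choose_spec.1 a

theorem firstDer_in₂ : firstDer k R l (in₂ _ _ a) = 0 := (exists_firstDer l).choose_spec.2.1 a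

theorem firstDer_in₃ : firstDer k R l (in₃ _ _ a) = 0 := (exists_firstDer l).choose_spec.2.2 a

theorem middleDer_in₁ : middleDer k R l (in₁ _ _ a) = 0 := (exists_middleDer l).choose_spec.1 a

theorem middleDer_in₂ : middleDer k R l (in₂ _ _ a) = in₂ _ _ (jetDer₂ k R l a) :=
  (exists_middleDer l).choose_spec.2.1 a

theorem middleDer_in₃ : middleDer k R l (in₃ _ _ a) = in₃ _ _ (jetDer₁ k R l a) :=
  (exists_middleDer l).choose_spec.2.2 a

theorem lastDer_in₁ : lastDer k R l (in₁ _ _ a) = 0 := (exists_lastDer l).choose_spec.1 a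

theorem lastDer_in₂ : lastDer k R l (in₂ _ _ a) = 0 := (exists_lastDer l).choose_spec.2.1 a

theorem lastDer_in₃ : lastDer k R l (in₃ _ _ a) = in₃ _ _ (jetDer₂ k R l a) :=
  (exists_lastDer l).choose_spec.2.2 a

variable {l a}

theorem in₁_mem_ideal₃ (ha : a ∈ RingHom.ker (jetCounit k R L)) :
    in₁ _ _ a ∈ jetIdeal₃ k R L :=
  Ideal.mem_sup_left (Ideal.mem_sup_left (Ideal.mem_map_of_mem _ ha))

theorem in₂_mem_ideal₃ (ha : a ∈ RingHom.ker (jetCounit k R L)) :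
    in₂ _ _ a ∈ jetIdeal₃ k R L :=
  Ideal.mem_sup_left (Ideal.mem_sup_right (Ideal.mem_map_of_mem _ ha))

theorem in₃_mem_ideal₃ (ha : a ∈ RingHom.ker (jetCounit k R L)) :
    in₃ _ _ a ∈ jetIdeal₃ k R L :=
  Ideal.mem_sup_right (Ideal.mem_map_of_mem _ ha)

variable {ι : Type*}

variable (k R) in
/-- The derivations of the triple tensor product defined by a family of elements of `L`. -/
def tripleDer (e : ι → L) : ι ⊕ ι ⊕ ι → Derivation k (JetTensor₃ k R L) (JetTensor₃ k R L) :=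
  Sum.elim (fun i => firstDer k R (e i))
    (Sum.elim (fun i => middleDer k R (e i)) (fun i => lastDer k R (e i)))

/-- The coordinates dual to `tripleDer`. -/
def tripleCoord (t : ι → Jet k R L) : ι ⊕ ι ⊕ ι → JetTensor₃ k R L :=
  Sum.elim (fun i => in₁ _ _ (antipode k R L (t i)))
    -- The middle derivation acts on the third factor by ${}^1\nabla$, to first order minus
    -- ${}^2\nabla$ on the $t_i$. Adding the second-factor coordinate to the third makes the sum
    -- constant to first order in the middle direction.
    (Sum.elim (fun i => in₂ _ _ (t i)) (fun i => in₃ _ _ (t i) + in₂ _ _ (t i)))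

theorem euler_tripleDer [Fintype ι] (e : ι → L) (t : ι → Jet k R L) (x : JetTensor₃ k R L) :
    euler (tripleDer k R e) (tripleCoord t) x =
      ∑ i, in₁ _ _ (antipode k R L (t i)) * firstDer k R (e i) x +
        (∑ i, in₂ _ _ (t i) * middleDer k R (e i) x +
          ∑ i, (in₃ _ _ (t i) + in₂ _ _ (t i)) * lastDer k R (e i) x) := by
  rw [euler_apply, Fintype.sum_sum_type, Fintype.sum_sum_type]
  rfl

end TripleTensor

/-! ### Verification of the axioms for jets -/

section Axioms

variable {k R L : Type*} [Field k] [CharZero k] [CommRing R] [Algebra k R] [LieRing L]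
  [LieAlgebra k L] [Module R L] [LieRingModule L R] [LieRinehartRing R L]
  [LieRinehartAlgebra k R L]
  {ι : Type*} [Fintype ι] {lam : ι → L →ₗ[R] R} {e : ι → L} {t : ι → Jet k R L}

/-- The counit of ${}^1\nabla_l\alpha+{}^2\nabla_l\alpha$ is $l(\alpha(1))$, and the coordinates
vanish at $1$. -/
theorem JetCoords.jetDer₁_add_jetDer₂_mem (h : JetCoords k lam e t) (i j : ι) :
    jetDer₁ k R (e i) (t j) + jetDer₂ k R (e i) (t j) ∈ RingHom.ker (jetCounit k R L) := by
  rw [RingHom.mem_ker, map_add, jetCounit_jetDer₂, jetCounit_apply, jetDer₁_apply, mul_one,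
    h.coord_one, lie_zero, zero_sub, neg_add_cancel]

theorem JetCoords.ideal₃_eq_span (h : JetCoords k lam e t) : jetIdeal₃ k R L =
    Ideal.span ((Set.range (fun i => in₁ (unit₁ k R L) (unit₂ k R L) (antipode k R L (t i))) ∪
      Set.range (fun i => in₂ (unit₁ k R L) (unit₂ k R L) (t i))) ∪
        Set.range (fun i => in₃ (unit₁ k R L) (unit₂ k R L) (t i))) := by
  rw [Ideal.span_union, Ideal.span_union, jetIdeal₃, ideal₃,
    Ideal.map_eq_span_range h.ker_eq_span_antipode (in₁ (unit₁ k R L) (unit₂ k R L)),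
    Ideal.map_eq_span_range h.ker_eq_span (in₂ (unit₁ k R L) (unit₂ k R L)),
    Ideal.map_eq_span_range h.ker_eq_span (in₃ (unit₁ k R L) (unit₂ k R L))]

theorem JetCoords.ordIdeal_tripleDer_le (h : JetCoords k lam e t) (n : ℕ) :
    ordIdeal (tripleDer k R e) (jetIdeal₃ k R L) n ≤ jetIdeal₃ k R L ^ n := by
  refine ordIdeal_le_pow (z := tripleCoord t) ?_ h.ideal₃_eq_span ?_ n
  · rintro (i | i | i)
    · exact in₁_mem_ideal₃ (antipode_mem_ker (h.coord_mem i))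
    · exact in₂_mem_ideal₃ (h.coord_mem i)
    · exact add_mem (in₃_mem_ideal₃ (h.coord_mem i)) (in₂_mem_ideal₃ (h.coord_mem i))
  · rintro _ ((⟨j, rfl⟩ | ⟨j, rfl⟩) | ⟨j, rfl⟩)
    · simp only [euler_tripleDer, firstDer_in₁, middleDer_in₁, lastDer_in₁, mul_zero,
        Finset.sum_const_zero, add_zero, ← map_mul]
      rw [← map_sum, sum_antipode_mul, ← map_sub]
      exact Ideal.map_mem_pow_of_forall (in₁ (unit₁ k R L) (unit₂ k R L))
        (fun a ha => in₁_mem_ideal₃ ha) 2 (h.antipode_euler_sub_mem j)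
    · simp only [euler_tripleDer, firstDer_in₂, middleDer_in₂, lastDer_in₂, mul_zero,
        Finset.sum_const_zero, add_zero, zero_add, ← map_mul]
      rw [← map_sum, ← euler_apply, ← map_sub]
      exact Ideal.map_mem_pow_of_forall (in₂ (unit₁ k R L) (unit₂ k R L))
        (fun a ha => in₂_mem_ideal₃ ha) 2 (h.euler_sub_mem j)
    -- The mixed terms come from the middle derivation and from the shift in the last coordinate.
    -- They combine to ${}^1\nabla+{}^2\nabla$ of a coordinate, which lies in the ideal, so their
    -- products with the second-factor coordinates are in its square.
    · have : euler (tripleDer k R e) (tripleCoord t) (in₃ _ _ (t j)) - in₃ _ _ (t j) =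
          ∑ i, in₂ _ _ (t i) *
              in₃ _ _ (jetDer₁ k R (e i) (t j) + jetDer₂ k R (e i) (t j)) +
            in₃ _ _ (euler (fun i => jetDer₂ k R (e i)) t (t j) - t j) := by
        rw [euler_tripleDer, euler_apply]
        simp only [firstDer_in₃, middleDer_in₃, lastDer_in₃, mul_zero, Finset.sum_const_zero,
          zero_add, map_sub, map_sum, map_mul, map_add, mul_add, add_mul, Finset.sum_add_distrib]
        ring
      rw [this]
      refine add_mem (sum_mem fun i _ => ?_) ?_
      · rw [pow_two]
        exact Ideal.mul_mem_mul (in₂_mem_ideal₃ (h.coord_mem i))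
          (in₃_mem_ideal₃ (h.jetDer₁_add_jetDer₂_mem i j))
      · exact Ideal.map_mem_pow_of_forall (in₃ (unit₁ k R L) (unit₂ k R L))
          (fun a ha => in₃_mem_ideal₃ ha) 2 (h.euler_sub_mem j)

variable {Δ : Jet k R L →ₐ[k] JetTensor k R L}

theorem JetCoords.isInvariant (h : JetCoords k lam e t) (hΔ : IsJetComul k R e Δ) (l : L) :
    IsInvariant Δ (jetDer₁ k R l) (jetDer₂ k R l) (leftTensorDer k R l) (rightTensorDer k R l)
      (diagTensorDer k R l) where
  left_inl := leftTensorDer_inl l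
  left_inr := leftTensorDer_inr l
  right_inl := rightTensorDer_inl l
  right_inr := rightTensorDer_inr l
  diag_inl := diagTensorDer_inl l
  diag_inr := diagTensorDer_inr l
  derives_left := h.derives_left hΔ l
  derives_right := h.derives_right hΔ l
  derives_diag := h.derives_diag hΔ l

theorem isTriple (l : L) : IsTriple (jetDer₁ k R l) (jetDer₂ k R l) (firstDer k R l)
    (middleDer k R l) (lastDer k R l) where
  first_in₁ := firstDer_in₁ l
  first_in₂ := firstDer_in₂ l
  first_in₃ := firstDer_in₃ l
  middle_in₁ := middleDer_in₁ l
  middle_in₂ := middleDer_in₂ l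
  middle_in₃ := middleDer_in₃ l
  last_in₁ := lastDer_in₁ l
  last_in₂ := lastDer_in₂ l
  last_in₃ := lastDer_in₃ l

theorem JetCoords.isFormalGroupoid (h : JetCoords k lam e t) (hΔ : IsJetComul k R e Δ) :
    IsFormalGroupoid (unit₁ k R L) (unit₂ k R L) (jetCounit k R L) Δ (antipode k R L) where
  complete := h.isAdicComplete
  counit_s := jetCounit_unit₁
  counit_t := jetCounit_unit₂
  counit_bimodule r a r' := by rw [map_mul, map_mul, jetCounit_unit₁, jetCounit_unit₂]
  comul_bimodule := hΔ.isBimoduleMap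
  comul_cts := hΔ.isCts
  coassoc := coassoc_of_isInvariant _ _ (fun i => h.isInvariant hΔ (e i)) (fun i => isTriple (e i))
    jetCounit_unit₁ h.ordIdeal_tripleDer_le
  counit_comul := counit_comul_of_isInvariant _ _ hΔ.isBimoduleMap hΔ.isCts
    (fun i => h.isInvariant hΔ (e i)) h.ordIdeal_jetDer₂_le fun i => jetDer₂_unit₁ (e i)
  comul_counit := comul_counit_of_isInvariant _ _ hΔ.isBimoduleMap hΔ.isCts
    (fun i => h.isInvariant hΔ (e i)) h.ordIdeal_jetDer₁_le fun i => jetDer₁_unit₂ (e i)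
  antipode_s := antipode_unit₁
  antipode_t := antipode_unit₂
  counit_antipode := jetCounit_antipode
  antipode_comul := antipode_comul_of_isInvariant _ _ jetCounit_unit₁ antipode_unit₁ hΔ.isBimoduleMap
    hΔ.isCts (fun i => h.isInvariant hΔ (e i)) h.ordIdeal_jetDer₁_le
    (fun i => jetDer₁_unit₂ (e i)) fun i => jetDer₁_antipode (e i)
  comul_antipode := comul_antipode_of_isInvariant _ _ jetCounit_unit₁ hΔ.isBimoduleMap
    hΔ.isCts (fun i => h.isInvariant hΔ (e i)) h.ordIdeal_jetDer₂_le
    (fun i => jetDer₂_unit₁ (e i)) fun i => jetDer₂_antipode (e i)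

end Axioms

end LieAlgebroid

end

open FormalGroupoid LieAlgebroid in
theorem mainTheorem10 {k R L : Type*} [Field k] [CharZero k] [CommRing R] [Algebra k R]
    [LieRing L] [LieAlgebra k L] [Module R L] [LieRingModule L R] [LieRinehartRing R L]
    [LieRinehartAlgebra k R L] [Module.Finite R L] [Module.Projective R L] (d : ℕ)
    (hd : ∀ p : PrimeSpectrum R, Module.rankAtStalk L p = d) :
    ∃ (Δ : Jet k R L →ₐ[k] JetTensor k R L) (S : Jet k R L ≃ₐ[k] Jet k R L),
      (∀ (α : Jet k R L) (x : JetTensor k R L),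
        (∀ D E : Env k R L,
          HasPairing x D E (jetCounit k R L ((nabla₁ k R L).toEnd D (nabla₂ k R L E α)))) ↔
            x = Δ α) ∧
      (∀ α β : Jet k R L, (∀ D : Env k R L, pair₁ D β = pair₂ D α) ↔ β = S α) ∧
      IsFormalGroupoid (unit₁ k R L) (unit₂ k R L) (jetCounit k R L) Δ S ∧
      (∀ α, S (S α) = α) := by
  -- The coordinates are auxiliary: the comultiplication built from them is characterized by the
  -- pairing, which does not involve them.
  obtain ⟨n, lam, e, t, h⟩ := exists_jetCoords (k := k) (R := R) (L := L)
  obtain ⟨Δ, hΔ⟩ := h.exists_comul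
  exact ⟨Δ, antipode k R L, h.hasPairing_iff hΔ, pair₁_eq_pair₂_iff, h.isFormalGroupoid hΔ,
    antipode_antipode⟩
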